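/- Let $G$ be the group of real points of a simply connected, absolutely simple linear algebraic group over $\mathbb R$, with Lie algebra $\mathfrak g$. Let $P=MN$ be a maximal parabolic subgroup with abelian unipotent radical $N$ such that $P$ is conjugate in $G$ to the opposite parabolic $\bar P=M\bar N$; equivalently, there is $h\in\mathfrak g$, $h\neq 0$, with $\mathfrak g=\bar{\mathfrak n}\oplus\mathfrak m\oplus\mathfrak n$ the decomposition into the eigenspaces of $\operatorname{ad}h$ for $-2,0,2$, where $M$ is the centralizer of $h$ in $G$, $N=\exp\mathfrak n$, $\bar N=\exp\bar{\mathfrak n}$. Identify $\bar N$ with $\bar{\mathfrak n}$ by the exponential map. Let $\kappa$ be a fixed nonzero real multiple of the Killing form of $\mathfrak g$, put $\langle n,y\rangle=\kappa(\log n,\log y)$ and $\psi_y(n)=e^{\sqrt{-1}\langle n,y\rangle}$ for $n\in N$, $y\in\bar N$. Let $\omega\subseteq\bar N$ be an $M$-orbit (for the conjugation action), a smooth manifold. Let $dx$ be a nonzero locally finite Borel measure on $\omega$ and $\nu:M\to\mathbb C^\times$ a smooth character such that $d(mx)=|\nu(m)|^{-2}dx$ for $m\in M$. Let $\pi$ be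 a (strongly continuous) unitary representation of $G$ on $\mathcal H=L^2(\omega,dx)$ such that, for $f\in\mathcal H$, $$\pi(m)f(y)=\nu(m)f(m^{-1}y)\quad(m\in M),\qquad \pi(n)f(y)=\psi_y(n)f(y)\quad(n\in N).$$ Let $\mathcal H^\infty$ be the space of $G$-smooth vectors, with the topology given by the semi-norms $v\mapsto\|d\pi(u)v\|$, $u\in U(\mathfrak g)$. Then every element of $\mathcal H^\infty$ is represented by a unique smooth function on $\omega$, so that $f(x)$ makes sense for $f\in\mathcal H^\infty$ and $x\in\omega$. Assume that for every $X\in\mathfrak g$ there is a linear differential operator $D_X$ on $\omega$, of finite order and with smooth coefficients (for instance a regular, that is, algebraic one), such that $d\pi(X)f=D_Xf$ for all $f\in\mathcal H^\infty$ and such that $D_X$ is anti-symmetric: $$\int_\omega D_X\varphi\cdot\bar f\,dx=-\int_\omega\varphi\cdot\overline{D_Xf}\,dx\qquad\text{for all }\varphi\in C_c^\infty(\omega),\ f\in C^\infty(\omega).$$ Let $x\in\bar N$, and let $\ell$ be a continuous linear functional on $\mathcal H^\infty$ such that $\ell(\pi(n)f)=\psi_x(n)\ell(f)$ for all $n\in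 N$ and $f\in\mathcal H^\infty$. 1. If $x$ is not in the topological closure of $\omega$, then $\ell=0$. 2. If $x\in\omega$, then there is $\lambda\in\mathbb C$ such that $\ell(f)=\lambda f(x)$ for all $f\in\mathcal H^\infty$. -/

import Mathlib

open scoped Topology ContDiff TensorProduct
open MeasureTheory

attribute [local instance] LieRing.ofAssociativeRing

noncomputable section

/-! ## Real algebraic groups and their Lie algebras -/

/-- A linear algebraic group defined over `ℝ`: the group of complex points, given inside `SL_d(ℂ)` as
the zero locus of a set of polynomials with real coefficients in the matrix entries. -/
structure RealAlgebraicGroup (d : ℕ) where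
  complexPoints : Subgroup (Matrix.SpecialLinearGroup (Fin d) ℂ)
  exists_equations : ∃ S : Set (MvPolynomial (Fin d × Fin d) ℝ),
    ∀ g : Matrix.SpecialLinearGroup (Fin d) ℂ, g ∈ complexPoints ↔
      ∀ p ∈ S, MvPolynomial.aeval (fun ij : Fin d × Fin d => (g : Matrix (Fin d) (Fin d) ℂ) ij.1 ij.2) p = 0

namespace RealAlgebraicGroup

variable {d : ℕ} (G : RealAlgebraicGroup d)

/-- The group of real points. -/
def realPoints : Subgroup (Matrix.SpecialLinearGroup (Fin d) ℝ) :=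
  G.complexPoints.comap (Matrix.SpecialLinearGroup.map (algebraMap ℝ ℂ))

section LieAlgebraConstruction

attribute [local instance] Matrix.linftyOpNormedRing Matrix.linftyOpNormedAlgebra

theorem norm_pow_sub_pow_le {A : Type*} [NormedRing A] (h1 : ‖(1 : A)‖ ≤ 1) {a b : A} {R : ℝ}
    (hR : 1 ≤ R) (ha : ‖a‖ ≤ R) (hb : ‖b‖ ≤ R) (n : ℕ) :
    ‖a ^ n - b ^ n‖ ≤ n * R ^ n * ‖a - b‖ := by
  have hpow : ∀ k : ℕ, ‖a ^ k‖ ≤ R ^ k := by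
    intro k
    induction k with
    | zero => simpa using h1
    | succ k ih =>
      rw [pow_succ, pow_succ]
      exact (norm_mul_le _ _).trans (mul_le_mul ih ha (norm_nonneg _) (by positivity))
  induction n with
  | zero => simp
  | succ n ih =>
    have e : a ^ (n + 1) - b ^ (n + 1) = a ^ n * (a - b) + (a ^ n - b ^ n) * b := by
      rw [pow_succ, pow_succ]; noncomm_ring
    rw [e]
    have h2 : ‖a ^ n * (a - b)‖ ≤ R ^ (n + 1) * ‖a - b‖ := by
      refine (norm_mul_le _ _).trans (mul_le_mul_of_nonneg_right ((hpow n).trans ?_) (norm_nonneg _))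
      exact pow_le_pow_right₀ hR (Nat.le_succ n)
    have h3 : ‖(a ^ n - b ^ n) * b‖ ≤ (n * R ^ n * ‖a - b‖) * R :=
      (norm_mul_le _ _).trans (mul_le_mul ih hb (norm_nonneg _) (by positivity))
    refine (norm_add_le _ _).trans ((add_le_add h2 h3).trans (le_of_eq ?_))
    push_cast
    ring

/-- If `c` is a curve through `1` with velocity `Z`, then `c (1/k) ^ k` tends to `exp Z`. -/
theorem tendsto_curve_pow {A : Type*} [NormedRing A] [NormedAlgebra ℝ A] [CompleteSpace A]
    (h1 : ‖(1 : A)‖ ≤ 1) (c : ℝ → A) (Z : A) (h0 : c 0 = 1) (hc : HasDerivAt c Z 0) :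
    Filter.Tendsto (fun k : ℕ => c (1 / ((k : ℝ) + 1)) ^ (k + 1)) Filter.atTop
      (𝓝 (NormedSpace.exp Z)) := by
  have hb : HasDerivAt (fun t : ℝ => NormedSpace.exp (t • Z)) Z 0 := by
    simpa using hasDerivAt_exp_smul_const (𝕂 := ℝ) Z (0 : ℝ)
  have hlim : Filter.Tendsto (fun k : ℕ => 1 / ((k : ℝ) + 1)) Filter.atTop (𝓝 0) :=
    tendsto_one_div_add_atTop_nhds_zero_nat
  obtain ⟨C₁, hC₁⟩ := hc.differentiableAt.isBigO_sub.bound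
  obtain ⟨C₂, hC₂⟩ := hb.differentiableAt.isBigO_sub.bound
  have he : (fun t : ℝ => c t - NormedSpace.exp (t • Z)) =o[𝓝 0] fun t => t := by
    have := (hc.sub hb).isLittleO
    simpa [h0] using this
  set C := max (max C₁ C₂) 0 with hC
  have key : Filter.Tendsto
      (fun k : ℕ => c (1 / ((k : ℝ) + 1)) ^ (k + 1) - NormedSpace.exp Z) Filter.atTop (𝓝 0) := by
    rw [Metric.tendsto_nhds]
    intro ε hε
    have hε' : 0 < ε / (2 * Real.exp C) := by positivity
    filter_upwards [hlim.eventually hC₁, hlim.eventually hC₂, hlim.eventually (he.bound hε')]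
      with k k1 k2 k3
    set t : ℝ := 1 / ((k : ℝ) + 1) with ht
    have hk : (0 : ℝ) < (k : ℝ) + 1 := by positivity
    have htpos : 0 < t := by positivity
    have htn : ‖t‖ = t := by rw [Real.norm_eq_abs, abs_of_pos htpos]
    simp only [sub_zero, htn, h0, zero_smul, NormedSpace.exp_zero] at k1 k2 k3
    have hC0 : 0 ≤ C := le_max_right _ _
    have hA : ‖c t‖ ≤ 1 + C * t := by
      have h2 : C₁ * t ≤ C * t :=
        mul_le_mul_of_nonneg_right ((le_max_left _ _).trans (le_max_left _ _)) htpos.le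
      calc ‖c t‖ = ‖1 + (c t - 1)‖ := by congr 1; abel
        _ ≤ ‖(1 : A)‖ + ‖c t - 1‖ := norm_add_le _ _
        _ ≤ 1 + C * t := by linarith
    have hB : ‖NormedSpace.exp (t • Z)‖ ≤ 1 + C * t := by
      have h2 : C₂ * t ≤ C * t :=
        mul_le_mul_of_nonneg_right ((le_max_right _ _).trans (le_max_left _ _)) htpos.le
      calc ‖NormedSpace.exp (t • Z)‖ = ‖1 + (NormedSpace.exp (t • Z) - 1)‖ := by congr 1; abel
        _ ≤ ‖(1 : A)‖ + ‖NormedSpace.exp (t • Z) - 1‖ := norm_add_le _ _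
        _ ≤ 1 + C * t := by linarith
    have hpowB : NormedSpace.exp (t • Z) ^ (k + 1) = NormedSpace.exp Z := by
      let _ : NormedAlgebra ℚ A := NormedAlgebra.restrictScalars ℚ ℝ A
      rw [← NormedSpace.exp_nsmul]
      congr 1
      rw [← Nat.cast_smul_eq_nsmul ℝ, smul_smul, ht]
      push_cast
      rw [mul_one_div_cancel hk.ne', one_smul]
    have hR1 : 1 ≤ 1 + C * t := by
      have := mul_nonneg hC0 htpos.le
      linarith
    have hRpow : (1 + C * t) ^ (k + 1) ≤ Real.exp C := by
      have h5 : 1 + C * t ≤ Real.exp (C * t) := by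
        have := Real.add_one_le_exp (C * t); linarith
      calc (1 + C * t) ^ (k + 1) ≤ Real.exp (C * t) ^ (k + 1) :=
            pow_le_pow_left₀ (by linarith) h5 _
        _ = Real.exp C := by
            rw [← Real.exp_nat_mul]
            congr 1
            rw [ht]; push_cast; field_simp
    have hmain := norm_pow_sub_pow_le h1 hR1 hA hB (k + 1)
    rw [hpowB] at hmain
    rw [dist_zero_right]
    have hkt : ((k + 1 : ℕ) : ℝ) * t = 1 := by
      rw [ht]; push_cast; exact mul_one_div_cancel hk.ne'
    have hE := Real.exp_pos C
    calc ‖c t ^ (k + 1) - NormedSpace.exp Z‖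
        ≤ ((k + 1 : ℕ) : ℝ) * (1 + C * t) ^ (k + 1) * ‖c t - NormedSpace.exp (t • Z)‖ := hmain
      _ ≤ ((k + 1 : ℕ) : ℝ) * Real.exp C * (ε / (2 * Real.exp C) * t) := by
          refine mul_le_mul (mul_le_mul_of_nonneg_left hRpow (by positivity)) k3
            (norm_nonneg _) (by positivity)
      _ = (((k + 1 : ℕ) : ℝ) * t) * (ε / 2) := by field_simp
      _ < ε := by rw [hkt]; linarith
  simpa using key.add_const (NormedSpace.exp Z)

theorem norm_one_matrix_le : ‖(1 : Matrix (Fin d) (Fin d) ℝ)‖ ≤ 1 := by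
  rw [← Matrix.diagonal_one, Matrix.linfty_opNorm_diagonal]
  exact (pi_norm_le_iff_of_nonneg zero_le_one).2 (fun i => by simp)

/-- The matrices of the real points form a closed set. -/
theorem isClosed_matrices :
    IsClosed {A : Matrix (Fin d) (Fin d) ℝ | ∃ g ∈ G.realPoints, (g : Matrix (Fin d) (Fin d) ℝ) = A} := by
  obtain ⟨S, hS⟩ := G.exists_equations
  have e : {A : Matrix (Fin d) (Fin d) ℝ | ∃ g ∈ G.realPoints, (g : Matrix (Fin d) (Fin d) ℝ) = A}
      = {A | A.det = 1} ∩ ⋂ p ∈ S, {A : Matrix (Fin d) (Fin d) ℝ |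
          MvPolynomial.aeval (fun ij : Fin d × Fin d => ((A ij.1 ij.2 : ℝ) : ℂ)) p = 0} := by
    ext A
    simp only [Set.mem_ofPred_eq, Set.mem_inter_iff, Set.mem_iInter]
    constructor
    · rintro ⟨g, hg, rfl⟩
      refine ⟨g.2, fun p hp => ?_⟩
      have := (hS _).1 (Subgroup.mem_comap.1 hg) p hp
      simpa using this
    · rintro ⟨hdet, hp⟩
      refine ⟨⟨A, hdet⟩, Subgroup.mem_comap.2 ((hS _).2 fun p hpS => ?_), rfl⟩
      exact hp p hpS
  rw [e]
  refine IsClosed.inter (isClosed_eq (Continuous.matrix_det continuous_id) continuous_const)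
    (isClosed_biInter fun p _ => isClosed_eq ?_ continuous_const)
  simp only [MvPolynomial.aeval_def, MvPolynomial.eval₂_eq]
  fun_prop

/-- The predicate defining the Lie algebra. -/
def IsTangent (X : Matrix (Fin d) (Fin d) ℝ) : Prop :=
  ∀ t : ℝ, ∃ g ∈ G.realPoints, (g : Matrix (Fin d) (Fin d) ℝ) = NormedSpace.exp (t • X)

theorem isTangent_of_curve (c : ℝ → ℝ → Matrix (Fin d) (Fin d) ℝ) (Z : Matrix (Fin d) (Fin d) ℝ)
    (hmem : ∀ t s, ∃ g ∈ G.realPoints, (g : Matrix (Fin d) (Fin d) ℝ) = c t s)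
    (h0 : ∀ t, c t 0 = 1) (hc : ∀ t, HasDerivAt (c t) (t • Z) 0) : G.IsTangent Z := by
  intro t
  refine G.isClosed_matrices.mem_of_tendsto
    (tendsto_curve_pow norm_one_matrix_le (c t) (t • Z) (h0 t) (hc t))
    (Filter.Eventually.of_forall fun k => ?_)
  obtain ⟨g, hg, hgc⟩ := hmem t (1 / ((k : ℝ) + 1))
  exact ⟨g ^ (k + 1), pow_mem hg _, by rw [Matrix.SpecialLinearGroup.coe_pow, hgc]⟩

theorem IsTangent.add {X Y : Matrix (Fin d) (Fin d) ℝ} (hX : G.IsTangent X) (hY : G.IsTangent Y) :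
    G.IsTangent (X + Y) := by
  refine G.isTangent_of_curve
    (fun t s => NormedSpace.exp (s • (t • X)) * NormedSpace.exp (s • (t • Y))) _ ?_ ?_ ?_
  · intro t s
    obtain ⟨g, hg, hgX⟩ := hX (s * t)
    obtain ⟨k, hk, hkY⟩ := hY (s * t)
    exact ⟨g * k, mul_mem hg hk, by rw [Matrix.SpecialLinearGroup.coe_mul, hgX, hkY]; simp [smul_smul]⟩
  · intro t; simp
  · intro t
    have h1 := hasDerivAt_exp_smul_const (𝕂 := ℝ) (t • X) (0 : ℝ)
    have h2 := hasDerivAt_exp_smul_const (𝕂 := ℝ) (t • Y) (0 : ℝ)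
    have := h1.mul h2
    simp only [zero_smul, NormedSpace.exp_zero, one_mul, mul_one, ← smul_add] at this
    exact this

theorem IsTangent.smul {X : Matrix (Fin d) (Fin d) ℝ} (a : ℝ) (hX : G.IsTangent X) :
    G.IsTangent (a • X) := by
  intro t
  rw [smul_smul]
  exact hX (t * a)

theorem IsTangent.conj {X : Matrix (Fin d) (Fin d) ℝ} (hX : G.IsTangent X)
    {g : Matrix.SpecialLinearGroup (Fin d) ℝ} (hg : g ∈ G.realPoints) :
    G.IsTangent ((g : Matrix (Fin d) (Fin d) ℝ) * X *
      ((g⁻¹ : Matrix.SpecialLinearGroup (Fin d) ℝ) : Matrix (Fin d) (Fin d) ℝ)) := by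
  intro t
  obtain ⟨k, hk, hkX⟩ := hX t
  refine ⟨g * k * g⁻¹, mul_mem (mul_mem hg hk) (inv_mem hg), ?_⟩
  have hgi : (g : Matrix (Fin d) (Fin d) ℝ) *
      ((g⁻¹ : Matrix.SpecialLinearGroup (Fin d) ℝ) : Matrix (Fin d) (Fin d) ℝ) = 1 := by
    rw [← Matrix.SpecialLinearGroup.coe_mul, mul_inv_cancel, Matrix.SpecialLinearGroup.coe_one]
  have hig : ((g⁻¹ : Matrix.SpecialLinearGroup (Fin d) ℝ) : Matrix (Fin d) (Fin d) ℝ) *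
      (g : Matrix (Fin d) (Fin d) ℝ) = 1 := by
    rw [← Matrix.SpecialLinearGroup.coe_mul, inv_mul_cancel, Matrix.SpecialLinearGroup.coe_one]
  have := Matrix.exp_units_conj (⟨g, _, hgi, hig⟩ : (Matrix (Fin d) (Fin d) ℝ)ˣ) (t • X)
  simp only [Units.inv_mk] at this
  rw [Matrix.SpecialLinearGroup.coe_mul, Matrix.SpecialLinearGroup.coe_mul, hkX, ← this]
  simp

/-- The tangent matrices as a linear subspace. -/
def tangentSpace : Submodule ℝ (Matrix (Fin d) (Fin d) ℝ) where
  carrier := {X | G.IsTangent X}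
  add_mem' := fun hX hY => IsTangent.add G hX hY
  zero_mem' := fun t => ⟨1, one_mem _, by simp⟩
  smul_mem' := fun a _ hX => IsTangent.smul G a hX

theorem IsTangent.lie {X Y : Matrix (Fin d) (Fin d) ℝ} (hX : G.IsTangent X) (hY : G.IsTangent Y) :
    G.IsTangent ⁅X, Y⁆ := by
  have hclosed : IsClosed (G.tangentSpace : Set (Matrix (Fin d) (Fin d) ℝ)) :=
    Submodule.closed_of_finiteDimensional _
  set γ : ℝ → Matrix (Fin d) (Fin d) ℝ :=
    fun s => NormedSpace.exp (s • X) * Y * NormedSpace.exp (s • (-X)) with hγ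
  have hmem : ∀ s, γ s ∈ G.tangentSpace := by
    intro s
    obtain ⟨g, hg, hgX⟩ := hX s
    have := IsTangent.conj G hY hg
    have hinv : ((g⁻¹ : Matrix.SpecialLinearGroup (Fin d) ℝ) : Matrix (Fin d) (Fin d) ℝ)
        = NormedSpace.exp (s • (-X)) := by
      rw [smul_neg, Matrix.exp_neg, ← hgX]
      refine (Matrix.inv_eq_left_inv ?_).symm
      rw [← Matrix.SpecialLinearGroup.coe_mul, inv_mul_cancel, Matrix.SpecialLinearGroup.coe_one]
    rw [hinv, hgX] at this
    exact this
  have hder : HasDerivAt γ ⁅X, Y⁆ 0 := by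
    have h1 := hasDerivAt_exp_smul_const (𝕂 := ℝ) X (0 : ℝ)
    have h2 := hasDerivAt_exp_smul_const (𝕂 := ℝ) (-X) (0 : ℝ)
    have h3 := (h1.mul_const Y).mul h2
    simp only [zero_smul, NormedSpace.exp_zero, one_mul, mul_one, mul_neg,
      ← sub_eq_add_neg, ← Ring.lie_def] at h3
    exact h3
  have hslope := hasDerivAt_iff_tendsto_slope.1 hder
  refine hclosed.mem_of_tendsto hslope (Filter.Eventually.of_forall fun s => ?_)
  exact G.tangentSpace.smul_mem _ (G.tangentSpace.sub_mem (hmem s) (hmem 0))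

end LieAlgebraConstruction

/-- The Lie algebra `𝔤` of `G(ℝ)`: the matrices `X` with `exp (t X) ∈ G(ℝ)` for all real `t`. -/
def lieAlgebra : LieSubalgebra ℝ (Matrix (Fin d) (Fin d) ℝ) where
  toSubmodule := G.tangentSpace
  lie_mem' := fun hX hY => IsTangent.lie G hX hY

/-- A norm on the finite-dimensional space `𝔤` (they all define the same smooth functions). -/
instance : NormedAddCommGroup G.lieAlgebra :=
  letI : NormedAddCommGroup (Matrix (Fin d) (Fin d) ℝ) := Matrix.linftyOpNormedAddCommGroup
  NormedAddCommGroup.induced G.lieAlgebra (Matrix (Fin d) (Fin d) ℝ) G.lieAlgebra.subtype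
    Subtype.val_injective

instance : NormedSpace ℝ G.lieAlgebra :=
  letI : NormedAddCommGroup (Matrix (Fin d) (Fin d) ℝ) := Matrix.linftyOpNormedAddCommGroup
  letI : NormedSpace ℝ (Matrix (Fin d) (Fin d) ℝ) := Matrix.linftyOpNormedSpace
  NormedSpace.induced ℝ G.lieAlgebra (Matrix (Fin d) (Fin d) ℝ) G.lieAlgebra.toSubmodule.subtype

instance : FiniteDimensional ℝ G.lieAlgebra :=
  inferInstanceAs (FiniteDimensional ℝ G.lieAlgebra.toSubmodule)

instance : IsTopologicalAddGroup G.lieAlgebra :=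
  inferInstanceAs (IsTopologicalAddGroup G.lieAlgebra.toSubmodule)

instance : ContinuousSMul ℝ G.lieAlgebra :=
  inferInstanceAs (ContinuousSMul ℝ G.lieAlgebra.toSubmodule)

/-- The exponential map `𝔤 → G(ℝ)`. -/
def expMap (X : G.lieAlgebra) : G.realPoints :=
  ⟨(X.2 1).choose, (X.2 1).choose_spec.1⟩

theorem coe_expMap (X : G.lieAlgebra) :
    ((G.expMap X : Matrix.SpecialLinearGroup (Fin d) ℝ) : Matrix (Fin d) (Fin d) ℝ)
      = NormedSpace.exp (X : Matrix (Fin d) (Fin d) ℝ) := by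
  have := (X.2 1).choose_spec.2
  exact this.trans (congrArg NormedSpace.exp (one_smul ℝ (X : Matrix (Fin d) (Fin d) ℝ)))

/-- The adjoint action of `G(ℝ)` on `𝔤`, by conjugation of matrices. -/
instance : MulAction G.realPoints G.lieAlgebra where
  smul g X := ⟨((g : Matrix.SpecialLinearGroup (Fin d) ℝ) : Matrix (Fin d) (Fin d) ℝ) * X *
    ((g⁻¹ : G.realPoints) : Matrix.SpecialLinearGroup (Fin d) ℝ), IsTangent.conj G X.2 g.2⟩
  one_smul X := Subtype.ext <| by
    change (((1 : G.realPoints) : Matrix.SpecialLinearGroup (Fin d) ℝ) :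
      Matrix (Fin d) (Fin d) ℝ) * X * (((1 : G.realPoints)⁻¹ : G.realPoints) :
        Matrix.SpecialLinearGroup (Fin d) ℝ) = X
    simp
  mul_smul g k X := Subtype.ext <| by
    change (((g * k : G.realPoints) : Matrix.SpecialLinearGroup (Fin d) ℝ) :
      Matrix (Fin d) (Fin d) ℝ) * X * (((g * k : G.realPoints)⁻¹ : G.realPoints) :
        Matrix.SpecialLinearGroup (Fin d) ℝ) =
      ((g : Matrix.SpecialLinearGroup (Fin d) ℝ) : Matrix (Fin d) (Fin d) ℝ) *
      (((k : Matrix.SpecialLinearGroup (Fin d) ℝ) : Matrix (Fin d) (Fin d) ℝ) * X *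
      ((k⁻¹ : G.realPoints) : Matrix.SpecialLinearGroup (Fin d) ℝ)) *
      ((g⁻¹ : G.realPoints) : Matrix.SpecialLinearGroup (Fin d) ℝ)
    rw [mul_inv_rev]
    simp only [Subgroup.coe_mul, Matrix.SpecialLinearGroup.coe_mul, mul_assoc]

theorem coe_smul (g : G.realPoints) (X : G.lieAlgebra) :
    ((g • X : G.lieAlgebra) : Matrix (Fin d) (Fin d) ℝ) =
      ((g : Matrix.SpecialLinearGroup (Fin d) ℝ) : Matrix (Fin d) (Fin d) ℝ) * X *
      ((g⁻¹ : G.realPoints) : Matrix.SpecialLinearGroup (Fin d) ℝ) := rfl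

theorem smul_lie (g : G.realPoints) (X Y : G.lieAlgebra) : g • ⁅X, Y⁆ = ⁅g • X, g • Y⁆ := by
  apply Subtype.ext
  have hig : (((g⁻¹ : G.realPoints) : Matrix.SpecialLinearGroup (Fin d) ℝ) :
      Matrix (Fin d) (Fin d) ℝ) *
      ((g : Matrix.SpecialLinearGroup (Fin d) ℝ) : Matrix (Fin d) (Fin d) ℝ) = 1 := by
    rw [← Matrix.SpecialLinearGroup.coe_mul, ← Subgroup.coe_mul, inv_mul_cancel]
    simp
  have key : ∀ A B C D : Matrix (Fin d) (Fin d) ℝ, D * A = 1 →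
      A * (B * C - C * B) * D = A * B * D * (A * C * D) - A * C * D * (A * B * D) := by
    intro A B C D h
    have h2 : ∀ Z, D * (A * Z) = Z := fun Z => by rw [← mul_assoc, h, one_mul]
    simp only [mul_sub, sub_mul, mul_assoc, h2]
  simp only [coe_smul, LieSubalgebra.coe_bracket, Ring.lie_def]
  exact key _ _ _ _ hig

theorem smul_real (g : G.realPoints) (a : ℝ) (X : G.lieAlgebra) : g • (a • X) = a • (g • X) := by
  apply Subtype.ext
  simp [coe_smul]

/-! ## Maximal parabolic subgroups with abelian unipotent radical -/

/-- The subspace of `X ∈ 𝔤` with `[h, X] = k X`. -/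
def gradedPart (h : G.lieAlgebra) (k : ℝ) : Submodule ℝ G.lieAlgebra :=
  Module.End.eigenspace (LieAlgebra.ad ℝ G.lieAlgebra h) k

theorem mem_gradedPart {h : G.lieAlgebra} {k : ℝ} {X : G.lieAlgebra} :
    X ∈ G.gradedPart h k ↔ ⁅h, X⁆ = k • X := by
  rw [gradedPart, Module.End.mem_eigenspace_iff, LieAlgebra.ad_apply]

/-- `h` is the element of `𝔤` defining a decomposition `𝔤 = 𝔫̄ ⊕ 𝔪 ⊕ 𝔫`, that is, `h ≠ 0` and
`ad h` is diagonalizable with eigenvalues among `-2`, `0`, `2`. -/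
def IsGradingElement (h : G.lieAlgebra) : Prop :=
  h ≠ 0 ∧ G.gradedPart h (-2) ⊔ G.gradedPart h 0 ⊔ G.gradedPart h 2 = ⊤

/-- `𝔫`, the Lie algebra of the unipotent radical `N` of `P`. -/
abbrev nil (h : G.lieAlgebra) : Submodule ℝ G.lieAlgebra := G.gradedPart h 2

/-- `𝔫̄`, the Lie algebra of the unipotent radical `N̄` of the opposite parabolic subgroup; it is
identified with `N̄` by the exponential map. -/
abbrev nilBar (h : G.lieAlgebra) : Submodule ℝ G.lieAlgebra := G.gradedPart h (-2)

/-- The Levi subgroup `M`, the centralizer of `h` in `G(ℝ)`. -/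
def levi (h : G.lieAlgebra) : Subgroup G.realPoints := MulAction.stabilizer G.realPoints h

/-- The subgroup `N = exp 𝔫`. -/
def unipotentRadical (h : G.lieAlgebra) : Subgroup G.realPoints :=
  Subgroup.closure (G.expMap '' (G.nil h : Set G.lieAlgebra))

/-- The parabolic subgroup `P = M N`. -/
def parabolic (h : G.lieAlgebra) : Subgroup G.realPoints := G.levi h ⊔ G.unipotentRadical h

/-- The opposite parabolic subgroup `P̄ = M N̄`. -/
def oppositeParabolic (h : G.lieAlgebra) : Subgroup G.realPoints := G.parabolic (-h)

/-- The adjoint action of `M` on `𝔫̄`, that is, the conjugation action of `M` on `N̄`. -/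
instance (h : G.lieAlgebra) : MulAction (G.levi h) (G.nilBar h) where
  smul m y := ⟨(m : G.realPoints) • (y : G.lieAlgebra), by
    have hm : (m : G.realPoints) • h = h := MulAction.mem_stabilizer_iff.1 m.2
    have hy := G.mem_gradedPart.1 y.2
    have e := G.smul_lie (m : G.realPoints) h (y : G.lieAlgebra)
    rw [hm, hy, G.smul_real] at e
    exact G.mem_gradedPart.2 e.symm⟩
  one_smul y := Subtype.ext (one_smul G.realPoints (y : G.lieAlgebra))
  mul_smul m k y := Subtype.ext (mul_smul (m : G.realPoints) (k : G.realPoints) (y : G.lieAlgebra))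

/-- The pairing `⟨exp X, exp y⟩ = c κ(X, y)` of `N` and `N̄`, where `κ` is the Killing form of `𝔤` and
the nonzero constant `c` is the normalization. -/
def pairing (c : ℝ) (X y : G.lieAlgebra) : ℝ := c * killingForm ℝ G.lieAlgebra X y

/-! ## Smooth vectors of a unitary representation -/

section Representation

variable {G} {H : Type*} [NormedAddCommGroup H] [InnerProductSpace ℂ H]

/-- The space `ℋ^∞` of smooth vectors: `v` such that `g ↦ π(g) v` is smooth on `G(ℝ)`. By
translation this is smoothness in exponential coordinates at the identity. -/
def smoothVectors (π : G.realPoints →* (H ≃ₗᵢ[ℂ] H)) : Submodule ℂ H where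
  carrier := {v | ContDiff ℝ ∞ fun X : G.lieAlgebra => π (G.expMap X) v}
  add_mem' := fun {v w} hv hw => by
    have : ContDiff ℝ ∞ fun X : G.lieAlgebra => π (G.expMap X) v + π (G.expMap X) w := ContDiff.add (f := fun X : G.lieAlgebra => π (G.expMap X) v)
        (g := fun X : G.lieAlgebra => π (G.expMap X) w) hv hw
    simpa only [Set.mem_ofPred_eq, map_add] using this
  zero_mem' := by
    simp only [Set.mem_ofPred_eq, map_zero]
    exact contDiff_const
  smul_mem' := fun a v hv => by
    have : ContDiff ℝ ∞ fun X : G.lieAlgebra => a • π (G.expMap X) v := ContDiff.const_smul (f := fun X : G.lieAlgebra => π (G.expMap X) v) a hv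
    simpa only [Set.mem_ofPred_eq, map_smul] using this

/-- The derivative `dπ(X) v` of `t ↦ π(exp tX) v` at `t = 0` (meaningful for smooth `v`). -/
def dRep (π : G.realPoints →* (H ≃ₗᵢ[ℂ] H)) (X : G.lieAlgebra) (v : H) : H :=
  deriv (fun t : ℝ => π (G.expMap (t • X)) v) 0

/-- `dπ(X₁ ⋯ X_k) v = dπ(X₁) ⋯ dπ(X_k) v`; the products `X₁ ⋯ X_k` span the enveloping algebra. -/
def dRepList (π : G.realPoints →* (H ≃ₗᵢ[ℂ] H)) (L : List G.lieAlgebra) (v : H) : H :=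
  L.foldr (dRep π) v

/-- The Fréchet topology of `ℋ^∞`, given by the semi-norms `v ↦ ‖dπ(u) v‖` for `u` in the enveloping
algebra: the coarsest topology for which the (linear) maps `dπ(X₁ ⋯ X_k) : ℋ^∞ → ℋ` are continuous. -/
@[reducible] def smoothTopology (π : G.realPoints →* (H ≃ₗᵢ[ℂ] H)) : TopologicalSpace (smoothVectors π) :=
  ⨅ L : List G.lieAlgebra,
    TopologicalSpace.induced (fun v : smoothVectors π => dRepList π L (v : H)) inferInstance

theorem expMap_smul (g : G.realPoints) (X : G.lieAlgebra) :
    G.expMap (g • X) = g * G.expMap X * g⁻¹ := by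
  apply Subtype.ext
  apply Subtype.ext
  have hgi : ((g : Matrix.SpecialLinearGroup (Fin d) ℝ) : Matrix (Fin d) (Fin d) ℝ) *
      (((g⁻¹ : G.realPoints) : Matrix.SpecialLinearGroup (Fin d) ℝ) :
        Matrix (Fin d) (Fin d) ℝ) = 1 := by
    rw [← Matrix.SpecialLinearGroup.coe_mul, ← Subgroup.coe_mul, mul_inv_cancel]
    simp
  have hig : (((g⁻¹ : G.realPoints) : Matrix.SpecialLinearGroup (Fin d) ℝ) :
      Matrix (Fin d) (Fin d) ℝ) *
      ((g : Matrix.SpecialLinearGroup (Fin d) ℝ) : Matrix (Fin d) (Fin d) ℝ) = 1 := by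
    rw [← Matrix.SpecialLinearGroup.coe_mul, ← Subgroup.coe_mul, inv_mul_cancel]
    simp
  have key := Matrix.exp_units_conj
    (⟨_, _, hgi, hig⟩ : (Matrix (Fin d) (Fin d) ℝ)ˣ) (X : Matrix (Fin d) (Fin d) ℝ)
  simp only [Units.inv_mk] at key
  change ((G.expMap (g • X) : Matrix.SpecialLinearGroup (Fin d) ℝ) : Matrix (Fin d) (Fin d) ℝ) =
    ((g * G.expMap X * g⁻¹ : G.realPoints) : Matrix.SpecialLinearGroup (Fin d) ℝ)
  rw [Subgroup.coe_mul, Subgroup.coe_mul, Matrix.SpecialLinearGroup.coe_mul,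
    Matrix.SpecialLinearGroup.coe_mul, coe_expMap, coe_expMap, coe_smul]
  exact key

theorem smul_mem_smoothVectors (π : G.realPoints →* (H ≃ₗᵢ[ℂ] H)) (g : G.realPoints) {v : H}
    (hv : v ∈ smoothVectors π) : π g v ∈ smoothVectors π := by
  let A : G.lieAlgebra →ₗ[ℝ] G.lieAlgebra :=
    { toFun := fun X => g⁻¹ • X
      map_add' := fun X Y => by
        apply Subtype.ext
        simp [coe_smul, mul_add, add_mul]
      map_smul' := fun a X => G.smul_real g⁻¹ a X }
  have hA : ContDiff ℝ ∞ A := (LinearMap.toContinuousLinearMap A).contDiff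
  have h1 : ContDiff ℝ ∞ fun X : G.lieAlgebra => π (G.expMap (g⁻¹ • X)) v :=
    ContDiff.comp (g := fun X : G.lieAlgebra => π (G.expMap X) v) hv hA
  have h2 : ContDiff ℝ ∞ fun w : H => π g w :=
    ((π g).toContinuousLinearEquiv.toContinuousLinearMap.restrictScalars ℝ).contDiff
  have h3 := h2.comp h1
  have e : (fun X : G.lieAlgebra => π (G.expMap X) (π g v)) =
      (fun w : H => π g w) ∘ fun X : G.lieAlgebra => π (G.expMap (g⁻¹ • X)) v := by
    funext X
    simp only [Function.comp_apply, expMap_smul, inv_inv]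
    change (π (G.expMap X) * π g) v = (π g * π (g⁻¹ * G.expMap X * g)) v
    rw [← map_mul, ← map_mul]
    congr 2
    group
  change ContDiff ℝ ∞ _
  rw [e]
  exact h3

/-- The action of `G(ℝ)` on `ℋ^∞`. -/
def smoothRep (π : G.realPoints →* (H ≃ₗᵢ[ℂ] H)) (g : G.realPoints) (v : smoothVectors π) :
    smoothVectors π :=
  ⟨π g v, smul_mem_smoothVectors π g v.2⟩

end Representation

end RealAlgebraicGroup

/-! ## Smooth functions and differential operators on a submanifold of a vector space -/

section Submanifold

variable {V : Type*} [NormedAddCommGroup V] [NormedSpace ℝ V]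

/-- `C^∞(Ω)` for a submanifold `Ω` of `V`: the complex functions on `Ω` that agree, near every point of
`Ω`, with a smooth function on `V`. -/
def smoothFunctions (Ω : Set V) : Submodule ℂ (Ω → ℂ) where
  carrier := {f | ∀ y : Ω, ∃ U ∈ 𝓝 (y : V), ∃ F : V → ℂ, ContDiff ℝ ∞ F ∧
    ∀ z : Ω, (z : V) ∈ U → f z = F z}
  add_mem' := fun {f g} hf hg y => by
    obtain ⟨U, hU, F, hF, hFf⟩ := hf y
    obtain ⟨W, hW, K, hK, hKg⟩ := hg y
    exact ⟨U ∩ W, Filter.inter_mem hU hW, fun z => F z + K z, hF.add hK,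
      fun z hz => by simp [hFf z hz.1, hKg z hz.2]⟩
  zero_mem' := fun _ => ⟨Set.univ, Filter.univ_mem, fun _ => 0, contDiff_const, fun _ _ => rfl⟩
  smul_mem' := fun a f hf y => by
    obtain ⟨U, hU, F, hF, hFf⟩ := hf y
    exact ⟨U, hU, fun z => a • F z, hF.const_smul a, fun z hz => by simp [hFf z hz]⟩

/-- `D` is a linear differential operator (of finite order, with smooth coefficients) on the
submanifold `Ω` of `V`: near every point of `Ω` it is induced by a differential operator
`F ↦ ∑_{j ≤ k} a_j(z) (∂^j F (z))` on an open subset of `V`, whose coefficients `a_j(z)` are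
linear functionals on the `j`-th derivatives, depending smoothly on `z`. -/
def IsDifferentialOperator {Ω : Set V} (D : smoothFunctions Ω →ₗ[ℂ] smoothFunctions Ω) : Prop :=
  ∃ k : ℕ, ∀ y : Ω, ∃ U : Set V, IsOpen U ∧ (y : V) ∈ U ∧
    ∃ a : (j : ℕ) → V → (ContinuousMultilinearMap ℝ (fun _ : Fin j => V) ℂ →L[ℂ] ℂ),
      (∀ j, ContDiffOn ℝ ∞ (a j) U) ∧
      ∀ (f : smoothFunctions Ω) (F : V → ℂ) (W : Set V), ContDiff ℝ ∞ F → IsOpen W → W ⊆ U →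
        (∀ z : Ω, (z : V) ∈ W → (f : Ω → ℂ) z = F z) →
        ∀ z : Ω, (z : V) ∈ W → (D f : Ω → ℂ) z =
          ∑ j ∈ Finset.range (k + 1), a j z (iteratedFDeriv ℝ j F z)

/-- `D` is anti-symmetric: `∫ Dφ · conj f = - ∫ φ · conj (D f)` for `φ ∈ C_c^∞(Ω)`, `f ∈ C^∞(Ω)`. -/
def IsAntisymmetric {Ω : Set V} [MeasurableSpace Ω] (μ : Measure Ω)
    (D : smoothFunctions Ω →ₗ[ℂ] smoothFunctions Ω) : Prop :=
  ∀ φ f : smoothFunctions Ω, HasCompactSupport (φ : Ω → ℂ) →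
    ∫ y, (D φ : Ω → ℂ) y * (starRingEnd ℂ) ((f : Ω → ℂ) y) ∂μ =
      - ∫ y, (φ : Ω → ℂ) y * (starRingEnd ℂ) ((D f : Ω → ℂ) y) ∂μ

end Submanifold

end

/-!
Write `𝔪 = gradedPart h 0`, `Ω` for the orbit. The statement rests on two facts about the space of smooth
vectors.

*Multiplication by test functions* (`exists_mul_testFunction`). Since `𝔤` is simple, the Killing form puts
`𝔫` and `𝔫̄` in duality, so that by Fourier inversion multiplication by `F ∈ C_c^∞(𝔫̄)` is a superposition
`∫ φ(ξ) π(exp X(ξ)) dξ` of the operators `π(n)`, `n ∈ N`, with `φ` of rapid decay. Since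
`(ad X(ξ))³ = 0`, the derivatives of `π(exp X(ξ)) v` grow polynomially in `ξ`; so the integral stays in `ℋ^∞`
and commutes with every continuous functional (`integral_mem_smoothVectors`; membership in `ℋ^∞` is tested
on one-parameter subgroups, by `mem_smoothVectors_of_family`). If `N` acts on `ℓ` by the character attached
to `x`, this gives `ℓ (F v) = F(x) ℓ(v)`.

*Smooth representatives* (`exists_smoothFunctions_ae_eq`). A smooth vector `v` is smooth along the action of
`𝔪`, which is, up to a character, translation on `Ω`. By a Sobolev type lemma
(`ae_exists_contDiff_of_contDiff_Lp`), for almost every `z` the function `t ↦ v(exp X(t) z)` has a smooth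
representative, and one such `z` near a given point provides a representative near this point, once
the coordinates `t` are known to be a chart of `Ω`. That `Ω` has no other sheets accumulating at one of its points
`y` is the geometric part (`IsGradingElement.exists_orbit_chart`): `y` belongs to an `𝔰𝔩₂`-triple
(`IsGradingElement.exists_lie_lie_eq`), from which `2u - [[e, u], u] ∈ [𝔪, y + u]` for all `u ∈ 𝔫̄`; thus
every displacement `u` is tangent to `Ω` at `y + u` up to terms of second order, and it cannot lie in
a fixed complement of the tangent space `[𝔪, y]` if `y + u ∈ Ω` and `u` is small and nonzero.

The representatives are unique, since the measure is positive on nonempty open sets. If `x` is not in the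
closure of `Ω`, choose `F` supported off `Ω` with `F(x) = 1`: then `F v = 0` and `ℓ(v) = F(x) ℓ(v) = 0`. If
`x ∈ Ω` and `v₀` is a smooth vector not vanishing at `x`, then near `x` any smooth vector `v` is the product
of `v₀` and a smooth function with value `v(x) / v₀(x)` at `x`, so that `ℓ(v)` is this multiple of `ℓ(v₀)`. If
no such `v₀` exists, translation by the Levi subgroup, which is transitive on `Ω`, shows that `ℋ^∞ = 0`.
-/

noncomputable section

/-! ### Nilpotency of products in an associative algebra -/

section Nilpotency

variable {R : Type*} [Ring R] [Algebra ℝ R]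

theorem ad_pow_mul_of_ad_ad_eq_zero {A B : R} (hAB : ⁅A, ⁅A, B⁆⁆ = 0) (P : R) (m : ℕ) :
    (LieAlgebra.ad ℝ R A ^ (m + 1)) (P * B) =
      (LieAlgebra.ad ℝ R A ^ (m + 1)) P * B +
        (m + 1 : ℝ) • ((LieAlgebra.ad ℝ R A ^ m) P * ⁅A, B⁆) := by
  have leib : ∀ X Y : R, ⁅A, X * Y⁆ = ⁅A, X⁆ * Y + X * ⁅A, Y⁆ := by
    intro X Y; simp only [Ring.lie_def]; noncomm_ring
  have hs : ∀ (k : ℕ) (Z : R),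
      (LieAlgebra.ad ℝ R A ^ (k + 1)) Z = ⁅A, (LieAlgebra.ad ℝ R A ^ k) Z⁆ := by
    intro k Z
    rw [pow_succ', Module.End.mul_apply, LieAlgebra.ad_apply]
  induction m with
  | zero => simp [leib]
  | succ m ih =>
    rw [hs (m + 1) (P * B), ih, lie_add, lie_smul, leib, leib, hAB, mul_zero, add_zero, ← hs, ← hs]
    push_cast
    module

/-- The Kleinecke–Shirokov argument: if `⁅A, B⁆` commutes with `A`, then the derivation `ad A` satisfies
`(ad A) ^ m (B ^ m) = m! ⁅A, B⁆ ^ m`. -/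
theorem ad_pow_pow_of_ad_ad_eq_zero {A B : R} (hAB : ⁅A, ⁅A, B⁆⁆ = 0) (m : ℕ) :
    (LieAlgebra.ad ℝ R A ^ m) (B ^ m) = (m.factorial : ℝ) • ⁅A, B⁆ ^ m ∧
      (LieAlgebra.ad ℝ R A ^ (m + 1)) (B ^ m) = 0 := by
  have hpow : ∀ k : ℕ, ⁅A, ⁅A, B⁆ ^ k⁆ = 0 := by
    intro k
    have hc : Commute A ⁅A, B⁆ := sub_eq_zero.1 ((Ring.lie_def A _).symm.trans hAB)
    rw [Ring.lie_def, (hc.pow_right k).eq, sub_self]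
  induction m with
  | zero => simp [Ring.lie_def]
  | succ m ih =>
    have e : (LieAlgebra.ad ℝ R A ^ (m + 1)) (B ^ (m + 1)) =
        ((m + 1).factorial : ℝ) • ⁅A, B⁆ ^ (m + 1) := by
      rw [pow_succ B m, ad_pow_mul_of_ad_ad_eq_zero hAB, ih.2, ih.1, zero_mul, zero_add,
        smul_mul_assoc, smul_smul, ← pow_succ, Nat.factorial_succ]
      push_cast
      rfl
    refine ⟨e, ?_⟩
    rw [pow_succ' _ (m + 1), Module.End.mul_apply, e, map_smul, LieAlgebra.ad_apply, hpow, smul_zero]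

theorem isNilpotent_lie_of_ad_ad_eq_zero {A B : R} (hA : IsNilpotent A) (hAB : ⁅A, ⁅A, B⁆⁆ = 0) :
    IsNilpotent ⁅A, B⁆ := by
  obtain ⟨m, hm⟩ := LieAlgebra.ad_nilpotent_of_nilpotent (R := ℝ) hA
  refine ⟨m, ?_⟩
  have := (ad_pow_pow_of_ad_ad_eq_zero hAB m).1
  rw [hm, LinearMap.zero_apply] at this
  exact (smul_eq_zero.1 this.symm).resolve_left (by exact_mod_cast m.factorial_ne_zero)

/-- Modulo the kernels of the powers of `A`, the product `A * B` acts as a multiple of `⁅A, B⁆`. -/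
theorem isNilpotent_mul_of_ad_ad_eq_zero {A B : R} (hA : A ^ 3 = 0) (hAB : ⁅A, ⁅A, B⁆⁆ = 0) :
    IsNilpotent (A * B) := by
  obtain ⟨p, hp⟩ := isNilpotent_lie_of_ad_ad_eq_zero ⟨3, hA⟩ hAB
  set C := ⁅A, B⁆ with hC
  have hc : A * C = C * A := sub_eq_zero.1 ((Ring.lie_def A C).symm.trans hAB)
  have hAB' : A * B = B * A + C := by rw [hC, Ring.lie_def]; abel
  have h2 : A ^ 2 * (A * B) = (3 : ℝ) • (C * A ^ 2) := by
    have h3 : A ^ 2 * (A * B) = B * A ^ 3 + (3 : ℝ) • (C * A ^ 2) := by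
      calc A ^ 2 * (A * B) = A * (A * (A * B)) := by noncomm_ring
        _ = A * (A * (B * A + C)) := by rw [hAB']
        _ = A * ((A * B) * A + A * C) := by noncomm_ring
        _ = A * ((B * A + C) * A + C * A) := by rw [hAB', hc]
        _ = (A * B) * A ^ 2 + (2 : ℝ) • ((A * C) * A) := by rw [two_smul]; noncomm_ring
        _ = (B * A + C) * A ^ 2 + (2 : ℝ) • ((C * A) * A) := by rw [hAB', hc]
        _ = B * A ^ 3 + (3 : ℝ) • (C * A ^ 2) := by
          rw [show (3 : ℝ) = 1 + 2 by norm_num, add_smul, one_smul]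
          simp only [two_smul]; noncomm_ring
    rw [h3, hA, mul_zero, zero_add]
  have s2 : ∀ k : ℕ, A ^ 2 * (A * B) ^ k = (3 : ℝ) ^ k • (C ^ k * A ^ 2) := by
    intro k
    induction k with
    | zero => simp
    | succ k ih =>
      rw [pow_succ (A * B), ← mul_assoc, ih, smul_mul_assoc, mul_assoc, h2, mul_smul_comm, smul_smul,
        ← mul_assoc, ← pow_succ, ← pow_succ]
  have z2 : A ^ 2 * (A * B) ^ p = 0 := by rw [s2, hp, zero_mul, smul_zero]
  have h1 : A * (A * B) = B * A ^ 2 + (2 : ℝ) • (C * A) := by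
    calc A * (A * B) = A * (B * A + C) := by rw [hAB']
      _ = (A * B) * A + A * C := by noncomm_ring
      _ = (B * A + C) * A + C * A := by rw [hAB', hc]
      _ = _ := by rw [two_smul]; noncomm_ring
  have s1 : ∀ k : ℕ, A * (A * B) ^ (k + p) = (2 : ℝ) ^ k • (C ^ k * (A * (A * B) ^ p)) := by
    intro k
    induction k with
    | zero => simp
    | succ k ih =>
      have e : A ^ 2 * (A * B) ^ (k + p) = 0 := by
        rw [add_comm, pow_add, ← mul_assoc, z2, zero_mul]
      rw [show k + 1 + p = (k + p) + 1 by ring, pow_succ', ← mul_assoc, h1, add_mul, mul_assoc, e,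
        mul_zero, zero_add, smul_mul_assoc, mul_assoc, ih, mul_smul_comm, smul_smul, ← mul_assoc C,
        ← pow_succ', ← pow_succ']
  have z1 : A * (A * B) ^ (p + p) = 0 := by rw [s1, hp, zero_mul, smul_zero]
  have s0 : ∀ k : ℕ, (A * B) ^ (k + (p + p)) = C ^ k * (A * B) ^ (p + p) := by
    intro k
    induction k with
    | zero => simp
    | succ k ih =>
      have e : A * (A * B) ^ (k + (p + p)) = 0 := by
        rw [add_comm, pow_add, ← mul_assoc, z1, zero_mul]
      rw [show k + 1 + (p + p) = (k + (p + p)) + 1 by ring, pow_succ']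
      nth_rewrite 1 [hAB']
      rw [add_mul, mul_assoc, e, mul_zero, zero_add, ih, ← mul_assoc, ← pow_succ']
  exact ⟨p + (p + p), by rw [s0, hp, zero_mul]⟩

end Nilpotency

/-! ### The grading of the Lie algebra and the Killing form -/

namespace RealAlgebraicGroup

variable {d : ℕ} (G : RealAlgebraicGroup d)

/-- An abelian ideal of `𝔤` would generate an abelian ideal of the simple complexification. Hence the
radical is trivial, and Cartan's criterion applies. -/
theorem isKilling_of_isSimple (hsimple : LieAlgebra.IsSimple ℂ (ℂ ⊗[ℝ] G.lieAlgebra)) :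
    LieAlgebra.IsKilling ℝ G.lieAlgebra := by
  have : LieAlgebra.HasTrivialRadical ℝ G.lieAlgebra := by
    rw [LieAlgebra.hasTrivialRadical_iff_no_abelian_ideals]
    intro I hI
    have hII : ⁅I, I⁆ = ⊥ := by
      rw [LieSubmodule.lie_eq_bot_iff]
      intro x hx y hy
      have := hI.trivial ⟨x, hx⟩ ⟨y, hy⟩
      exact congrArg Subtype.val this
    have hC : ⁅I.baseChange ℂ, I.baseChange ℂ⁆ = ⊥ := by
      rw [← LieSubmodule.lie_baseChange, hII, LieSubmodule.baseChange_bot]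
    rcases hsimple.eq_bot_or_eq_top (I.baseChange ℂ) with hb | ht
    · rw [eq_bot_iff]
      intro x hx
      have h1 : (1 : ℂ) ⊗ₜ[ℝ] x ∈ I.baseChange ℂ := LieSubmodule.tmul_mem_baseChange_of_mem 1 hx
      rw [hb, LieSubmodule.mem_bot] at h1
      have h2 : Function.Injective fun x : G.lieAlgebra => (1 : ℂ) ⊗ₜ[ℝ] x :=
        Module.FaithfullyFlat.tensorProduct_mk_injective (A := ℝ) (B := ℂ) G.lieAlgebra
      exact h2 (h1.trans (TensorProduct.tmul_zero _ _).symm)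
    · refine absurd ⟨fun x y => ?_⟩ hsimple.non_abelian
      have h1 := (LieSubmodule.lie_eq_bot_iff _ _).1 hC x (ht ▸ LieSubmodule.mem_top x) y
        (ht ▸ LieSubmodule.mem_top y)
      exact h1
  infer_instance

variable {G} {h : G.lieAlgebra}

theorem lie_mem_gradedPart {i j : ℝ} {X Y : G.lieAlgebra} (hX : X ∈ G.gradedPart h i)
    (hY : Y ∈ G.gradedPart h j) : ⁅X, Y⁆ ∈ G.gradedPart h (i + j) := by
  rw [mem_gradedPart] at *
  rw [leibniz_lie, hX, hY, _root_.smul_lie, lie_smul, add_smul]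

theorem IsGradingElement.exists_add (hgrad : G.IsGradingElement h) (X : G.lieAlgebra) :
    ∃ a ∈ G.gradedPart h (-2), ∃ b ∈ G.gradedPart h 0, ∃ e ∈ G.gradedPart h 2, X = a + b + e := by
  have hX : X ∈ G.gradedPart h (-2) ⊔ G.gradedPart h 0 ⊔ G.gradedPart h 2 := hgrad.2 ▸ trivial
  obtain ⟨u, hu, e, he, rfl⟩ := Submodule.mem_sup.1 hX
  obtain ⟨a, ha, b, hb, rfl⟩ := Submodule.mem_sup.1 hu
  exact ⟨a, ha, b, hb, e, he, rfl⟩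

theorem IsGradingElement.eq_zero_of_mem (hgrad : G.IsGradingElement h) {k : ℝ} {X : G.lieAlgebra}
    (hX : X ∈ G.gradedPart h k) (hk : k * (k - 2) * (k + 2) ≠ 0) : X = 0 := by
  obtain ⟨a, ha, b, hb, e, he, hs⟩ := hgrad.exists_add X
  rw [mem_gradedPart] at *
  have h1 : k • X = (-2 : ℝ) • a + (2 : ℝ) • e := by
    rw [← hX, hs, lie_add, lie_add, ha, hb, he, zero_smul, add_zero]
  have h2 : (k * k) • X = (4 : ℝ) • a + (4 : ℝ) • e := by
    rw [mul_smul, ← hX, ← lie_smul, h1, lie_add, lie_smul, lie_smul, ha, he]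
    module
  have h3 : (k * k * k) • X = (-8 : ℝ) • a + (8 : ℝ) • e := by
    rw [mul_smul, ← hX, ← lie_smul, h2, lie_add, lie_smul, lie_smul, ha, he]
    module
  have h4 : (k * (k - 2) * (k + 2)) • X = 0 := by
    have : (k * (k - 2) * (k + 2)) • X = (k * k * k) • X - (4 : ℝ) • (k • X) := by module
    rw [this, h3, h1]
    module
  exact (smul_eq_zero.1 h4).resolve_left hk

theorem killingForm_eq_zero_of_mem_gradedPart {i j : ℝ} {X Y : G.lieAlgebra}
    (hX : X ∈ G.gradedPart h i) (hY : Y ∈ G.gradedPart h j) (hij : i + j ≠ 0) :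
    killingForm ℝ G.lieAlgebra X Y = 0 := by
  rw [mem_gradedPart] at hX hY
  have e := LieModule.traceForm_apply_lie_apply ℝ G.lieAlgebra G.lieAlgebra X h Y
  rw [hY, ← lie_skew, hX, map_neg, map_smul, LinearMap.neg_apply, LinearMap.smul_apply, map_smul,
    smul_eq_mul, smul_eq_mul] at e
  have : (i + j) * killingForm ℝ G.lieAlgebra X Y = 0 := by
    rw [add_mul]
    linarith
  exact (mul_eq_zero.1 this).resolve_left hij

theorem IsGradingElement.lie_nilBar (hgrad : G.IsGradingElement h) {X Y : G.lieAlgebra}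
    (hX : X ∈ G.nilBar h) (hY : Y ∈ G.nilBar h) : ⁅X, Y⁆ = 0 :=
  hgrad.eq_zero_of_mem (lie_mem_gradedPart hX hY) (by norm_num)

theorem IsGradingElement.ad_pow_three (hgrad : G.IsGradingElement h) {k : ℝ} (hk : k ^ 2 = 4)
    {y : G.lieAlgebra} (hy : y ∈ G.gradedPart h k) : LieAlgebra.ad ℝ G.lieAlgebra y ^ 3 = 0 := by
  have key : ∀ i : ℝ, i = -2 ∨ i = 0 ∨ i = 2 → ∀ X ∈ G.gradedPart h i, ⁅y, ⁅y, ⁅y, X⁆⁆⁆ = 0 := by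
    intro i hi X hX
    have hk' : k = 2 ∨ k = -2 := sq_eq_sq_iff_eq_or_eq_neg.1 (by linarith)
    refine hgrad.eq_zero_of_mem
      (lie_mem_gradedPart hy (lie_mem_gradedPart hy (lie_mem_gradedPart hy hX))) ?_
    rcases hi with rfl | rfl | rfl <;> rcases hk' with rfl | rfl <;> norm_num
  ext1 X
  obtain ⟨a, ha, b, hb, e, he, rfl⟩ := hgrad.exists_add X
  simp only [pow_succ, pow_zero, one_mul, Module.End.mul_apply, LieAlgebra.ad_apply, lie_add,
    LinearMap.zero_apply, key _ (Or.inl rfl) a ha, key _ (Or.inr (Or.inl rfl)) b hb,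
    key _ (Or.inr (Or.inr rfl)) e he, add_zero]

/-- Every linear functional on `𝔫̄` is the pairing with an element of `𝔫`. -/
theorem IsGradingElement.exists_pairing_eq (hgrad : G.IsGradingElement h)
    (hK : LieAlgebra.IsKilling ℝ G.lieAlgebra) {c : ℝ} (hc : c ≠ 0)
    (f : G.nilBar h →ₗ[ℝ] ℝ) : ∃ X ∈ G.nil h, ∀ y : G.nilBar h, G.pairing c X y = f y := by
  obtain ⟨F, hF⟩ := LinearMap.exists_extend f
  obtain ⟨X, hX⟩ : ∃ X, killingForm ℝ G.lieAlgebra X = F := by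
    have hinj : Function.Injective (killingForm ℝ G.lieAlgebra) :=
      LinearMap.ker_eq_bot.1 (LieAlgebra.IsKilling.ker_killingForm_eq_bot ℝ G.lieAlgebra)
    exact (LinearMap.injective_iff_surjective_of_finrank_eq_finrank
      (Subspace.dual_finrank_eq).symm).1 hinj F
  obtain ⟨a, ha, b, hb, e, he, rfl⟩ := hgrad.exists_add X
  refine ⟨c⁻¹ • e, Submodule.smul_mem _ _ he, fun y => ?_⟩
  have h1 := killingForm_eq_zero_of_mem_gradedPart ha y.2 (by norm_num)
  have h2 := killingForm_eq_zero_of_mem_gradedPart hb y.2 (by norm_num)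
  have h3 : killingForm ℝ G.lieAlgebra e y = f y := by
    have h4 := LinearMap.congr_fun hX (y : G.lieAlgebra)
    rw [map_add, map_add, LinearMap.add_apply, LinearMap.add_apply, h1, h2, zero_add, zero_add] at h4
    rw [h4, ← hF]
    rfl
  rw [pairing, map_smul, LinearMap.smul_apply, h3, smul_eq_mul, mul_inv_cancel_left₀ hc]

/-- The part of the Jacobson–Morozov theorem that concerns `y ∈ 𝔫̄`: it lies in the image of
`(ad y) ^ 2`. That image is the orthogonal of `ker (ad y) ^ 2` for the Killing form, and `y` is orthogonal
to any `w` with `(ad y) ^ 2 w = 0` because `ad y ∘ ad w` is nilpotent. -/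
theorem IsGradingElement.exists_lie_lie_eq (hgrad : G.IsGradingElement h)
    (hK : LieAlgebra.IsKilling ℝ G.lieAlgebra) {y : G.lieAlgebra} (hy : y ∈ G.nilBar h) :
    ∃ e ∈ G.nil h, ⁅y, ⁅y, e⁆⁆ = y := by
  set A := LieAlgebra.ad ℝ G.lieAlgebra y with hA
  have hmem : y ∈ LinearMap.range (A ^ 2) := by
    by_contra hcon
    obtain ⟨F, hFy, hF⟩ := Submodule.exists_le_ker_of_notMem hcon
    obtain ⟨w, hw⟩ : ∃ w, killingForm ℝ G.lieAlgebra w = F := by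
      have hinj : Function.Injective (killingForm ℝ G.lieAlgebra) :=
        LinearMap.ker_eq_bot.1 (LieAlgebra.IsKilling.ker_killingForm_eq_bot ℝ G.lieAlgebra)
      exact (LinearMap.injective_iff_surjective_of_finrank_eq_finrank
        (Subspace.dual_finrank_eq).symm).1 hinj F
    have hyyw : ⁅y, ⁅y, w⁆⁆ = 0 := by
      have h1 : killingForm ℝ G.lieAlgebra ⁅y, ⁅y, w⁆⁆ = 0 := by
        ext b
        have h2 : killingForm ℝ G.lieAlgebra w ⁅y, ⁅y, b⁆⁆ = 0 := by
          rw [hw]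
          exact hF ⟨b, by simp [pow_two, hA]⟩
        have h3 : ∀ u v : G.lieAlgebra,
            killingForm ℝ G.lieAlgebra ⁅y, u⁆ v = - killingForm ℝ G.lieAlgebra u ⁅y, v⁆ := by
          intro u v
          rw [← LieModule.traceForm_apply_lie_apply, ← lie_skew, map_neg, LinearMap.neg_apply]
        rw [h3, h3, h2]
        simp
      have hinj : Function.Injective (killingForm ℝ G.lieAlgebra) :=
        LinearMap.ker_eq_bot.1 (LieAlgebra.IsKilling.ker_killingForm_eq_bot ℝ G.lieAlgebra)
      exact hinj (h1.trans (map_zero _).symm)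
    apply hFy
    rw [← hw, LieModule.traceForm_comm, killingForm_apply_apply]
    have h4 : ⁅A, ⁅A, LieAlgebra.ad ℝ G.lieAlgebra w⁆⁆ = 0 := by
      rw [hA, ← LieHom.map_lie, ← LieHom.map_lie, hyyw, map_zero]
    have h5 := isNilpotent_mul_of_ad_ad_eq_zero (hgrad.ad_pow_three (by norm_num) hy) h4
    exact (LinearMap.isNilpotent_trace_of_isNilpotent h5).eq_zero
  obtain ⟨X, hX⟩ := hmem
  obtain ⟨a, ha, b, hb, e, he, rfl⟩ := hgrad.exists_add X
  refine ⟨e, he, ?_⟩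
  have h1 : ⁅y, a⁆ = 0 := hgrad.lie_nilBar hy ha
  have h2 : ⁅y, ⁅y, b⁆⁆ = 0 :=
    hgrad.eq_zero_of_mem (lie_mem_gradedPart hy (lie_mem_gradedPart hy hb)) (by norm_num)
  have h3 : ⁅y, ⁅y, a + b + e⁆⁆ = y := by simpa [pow_two, hA] using hX
  rwa [lie_add, lie_add, lie_add, lie_add, h1, h2, lie_zero, zero_add, zero_add] at h3

/-- Every displacement `u` is, up to a quadratic term, tangent to the orbit of `𝔪` at the displaced point
`y + u`. Indeed `Z = ⁅e, y⁆ - h` satisfies `⁅Z, y⁆ = 0` and `⁅Z, u⁆ = 2 u + ⁅⁅e, u⁆, y⁆` if `e` belongs to an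
`𝔰𝔩₂`-triple of `y`, and `W = Z - ⁅e, u⁆`. -/
theorem IsGradingElement.exists_transversal (hgrad : G.IsGradingElement h)
    (hK : LieAlgebra.IsKilling ℝ G.lieAlgebra) {y : G.lieAlgebra} (hy : y ∈ G.nilBar h) :
    ∃ e : G.lieAlgebra, ∀ u ∈ G.nilBar h, ⁅e, u⁆ ∈ G.gradedPart h 0 ∧
      ∃ W ∈ G.gradedPart h 0, (2 : ℝ) • u - ⁅⁅e, u⁆, u⁆ = ⁅W, y + u⁆ := by
  obtain ⟨e', he', hye'⟩ := hgrad.exists_lie_lie_eq hK hy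
  set e := (-2 : ℝ) • e' with he_def
  have he : e ∈ G.nil h := Submodule.smul_mem _ _ he'
  have hye : ⁅⁅e, y⁆, y⁆ = (-2 : ℝ) • y := by
    rw [← lie_skew, ← lie_skew e y, lie_neg, neg_neg, he_def, lie_smul, lie_smul, hye']
  have hm : ∀ u ∈ G.nilBar h, ⁅e, u⁆ ∈ G.gradedPart h 0 := fun u hu => by
    simpa using lie_mem_gradedPart he hu
  have hh : h ∈ G.gradedPart h 0 := by rw [mem_gradedPart]; simp
  refine ⟨e, fun u hu => ⟨hm u hu, ⁅e, y⁆ - h - ⁅e, u⁆,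
    Submodule.sub_mem _ (Submodule.sub_mem _ (hm y hy) hh) (hm u hu), ?_⟩⟩
  have h1 : ⁅⁅e, y⁆, u⁆ = ⁅⁅e, u⁆, y⁆ := by
    rw [lie_lie, hgrad.lie_nilBar hy hu, lie_zero, zero_sub, lie_skew]
  have h2 := (mem_gradedPart G).1 hy
  have h3 := (mem_gradedPart G).1 hu
  rw [sub_lie, sub_lie, lie_add, lie_add, lie_add, hye, h1, h2, h3]
  module

end RealAlgebraicGroup

/-! ### Exponential coordinates on a closed subgroup -/

section ClosedSubgroup

variable {A : Type*} [NormedRing A] [NormedAlgebra ℝ A] [FiniteDimensional ℝ A]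

theorem contDiff_normedSpace_exp {n : WithTop ℕ∞} : ContDiff ℝ n (NormedSpace.exp : A → A) := by
  have : CompleteSpace A := FiniteDimensional.complete ℝ A
  exact AnalyticOnNhd.contDiff fun x _ => NormedSpace.exp_analytic (𝕂 := ℝ) x

theorem exp_neg_mul_exp (X : A) : NormedSpace.exp (-X) * NormedSpace.exp X = 1 := by
  have : CompleteSpace A := FiniteDimensional.complete ℝ A
  let _ : NormedAlgebra ℚ A := NormedAlgebra.restrictScalars ℚ ℝ A
  rw [← NormedSpace.exp_add_of_commute (Commute.refl X).neg_left, neg_add_cancel, NormedSpace.exp_zero]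

/-- A closed multiplicative set contains no exponentials of small nonzero elements transverse to its
tangent directions: the limit direction of a sequence of such elements would be tangent. -/
theorem eventually_exp_mem_imp_eq_zero {K : Set A} (hK : IsClosed K) (h1 : (1 : A) ∈ K)
    (hmul : ∀ a ∈ K, ∀ b ∈ K, a * b ∈ K) (hinv : ∀ a ∈ K, ∀ b, b * a = 1 → b ∈ K)
    (q : Submodule ℝ A) (hq : ∀ X ∈ q, (∀ t : ℝ, NormedSpace.exp (t • X) ∈ K) → X = 0) :
    ∀ᶠ B : q in 𝓝 0, NormedSpace.exp (B : A) ∈ K → B = 0 := by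
  have : CompleteSpace A := FiniteDimensional.complete ℝ A
  let _ : NormedAlgebra ℚ A := NormedAlgebra.restrictScalars ℚ ℝ A
  by_contra hcon
  rw [Filter.not_eventually] at hcon
  obtain ⟨B, hB0, hB'⟩ := Filter.frequently_iff_seq_forall.1 hcon
  have hB : ∀ k, NormedSpace.exp (B k : A) ∈ K ∧ B k ≠ 0 := fun k => Classical.not_imp.1 (hB' k)
  have hpos : ∀ k, 0 < ‖B k‖ := fun k => norm_pos_iff.2 (hB k).2
  obtain ⟨u, hu, φ, hφ, hlim⟩ := (isCompact_sphere (0 : q) 1).tendsto_subseq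
    (x := fun k => ‖B k‖⁻¹ • B k) (fun k => by
      rw [mem_sphere_zero_iff_norm, norm_smul, norm_inv, norm_norm, inv_mul_cancel₀ (hpos k).ne'])
  have hnonneg : ∀ t : ℝ, 0 ≤ t → NormedSpace.exp (t • (u : A)) ∈ K := by
    intro t ht
    have hnorm : Filter.Tendsto (fun k => ‖B (φ k)‖⁻¹) Filter.atTop Filter.atTop := by
      refine Filter.Tendsto.inv_tendsto_nhdsGT_zero (tendsto_nhdsWithin_iff.2 ⟨?_, .of_forall
        fun k => hpos (φ k)⟩)
      simpa using (hB0.comp hφ.tendsto_atTop).norm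
    have h2 : Filter.Tendsto (fun k => (⌊t * ‖B (φ k)‖⁻¹⌋₊ : ℝ) / ‖B (φ k)‖⁻¹) Filter.atTop (𝓝 t) :=
      (tendsto_nat_floor_mul_div_atTop ht).comp hnorm
    have h3 : Filter.Tendsto
        (fun k => ((⌊t * ‖B (φ k)‖⁻¹⌋₊ : ℝ) / ‖B (φ k)‖⁻¹) • (‖B (φ k)‖⁻¹ • B (φ k)))
        Filter.atTop (𝓝 (t • u)) := h2.smul hlim
    have h4 : Filter.Tendsto (fun k => NormedSpace.exp (⌊t * ‖B (φ k)‖⁻¹⌋₊ • (B (φ k) : A)))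
        Filter.atTop (𝓝 (NormedSpace.exp (t • (u : A)))) := by
      refine ((NormedSpace.exp_continuous.comp continuous_subtype_val).continuousAt.tendsto.comp
        h3).congr fun k => ?_
      simp only [Function.comp_apply, Submodule.coe_smul, smul_smul]
      rw [div_mul_cancel₀ _ (inv_ne_zero (hpos _).ne'), Nat.cast_smul_eq_nsmul]
    refine hK.mem_of_tendsto h4 (.of_forall fun k => ?_)
    rw [NormedSpace.exp_nsmul]
    induction ⌊t * ‖B (φ k)‖⁻¹⌋₊ with
    | zero => simpa using h1
    | succ m ih => rw [pow_succ]; exact hmul _ ih _ (hB _).1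
  have hu0 : (u : A) = 0 := by
    refine hq u u.2 fun t => ?_
    rcases le_total 0 t with ht | ht
    · exact hnonneg t ht
    · refine hinv _ (hnonneg (-t) (by linarith)) _ ?_
      rw [← exp_neg_mul_exp ((-t) • (u : A)), neg_smul, neg_neg]
  have : ‖u‖ = 1 := mem_sphere_zero_iff_norm.1 hu
  rw [Submodule.coe_eq_zero.1 hu0, norm_zero] at this
  exact zero_ne_one this

/-- Cartan's theorem on closed subgroups, in the form of a smooth local logarithm: if the image of `ι`
is the set of directions tangent to the closed group `K`, then `exp ∘ ι` has near `1` a smooth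
local inverse on `K`. -/
theorem exists_smooth_log {E : Type*} [NormedAddCommGroup E] [NormedSpace ℝ E]
    [FiniteDimensional ℝ E] (ι : E →ₗ[ℝ] A) (hι : Function.Injective ι)
    {K : Set A} (hK : IsClosed K) (h1 : (1 : A) ∈ K)
    (hmul : ∀ a ∈ K, ∀ b ∈ K, a * b ∈ K) (hinv : ∀ a ∈ K, ∀ b, b * a = 1 → b ∈ K)
    (hexp : ∀ X, X ∈ LinearMap.range ι ↔ ∀ t : ℝ, NormedSpace.exp (t • X) ∈ K) :
    ∃ l : A → E, ContDiffAt ℝ ∞ l 1 ∧ l 1 = 0 ∧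
      ∀ᶠ a in 𝓝 (1 : A), a ∈ K → NormedSpace.exp (ι (l a)) = a := by
  have : CompleteSpace A := FiniteDimensional.complete ℝ A
  have : CompleteSpace E := FiniteDimensional.complete ℝ E
  obtain ⟨q, hq⟩ := Submodule.exists_isCompl (LinearMap.range ι)
  have hsmall := eventually_exp_mem_imp_eq_zero hK h1 hmul hinv q
    (fun X hX ht => Submodule.disjoint_def.1 hq.disjoint X ((hexp X).2 ht) hX)
  let e : (E × q) ≃L[ℝ] A := (((LinearEquiv.ofInjective ι hι).prodCongr (LinearEquiv.refl ℝ q)).trans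
    (Submodule.prodEquivOfIsCompl _ _ hq)).toContinuousLinearEquiv
  have he : ∀ p : E × q, e p = ι p.1 + p.2 := fun p => rfl
  let ιc : E →L[ℝ] A := LinearMap.toContinuousLinearMap ι
  have hιc : ∀ X, ιc X = ι X := fun X => rfl
  let f : E × q → A := fun p => NormedSpace.exp (ιc p.1) * NormedSpace.exp (q.subtypeL p.2)
  have hf : ContDiff ℝ ∞ f :=
    (contDiff_normedSpace_exp.comp (ιc.contDiff.comp contDiff_fst)).mul
      (contDiff_normedSpace_exp.comp (q.subtypeL.contDiff.comp contDiff_snd))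
  have hf' : HasFDerivAt f (e : (E × q) →L[ℝ] A) 0 := by
    have h1 : HasFDerivAt (fun p : E × q => NormedSpace.exp (ιc p.1))
        ((1 : A →L[ℝ] A).comp (ιc.comp (ContinuousLinearMap.fst ℝ E q))) 0 := by
      refine HasFDerivAt.comp (0 : E × q) ?_ (ιc.comp (ContinuousLinearMap.fst ℝ E q)).hasFDerivAt
      simpa using hasFDerivAt_exp_zero (𝕂 := ℝ) (𝔸 := A)
    have h2 : HasFDerivAt (fun p : E × q => NormedSpace.exp (q.subtypeL p.2))
        ((1 : A →L[ℝ] A).comp (q.subtypeL.comp (ContinuousLinearMap.snd ℝ E q))) 0 := by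
      refine HasFDerivAt.comp (0 : E × q) ?_
        (q.subtypeL.comp (ContinuousLinearMap.snd ℝ E q)).hasFDerivAt
      simpa using hasFDerivAt_exp_zero (𝕂 := ℝ) (𝔸 := A)
    refine (h1.mul' h2).congr_fderiv ?_
    refine ContinuousLinearMap.ext fun p => ?_
    simp [he, hιc, add_comm]
  have hf0 : f 0 = 1 := by simp [f]
  have hfc := hf.contDiffAt (x := (0 : E × q))
  have hne : (∞ : WithTop ℕ∞) ≠ 0 := by simp
  set g := hfc.localInverse hf' hne with hg
  have hgs : ContDiffAt ℝ ∞ g 1 := by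
    have := hfc.to_localInverse hf' hne
    rwa [hf0] at this
  have hg1 : g 1 = 0 := by
    have := hfc.localInverse_apply_image hf' hne
    rwa [hf0] at this
  have hfg : ∀ᶠ a in 𝓝 (1 : A), f (g a) = a := by
    have := (hfc.hasStrictFDerivAt' hf' hne).eventually_right_inverse
    rwa [hf0] at this
  refine ⟨fun a => (g a).1, hgs.fst, by simp only [hg1, Prod.fst_zero], ?_⟩
  have hB : Filter.Tendsto (fun a => (g a).2) (𝓝 1) (𝓝 0) := by
    have := hgs.continuousAt.snd.tendsto
    simpa [hg1] using this
  filter_upwards [hfg, hB.eventually hsmall] with a ha hsm haK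
  have hX : NormedSpace.exp (ιc (g a).1) ∈ K := by
    have := (hexp (ι (g a).1)).1 ⟨_, rfl⟩ 1
    rwa [one_smul] at this
  have hBK : NormedSpace.exp ((g a).2 : A) ∈ K := by
    have h5 : NormedSpace.exp ((g a).2 : A) = NormedSpace.exp (-(ιc (g a).1)) * a := by
      have h6 : NormedSpace.exp (ιc (g a).1) * NormedSpace.exp ((g a).2 : A) = a := ha
      rw [← one_mul (NormedSpace.exp ((g a).2 : A)), ← exp_neg_mul_exp (ιc (g a).1), mul_assoc, h6]
    rw [h5]
    exact hmul _ (hinv _ hX _ (exp_neg_mul_exp _)) _ haK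
  have h0 := hsm hBK
  have h6 : f (g a) = NormedSpace.exp (ιc (g a).1) := by
    simp only [f, h0, map_zero, NormedSpace.exp_zero, mul_one]
  rw [← hιc, ← h6, ha]

end ClosedSubgroup

/-! ### Smooth vectors -/

namespace RealAlgebraicGroup

variable {d : ℕ} {G : RealAlgebraicGroup d}

section Exponential

attribute [local instance] Matrix.linftyOpNormedRing Matrix.linftyOpNormedAlgebra

/-- The matrix of a real point. -/
abbrev toMatrix (g : G.realPoints) : Matrix (Fin d) (Fin d) ℝ :=
  ((g : Matrix.SpecialLinearGroup (Fin d) ℝ) : Matrix (Fin d) (Fin d) ℝ)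

theorem toMatrix_injective : Function.Injective (toMatrix (G := G)) :=
  fun _ _ hgk => Subtype.ext (Subtype.ext hgk)

theorem toMatrix_mul (g k : G.realPoints) : toMatrix (g * k) = toMatrix g * toMatrix k := by
  rw [toMatrix, Subgroup.coe_mul, Matrix.SpecialLinearGroup.coe_mul]

theorem toMatrix_one : toMatrix (1 : G.realPoints) = 1 := by
  rw [toMatrix, Subgroup.coe_one, Matrix.SpecialLinearGroup.coe_one]

theorem contDiff_coe {n : WithTop ℕ∞} :
    ContDiff ℝ n fun X : G.lieAlgebra => (X : Matrix (Fin d) (Fin d) ℝ) :=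
  LinearIsometry.contDiff (⟨G.lieAlgebra.toSubmodule.subtype, fun _ => rfl⟩ :
    G.lieAlgebra →ₗᵢ[ℝ] Matrix (Fin d) (Fin d) ℝ)

theorem contDiff_toMatrix_expMap {n : WithTop ℕ∞} :
    ContDiff ℝ n fun X : G.lieAlgebra => toMatrix (G.expMap X) := by
  have e : (fun X : G.lieAlgebra => toMatrix (G.expMap X)) =
      fun X : G.lieAlgebra => NormedSpace.exp (X : Matrix (Fin d) (Fin d) ℝ) :=
    funext fun X => coe_expMap G X
  rw [e]
  exact contDiff_normedSpace_exp.comp contDiff_coe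

theorem continuous_of_continuous_toMatrix {P : Type*} [TopologicalSpace P] {γ : P → G.realPoints}
    (hγ : Continuous fun p => toMatrix (γ p)) : Continuous γ :=
  Continuous.subtype_mk (Continuous.subtype_mk hγ _) _

theorem continuous_expMap : Continuous fun X : G.lieAlgebra => G.expMap X :=
  continuous_of_continuous_toMatrix (contDiff_toMatrix_expMap (n := 0)).continuous

theorem expMap_zero : G.expMap 0 = 1 :=
  toMatrix_injective (by rw [toMatrix, coe_expMap, toMatrix_one]; simp)

theorem expMap_add_of_lie_eq_zero {X Y : G.lieAlgebra} (hXY : ⁅X, Y⁆ = 0) :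
    G.expMap (X + Y) = G.expMap X * G.expMap Y := by
  refine toMatrix_injective ?_
  have hc : Commute (X : Matrix (Fin d) (Fin d) ℝ) Y := by
    have := congrArg (fun Z : G.lieAlgebra => (Z : Matrix (Fin d) (Fin d) ℝ)) hXY
    exact sub_eq_zero.1 this
  rw [toMatrix_mul, toMatrix, toMatrix, toMatrix, coe_expMap, coe_expMap, coe_expMap]
  exact Matrix.exp_add_of_commute _ _ hc

theorem expMap_add_smul (s t : ℝ) (X : G.lieAlgebra) :
    G.expMap ((s + t) • X) = G.expMap (s • X) * G.expMap (t • X) := by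
  rw [add_smul]
  exact expMap_add_of_lie_eq_zero (by simp)

theorem expMap_neg (X : G.lieAlgebra) : G.expMap (-X) = (G.expMap X)⁻¹ := by
  refine eq_inv_of_mul_eq_one_left ?_
  rw [← expMap_add_of_lie_eq_zero (by simp), neg_add_cancel, expMap_zero]

variable (G) in
/-- Linear coordinates on the Lie algebra. -/
def coordEquiv : (Fin (Module.finrank ℝ G.lieAlgebra) → ℝ) ≃ₗ[ℝ] G.lieAlgebra :=
  (Module.finBasis ℝ G.lieAlgebra).equivFun.symm

theorem contDiff_coordEquiv {n : WithTop ℕ∞} : ContDiff ℝ n (coordEquiv G) := by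
  have := (LinearMap.toContinuousLinearMap (coordEquiv G).toLinearMap).contDiff (n := n)
  exact this

theorem contDiff_coordEquiv_symm {n : WithTop ℕ∞} : ContDiff ℝ n (coordEquiv G).symm := by
  have := (LinearMap.toContinuousLinearMap (coordEquiv G).symm.toLinearMap).contDiff (n := n)
  exact this

variable (G) in
/-- A smooth local logarithm on `G(ℝ)`, in linear coordinates of the Lie algebra. -/
theorem exists_log : ∃ l : Matrix (Fin d) (Fin d) ℝ → (Fin (Module.finrank ℝ G.lieAlgebra) → ℝ),
    ContDiffAt ℝ ∞ l 1 ∧ l 1 = 0 ∧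
      ∀ᶠ a in 𝓝 (1 : Matrix (Fin d) (Fin d) ℝ), ∀ g : G.realPoints, toMatrix g = a →
        G.expMap (coordEquiv G (l a)) = g := by
  set K : Set (Matrix (Fin d) (Fin d) ℝ) :=
    {A | ∃ g ∈ G.realPoints, (g : Matrix (Fin d) (Fin d) ℝ) = A} with hK
  obtain ⟨l, hl, hl1, hlog⟩ := exists_smooth_log
    (G.lieAlgebra.toSubmodule.subtype ∘ₗ (coordEquiv G).toLinearMap)
    (Subtype.val_injective.comp (coordEquiv G).injective) (K := K) G.isClosed_matrices
    ⟨1, one_mem _, by simp⟩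
    (by
      rintro _ ⟨g, hg, rfl⟩ _ ⟨k, hk, rfl⟩
      exact ⟨g * k, mul_mem hg hk, by simp⟩)
    (by
      rintro _ ⟨g, hg, rfl⟩ b hb
      refine ⟨g⁻¹, inv_mem hg, ?_⟩
      have h1 : (g : Matrix (Fin d) (Fin d) ℝ) *
          ((g⁻¹ : Matrix.SpecialLinearGroup (Fin d) ℝ) : Matrix (Fin d) (Fin d) ℝ) = 1 := by
        rw [← Matrix.SpecialLinearGroup.coe_mul, mul_inv_cancel, Matrix.SpecialLinearGroup.coe_one]
      exact (left_inv_eq_right_inv hb h1).symm)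
    (by
      intro X
      constructor
      · rintro ⟨Y, rfl⟩
        exact (coordEquiv G Y).2
      · intro hX
        exact ⟨(coordEquiv G).symm ⟨X, hX⟩, by simp⟩)
  refine ⟨l, hl, hl1, hlog.mono fun a ha g hg => toMatrix_injective ?_⟩
  rw [hg, toMatrix, coe_expMap]
  exact ha ⟨g, g.2, hg⟩

end Exponential

section Representation

attribute [local instance] Matrix.linftyOpNormedRing Matrix.linftyOpNormedAlgebra

variable {H : Type*} [NormedAddCommGroup H] [InnerProductSpace ℂ H]
  {π : G.realPoints →* (H ≃ₗᵢ[ℂ] H)}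

theorem rep_mul_apply (g k : G.realPoints) (v : H) : π (g * k) v = π g (π k v) := by
  rw [map_mul]; rfl

theorem rep_one_apply (v : H) : π 1 v = v := by
  rw [map_one]; rfl

/-- A unitary operator of the representation as a continuous real-linear map. -/
def repL (π : G.realPoints →* (H ≃ₗᵢ[ℂ] H)) (g : G.realPoints) : H →L[ℝ] H :=
  ((π g).toContinuousLinearEquiv.toContinuousLinearMap).restrictScalars ℝ

theorem repL_apply (g : G.realPoints) (v : H) : repL π g v = π g v := rfl

/-- The orbit map of a smooth vector is smooth along every smooth family of group elements. -/
theorem contDiffAt_rep {v : H} (hv : v ∈ smoothVectors π) {P : Type*} [NormedAddCommGroup P]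
    [NormedSpace ℝ P] {γ : P → G.realPoints} {p₀ : P}
    (hγ : ContDiffAt ℝ ∞ (fun p => toMatrix (γ p)) p₀) :
    ContDiffAt ℝ ∞ (fun p => π (γ p) v) p₀ := by
  obtain ⟨l, hl, hl1, hlog⟩ := exists_log G
  have h1 : toMatrix (γ p₀)⁻¹ * toMatrix (γ p₀) = 1 := by
    rw [← toMatrix_mul, inv_mul_cancel, toMatrix_one]
  have hδ : ContDiffAt ℝ ∞ (fun p => toMatrix (γ p₀)⁻¹ * toMatrix (γ p)) p₀ :=
    contDiffAt_const.mul hγ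
  have hlδ : ContDiffAt ℝ ∞ (fun p => l (toMatrix (γ p₀)⁻¹ * toMatrix (γ p))) p₀ := by
    refine ContDiffAt.comp p₀ (g := l) ?_ hδ
    rwa [h1]
  have hv' : ContDiff ℝ ∞ fun X : G.lieAlgebra => π (G.expMap X) v := hv
  have h2 : ContDiffAt ℝ ∞
      (fun p => repL π (γ p₀) (π (G.expMap (coordEquiv G
        (l (toMatrix (γ p₀)⁻¹ * toMatrix (γ p))))) v)) p₀ :=
    (repL π (γ p₀)).contDiff.contDiffAt.comp p₀
      ((hv'.comp contDiff_coordEquiv).contDiffAt.comp p₀ hlδ)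
  refine h2.congr_of_eventuallyEq ?_
  have h3 : Filter.Tendsto (fun p => toMatrix (γ p₀)⁻¹ * toMatrix (γ p)) (𝓝 p₀) (𝓝 1) := by
    have := hδ.continuousAt.tendsto
    rwa [h1] at this
  filter_upwards [h3.eventually hlog] with p hp
  rw [hp ((γ p₀)⁻¹ * γ p) (toMatrix_mul _ _), repL_apply, ← rep_mul_apply, mul_inv_cancel_left]

theorem contDiff_rep {v : H} (hv : v ∈ smoothVectors π) {P : Type*} [NormedAddCommGroup P]
    [NormedSpace ℝ P] {γ : P → G.realPoints} (hγ : ContDiff ℝ ∞ fun p => toMatrix (γ p)) :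
    ContDiff ℝ ∞ fun p => π (γ p) v :=
  contDiff_iff_contDiffAt.2 fun _ => contDiffAt_rep hv hγ.contDiffAt

theorem contDiff_smul_right (X : G.lieAlgebra) : ContDiff ℝ ∞ fun t : ℝ => t • X :=
  contDiff_id.smul contDiff_const

theorem hasDerivAt_rep_zero {v : H} (hv : v ∈ smoothVectors π) (X : G.lieAlgebra) :
    HasDerivAt (fun t : ℝ => π (G.expMap (t • X)) v) (dRep π X v) 0 := by
  have h1 : ContDiff ℝ ∞ fun t : ℝ => π (G.expMap (t • X)) v :=
    ContDiff.comp (g := fun X : G.lieAlgebra => π (G.expMap X) v) hv (contDiff_smul_right X)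
  exact (h1.differentiable (by simp)).differentiableAt.hasDerivAt

/-- A derivative at the origin of `t ↦ π (exp tX) v` propagates along the one-parameter group. -/
theorem hasDerivAt_rep_of_hasDerivAt_zero {u w : H} {X : G.lieAlgebra}
    (hu : HasDerivAt (fun t : ℝ => π (G.expMap (t • X)) u) w 0) (t : ℝ) :
    HasDerivAt (fun t : ℝ => π (G.expMap (t • X)) u) (π (G.expMap (t • X)) w) t := by
  have h0 : HasDerivAt (fun s : ℝ => π (G.expMap (s • X)) u) w (t - t) := by rwa [sub_self]
  have h1 : HasDerivAt (fun s : ℝ => π (G.expMap ((s - t) • X)) u) w t :=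
    h0.comp_sub_const t t
  have h2 := (repL π (G.expMap (t • X))).hasFDerivAt.comp_hasDerivAt t h1
  refine h2.congr_of_eventuallyEq (.of_forall fun s => ?_)
  simp only [Function.comp_apply, repL_apply, ← rep_mul_apply, ← expMap_add_smul, add_sub_cancel]

theorem hasDerivAt_rep {v : H} (hv : v ∈ smoothVectors π) (X : G.lieAlgebra) (t : ℝ) :
    HasDerivAt (fun t : ℝ => π (G.expMap (t • X)) v) (π (G.expMap (t • X)) (dRep π X v)) t :=
  hasDerivAt_rep_of_hasDerivAt_zero (hasDerivAt_rep_zero hv X) t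

theorem mem_smoothVectors_iff {v : H} : v ∈ smoothVectors π ↔
    ContDiff ℝ ∞ fun x => π (G.expMap (coordEquiv G x)) v := by
  constructor
  · intro hv
    exact ContDiff.comp (g := fun X : G.lieAlgebra => π (G.expMap X) v) hv contDiff_coordEquiv
  · intro hv
    have h1 : ContDiff ℝ ∞ fun X : G.lieAlgebra =>
        π (G.expMap (coordEquiv G ((coordEquiv G).symm X))) v :=
      ContDiff.comp (g := fun x => π (G.expMap (coordEquiv G x)) v) hv contDiff_coordEquiv_symm
    simp only [LinearEquiv.apply_symm_apply] at h1
    exact h1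

theorem dRep_eq_fderiv {v : H} (hv : v ∈ smoothVectors π) (X : G.lieAlgebra) :
    dRep π X v = fderiv ℝ (fun x => π (G.expMap (coordEquiv G x)) v) 0 ((coordEquiv G).symm X) := by
  have h1 : HasFDerivAt (fun x => π (G.expMap (coordEquiv G x)) v)
      (fderiv ℝ (fun x => π (G.expMap (coordEquiv G x)) v) 0)
      ((0 : ℝ) • (coordEquiv G).symm X) := by
    rw [zero_smul]
    exact (((mem_smoothVectors_iff.1 hv).differentiable (by simp)).differentiableAt).hasFDerivAt
  have h2 : HasDerivAt (fun t : ℝ => t • (coordEquiv G).symm X) ((coordEquiv G).symm X) 0 := by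
    simpa using (hasDerivAt_id (0 : ℝ)).smul_const ((coordEquiv G).symm X)
  have h3 := h1.comp_hasDerivAt (0 : ℝ) h2
  refine (hasDerivAt_rep_zero hv X).unique (h3.congr_of_eventuallyEq (.of_forall fun t => ?_))
  simp

theorem dRep_mem {v : H} (hv : v ∈ smoothVectors π) (X : G.lieAlgebra) :
    dRep π X v ∈ smoothVectors π := by
  set F : (Fin (Module.finrank ℝ G.lieAlgebra) → ℝ) × ℝ → H :=
    fun p => π (G.expMap (coordEquiv G p.1) * G.expMap (p.2 • X)) v with hF
  have hFs : ContDiff ℝ ∞ F := by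
    refine contDiff_rep hv ?_
    simp only [toMatrix_mul]
    exact (contDiff_toMatrix_expMap.comp (contDiff_coordEquiv.comp contDiff_fst)).mul
      (contDiff_toMatrix_expMap.comp ((contDiff_smul_right X).comp contDiff_snd))
  have hd : ContDiff ℝ ∞ fun x => fderiv ℝ F (x, 0) (0, 1) := by
    have h1 : ContDiff ℝ ∞ (fderiv ℝ F) := hFs.fderiv_right (by simp)
    exact (h1.comp (contDiff_id.prodMk contDiff_const)).clm_apply contDiff_const
  refine mem_smoothVectors_iff.2 ?_
  have he : (fun x => π (G.expMap (coordEquiv G x)) (dRep π X v)) =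
      fun x => fderiv ℝ F (x, 0) (0, 1) := by
    funext x
    have h1 : HasFDerivAt F (fderiv ℝ F (x, 0)) (x, 0) :=
      (hFs.differentiable (by simp)).differentiableAt.hasFDerivAt
    have h2 := h1.comp_hasDerivAt (0 : ℝ)
      ((hasDerivAt_const (0 : ℝ) x).prodMk (hasDerivAt_id (0 : ℝ)))
    have h4 := (repL π (G.expMap (coordEquiv G x))).hasFDerivAt.comp_hasDerivAt 0
      (hasDerivAt_rep_zero hv X)
    refine HasDerivAt.unique (h4.congr_of_eventuallyEq (.of_forall fun t => ?_)) h2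
    simp only [Function.comp_apply, hF, repL_apply, rep_mul_apply]
  rw [he]
  exact hd

theorem rep_dRep {v : H} (hv : v ∈ smoothVectors π) (g : G.realPoints) (X : G.lieAlgebra) :
    π g (dRep π X v) = dRep π (g • X) (π g v) := by
  have h1 := (repL π g).hasFDerivAt.comp_hasDerivAt 0 (hasDerivAt_rep_zero hv X)
  refine h1.unique ((hasDerivAt_rep_zero (smul_mem_smoothVectors π g hv)
    (g • X)).congr_of_eventuallyEq (.of_forall fun t => ?_))
  simp only [Function.comp_apply, repL_apply, ← smul_real, expMap_smul, ← rep_mul_apply,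
    inv_mul_cancel_right]

/-- The action of the Lie algebra on the smooth vectors, linear in both variables. -/
def dRepL (π : G.realPoints →* (H ≃ₗᵢ[ℂ] H)) :
    G.lieAlgebra →ₗ[ℝ] smoothVectors π →ₗ[ℂ] smoothVectors π :=
  LinearMap.mk₂' ℝ ℂ (fun X v => ⟨dRep π X v, dRep_mem v.2 X⟩)
    (fun X Y v => Subtype.ext <| by
      simp only [dRep_eq_fderiv v.2, map_add, Submodule.coe_add])
    (fun a X v => Subtype.ext <| by
      simp only [dRep_eq_fderiv v.2, map_smul]; rfl)
    (fun X v w => Subtype.ext <| by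
      refine (hasDerivAt_rep_zero (v + w).2 X).unique ?_
      refine ((hasDerivAt_rep_zero v.2 X).add
        (hasDerivAt_rep_zero w.2 X)).congr_of_eventuallyEq (.of_forall fun t => ?_)
      exact (π (G.expMap (t • X))).map_add (v : H) w)
    (fun a X v => Subtype.ext <| by
      refine (hasDerivAt_rep_zero (a • v).2 X).unique ?_
      have := (hasDerivAt_rep_zero v.2 X).const_smul a
      refine this.congr_of_eventuallyEq (.of_forall fun t => ?_)
      exact (π (G.expMap (t • X))).map_smul a (v : H))

theorem continuous_rep_expMap (hπ : ∀ v : H, Continuous fun g => π g v) (v : H) :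
    Continuous fun X : G.lieAlgebra => π (G.expMap X) v :=
  (hπ v).comp continuous_expMap

/-- If the one-parameter derivatives of a vector exist and depend linearly on the direction, then its
orbit map is Fréchet differentiable at the origin. -/
theorem hasFDerivAt_rep_zero (hπ : ∀ v : H, Continuous fun g => π g v) {u : H}
    (D : (Fin (Module.finrank ℝ G.lieAlgebra) → ℝ) →L[ℝ] H)
    (hD : ∀ x, HasDerivAt (fun t : ℝ => π (G.expMap (t • coordEquiv G x)) u) (D x) 0) :
    HasFDerivAt (fun x => π (G.expMap (coordEquiv G x)) u) D 0 := by
  let b := Pi.basisFun ℝ (Fin (Module.finrank ℝ G.lieAlgebra))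
  let co : Fin (Module.finrank ℝ G.lieAlgebra) →
      ((Fin (Module.finrank ℝ G.lieAlgebra) → ℝ) →L[ℝ] ℝ) := fun j => ContinuousLinearMap.proj j
  have hco : ∀ X, X = ∑ j, co j X • b j := fun X => (b.sum_repr X).symm
  set S : ℝ := ∑ j, ‖co j‖ with hS
  have hS0 : 0 ≤ S := Finset.sum_nonneg fun _ _ => norm_nonneg _
  rw [hasFDerivAt_iff_isLittleO_nhds_zero, Asymptotics.isLittleO_iff]
  intro ε hε
  have hε' : 0 < ε / (S + 1) := by positivity
  have hev : ∀ᶠ X in 𝓝 (0 : Fin (Module.finrank ℝ G.lieAlgebra) → ℝ), ∀ j,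
      ‖π (G.expMap (coordEquiv G X)) (D (b j)) - D (b j)‖ < ε / (S + 1) := by
    rw [Filter.eventually_all]
    intro j
    have h1 := ((continuous_rep_expMap hπ (D (b j))).comp
      (contDiff_coordEquiv (G := G) (n := 0)).continuous).continuousAt.tendsto (x := 0)
    simp only [Function.comp_apply, map_zero, expMap_zero, rep_one_apply] at h1
    have h2 := h1.eventually (Metric.ball_mem_nhds _ hε')
    filter_upwards [h2] with X hX
    rwa [← dist_eq_norm]
  obtain ⟨δ, hδ, hball⟩ := Metric.eventually_nhds_iff.1 hev
  filter_upwards [Metric.ball_mem_nhds (0 : Fin (Module.finrank ℝ G.lieAlgebra) → ℝ) hδ] with X hX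
  have hX' : ‖X‖ < δ := by simpa using hX
  have hder : ∀ t ∈ Set.Icc (0 : ℝ) 1, HasDerivWithinAt
      (fun t : ℝ => π (G.expMap (coordEquiv G (t • X))) u - t • D X)
      (π (G.expMap (coordEquiv G (t • X))) (D X) - D X) (Set.Icc 0 1) t := by
    intro t _
    have := (hasDerivAt_rep_of_hasDerivAt_zero (hD X) t).sub ((hasDerivAt_id t).smul_const (D X))
    rw [one_smul] at this
    simp only [← map_smul (coordEquiv G)] at this
    exact this.hasDerivWithinAt
  have hbd : ∀ t ∈ Set.Ico (0 : ℝ) 1, ‖π (G.expMap (coordEquiv G (t • X))) (D X) - D X‖ ≤ ε * ‖X‖ := by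
    intro t ht
    have htX : dist (t • X) 0 < δ := by
      rw [dist_zero_right, norm_smul, Real.norm_eq_abs, abs_of_nonneg ht.1]
      exact lt_of_le_of_lt (mul_le_of_le_one_left (norm_nonneg _) ht.2.le) hX'
    have e : π (G.expMap (coordEquiv G (t • X))) (D X) - D X =
        ∑ j, co j X • (π (G.expMap (coordEquiv G (t • X))) (D (b j)) - D (b j)) := by
      have hDX : D X = ∑ j, D (co j X • b j) := by
        conv_lhs => rw [hco X]
        rw [map_sum]
      rw [hDX]
      rw [← repL_apply, map_sum, ← Finset.sum_sub_distrib]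
      refine Finset.sum_congr rfl fun j _ => ?_
      rw [map_smul D, map_smul (repL π _), smul_sub, repL_apply]
    rw [e]
    calc ‖∑ j, co j X • (π (G.expMap (coordEquiv G (t • X))) (D (b j)) - D (b j))‖
        ≤ ∑ j, ‖co j X • (π (G.expMap (coordEquiv G (t • X))) (D (b j)) - D (b j))‖ := norm_sum_le _ _
      _ ≤ ∑ j, ‖co j‖ * ‖X‖ * (ε / (S + 1)) := by
          refine Finset.sum_le_sum fun j _ => ?_
          rw [norm_smul]
          exact mul_le_mul ((co j).le_opNorm X) (hball htX j).le (norm_nonneg _) (by positivity)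
      _ = S / (S + 1) * (ε * ‖X‖) := by
          rw [← Finset.sum_mul, ← Finset.sum_mul, ← hS]; ring
      _ ≤ ε * ‖X‖ := by
          refine mul_le_of_le_one_left (by positivity) ?_
          rw [div_le_one (by positivity)]; linarith
  have := norm_image_sub_le_of_norm_deriv_le_segment_01' hder hbd
  simp only [one_smul, zero_smul, map_zero, sub_zero, expMap_zero, rep_one_apply] at this
  simp only [zero_add, map_zero, expMap_zero, rep_one_apply]
  rwa [sub_right_comm]

/-- A family of vectors that is closed under differentiation along one-parameter subgroups consists of
smooth vectors. -/
theorem mem_smoothVectors_of_family (hπ : ∀ v : H, Continuous fun g => π g v) (S : Set H)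
    (hS : ∀ u ∈ S, ∃ D : G.lieAlgebra →ₗ[ℝ] H, ∀ X, D X ∈ S ∧
      HasDerivAt (fun t : ℝ => π (G.expMap (t • X)) u) (D X) 0) {u : H} (hu : u ∈ S) :
    u ∈ smoothVectors π := by
  obtain ⟨l, hl, hl1, hlog⟩ := exists_log G
  let b := Pi.basisFun ℝ (Fin (Module.finrank ℝ G.lieAlgebra))
  let co : Fin (Module.finrank ℝ G.lieAlgebra) →
      ((Fin (Module.finrank ℝ G.lieAlgebra) → ℝ) →L[ℝ] ℝ) := fun j => ContinuousLinearMap.proj j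
  have hco : ∀ X, X = ∑ j, co j X • b j := fun X => (b.sum_repr X).symm
  let E : (Fin (Module.finrank ℝ G.lieAlgebra) → ℝ) → G.realPoints :=
    fun x => G.expMap (coordEquiv G x)
  have hE : ContDiff ℝ ∞ fun x => toMatrix (E x) :=
    contDiff_toMatrix_expMap.comp contDiff_coordEquiv
  have hEneg : ∀ x, E (-x) = (E x)⁻¹ := fun x => by
    simp only [E, map_neg, expMap_neg]
  -- The logarithmic derivative of the exponential map.
  let W : (Fin (Module.finrank ℝ G.lieAlgebra) → ℝ) → ((Fin (Module.finrank ℝ G.lieAlgebra) → ℝ) →L[ℝ]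
      (Fin (Module.finrank ℝ G.lieAlgebra) → ℝ)) := fun Y =>
    (fderiv ℝ l 1).comp ((ContinuousLinearMap.mul ℝ (Matrix (Fin d) (Fin d) ℝ)
      (toMatrix (E (-Y)))).comp (fderiv ℝ (fun X => toMatrix (E X)) Y))
  have hW : ContDiff ℝ ∞ W := by
    refine contDiff_const.clm_comp (ContDiff.clm_comp ?_ ?_)
    · exact (ContinuousLinearMap.mul ℝ (Matrix (Fin d) (Fin d) ℝ)).contDiff.comp
        (hE.comp contDiff_neg)
    · exact hE.fderiv_right (by simp)
  have key : ∀ n : ℕ, ∀ u ∈ S, ContDiff ℝ n fun X => π (E X) u := by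
    intro n
    induction n with
    | zero =>
      intro u _
      exact contDiff_zero.2 ((continuous_rep_expMap hπ u).comp
        (contDiff_coordEquiv (G := G) (n := 0)).continuous)
    | succ n ih =>
      intro u hu
      obtain ⟨D, hD⟩ := hS u hu
      let Dc : (Fin (Module.finrank ℝ G.lieAlgebra) → ℝ) →L[ℝ] H :=
        LinearMap.toContinuousLinearMap (D ∘ₗ (coordEquiv G).toLinearMap)
      have hDc := hasFDerivAt_rep_zero hπ Dc fun x => (hD (coordEquiv G x)).2
      refine contDiff_succ_iff_hasFDerivAt.2 ⟨fun Y => ∑ j,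
        ((co j).comp (W Y)).smulRight (π (E Y) (Dc (b j))), ?_, fun Y => ?_⟩
      · refine ContDiff.sum fun j _ => ContDiff.smulRight ?_ (ih _ (hD _).1)
        exact contDiff_const.clm_comp (hW.of_le (by exact_mod_cast le_top))
      · have h1 : toMatrix (E (-Y)) * toMatrix (E Y) = 1 := by
          rw [← toMatrix_mul, hEneg, inv_mul_cancel, toMatrix_one]
        have h2 : HasFDerivAt (fun X => toMatrix (E (-Y)) * toMatrix (E X))
            ((ContinuousLinearMap.mul ℝ (Matrix (Fin d) (Fin d) ℝ)
              (toMatrix (E (-Y)))).comp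
                (fderiv ℝ (fun X => toMatrix (E X)) Y)) Y :=
          (ContinuousLinearMap.mul ℝ (Matrix (Fin d) (Fin d) ℝ)
            (toMatrix (E (-Y)))).hasFDerivAt.comp Y
              ((hE.differentiable
                (by simp)).differentiableAt.hasFDerivAt)
        have h3 : HasFDerivAt l (fderiv ℝ l 1)
            (toMatrix (E (-Y)) * toMatrix (E Y)) := by
          rw [h1]
          exact (hl.differentiableAt (by simp)).hasFDerivAt
        have h4 : HasFDerivAt (fun X => l (toMatrix (E (-Y)) * toMatrix (E X)))
            (W Y) Y := h3.comp Y h2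
        have h5 : HasFDerivAt (fun X => π (E X) u) Dc
            (l (toMatrix (E (-Y)) * toMatrix (E Y))) := by
          rw [h1, hl1]
          exact hDc
        have h6 := (repL π (E Y)).hasFDerivAt.comp Y (h5.comp Y h4)
        have h7 : (repL π (E Y)).comp (Dc.comp (W Y)) =
            ∑ j, ((co j).comp (W Y)).smulRight (π (E Y) (Dc (b j))) := by
          refine ContinuousLinearMap.ext fun X => ?_
          have h8 : Dc (W Y X) = ∑ j, co j (W Y X) • Dc (b j) := by
            conv_lhs => rw [hco (W Y X)]
            simp only [map_sum, map_smul]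
          change repL π (E Y) (Dc (W Y X)) = _
          rw [h8, map_sum, sum_apply]
          refine Finset.sum_congr rfl fun j _ => ?_
          rw [map_smul]
          rfl
        change HasFDerivAt _ (∑ j, ((co j).comp (W Y)).smulRight (π (E Y) (Dc (b j)))) Y
        rw [← h7]
        refine h6.congr_of_eventuallyEq ?_
        have h9 : Filter.Tendsto (fun X => toMatrix (E (-Y)) * toMatrix (E X))
            (𝓝 Y) (𝓝 1) := by
          have := h2.continuousAt.tendsto
          rwa [h1] at this
        filter_upwards [h9.eventually hlog] with X hX
        have h10 := hX (E (-Y) * E X) (toMatrix_mul _ _)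
        change G.expMap _ = _ at h10
        change π (E X) u = π (E Y) (π (G.expMap _) u)
        rw [h10, ← rep_mul_apply, hEneg, mul_inv_cancel_left]
  exact mem_smoothVectors_iff.2 (contDiff_infty.2 fun n => key n u hu)

end Representation

end RealAlgebraicGroup

/-! ### Integrals of square-integrable functions depending on a parameter -/

section IntegralLp

variable {T Ω : Type*} [MeasurableSpace T] [MeasurableSpace Ω] {τ : Measure T} {μ : Measure Ω}

theorem setIntegral_norm_coeFn_Lp_le (f : Lp ℂ 2 μ) {S : Set Ω} (hμS : μ S ≠ ⊤) :
    ∫ z in S, ‖f z‖ ∂μ ≤ ‖f‖ * ((μ S) ^ (1 / 2 : ℝ)).toReal := by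
  have hm : AEStronglyMeasurable (f : Ω → ℂ) (μ.restrict S) := (Lp.aestronglyMeasurable f).restrict
  have h1 := eLpNorm_le_eLpNorm_mul_rpow_measure_univ (μ := μ.restrict S) (p := 1) (q := 2)
    (by norm_num) hm
  have h2 : eLpNorm (f : Ω → ℂ) 2 (μ.restrict S) ≤ eLpNorm (f : Ω → ℂ) 2 μ :=
    eLpNorm_mono_measure _ Measure.restrict_le_self
  have e : (1 / (1 : ENNReal).toReal - 1 / (2 : ENNReal).toReal : ℝ) = 1 / 2 := by norm_num
  rw [e, Measure.restrict_apply_univ] at h1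
  rw [integral_norm_eq_lintegral_enorm hm, ← eLpNorm_one_eq_lintegral_enorm, Lp.norm_def,
    ← ENNReal.toReal_mul]
  refine ENNReal.toReal_mono (ENNReal.mul_ne_top (Lp.eLpNorm_ne_top f)
    (ENNReal.rpow_ne_top_of_nonneg (by norm_num) hμS)) (h1.trans ?_)
  gcongr

theorem integrableOn_coeFn_Lp (f : Lp ℂ 2 μ) {S : Set Ω} (hμS : μ S ≠ ⊤) : IntegrableOn f S μ := by
  have : IsFiniteMeasure (μ.restrict S) := ⟨by simpa using hμS.lt_top⟩
  exact ((Lp.memLp f).restrict S).integrable (by norm_num)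

variable {u : T → Lp ℂ 2 μ} {W : T × Ω → ℂ}

theorem integrable_prod_of_coeFn_ae_eq [SFinite μ] (hu : Integrable u τ)
    (hW : AEStronglyMeasurable W (τ.prod μ)) (h : ∀ᵐ t ∂τ, u t =ᵐ[μ] fun z => W (t, z))
    {S : Set Ω} (hμS : μ S ≠ ⊤) :
    Integrable W (τ.prod (μ.restrict S)) := by
  have hW' : AEStronglyMeasurable W (τ.prod (μ.restrict S)) :=
    hW.mono_ac (Measure.AbsolutelyContinuous.rfl.prod Measure.restrict_le_self.absolutelyContinuous)
  refine (integrable_prod_iff hW').2 ⟨?_, ?_⟩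
  · filter_upwards [h] with t ht
    exact (integrableOn_coeFn_Lp (u t) hμS).congr (ae_restrict_of_ae ht)
  · refine (hu.norm.mul_const ((μ S) ^ (1 / 2 : ℝ)).toReal).mono' hW'.norm.integral_prod_right' ?_
    filter_upwards [h] with t ht
    rw [Real.norm_of_nonneg (integral_nonneg fun _ => norm_nonneg _)]
    refine le_trans (le_of_eq (integral_congr_ae ?_)) (setIntegral_norm_coeFn_Lp_le (u t) hμS)
    filter_upwards [ae_restrict_of_ae ht] with z hz
    rw [hz]

theorem ae_integrable_of_coeFn_ae_eq [SFinite τ] [SigmaFinite μ] (hu : Integrable u τ)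
    (hW : AEStronglyMeasurable W (τ.prod μ)) (h : ∀ᵐ t ∂τ, u t =ᵐ[μ] fun z => W (t, z)) :
    ∀ᵐ z ∂μ, Integrable (fun t => W (t, z)) τ := by
  have h1 : ∀ n, ∀ᵐ z ∂μ.restrict (spanningSets μ n), Integrable (fun t => W (t, z)) τ := fun n =>
    (integrable_prod_of_coeFn_ae_eq hu hW h (measure_spanningSets_lt_top μ n).ne).prod_left_ae
  rw [← Measure.restrict_univ (μ := μ), ← iUnion_spanningSets μ, ae_restrict_iUnion_iff]
  exact h1

/-- The value of an `L²`-valued integral is the pointwise integral. -/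
theorem coeFn_integral_Lp [SFinite τ] [SigmaFinite μ] (hu : Integrable u τ)
    (hW : AEStronglyMeasurable W (τ.prod μ)) (h : ∀ᵐ t ∂τ, u t =ᵐ[μ] fun z => W (t, z)) :
    (∫ t, u t ∂τ : Lp ℂ 2 μ) =ᵐ[μ] fun z => ∫ t, W (t, z) ∂τ := by
  have hI : ∀ S, μ S < ⊤ → Integrable W (τ.prod (μ.restrict S)) := fun S hS =>
    integrable_prod_of_coeFn_ae_eq hu hW h hS.ne
  refine ae_eq_of_forall_setIntegral_eq_of_sigmaFinite
    (fun S _ hμS => integrableOn_coeFn_Lp _ hμS.ne)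
    (fun S _ hμS => (hI S hμS).integral_prod_right) (fun S hS hμS => ?_)
  rw [← L2.inner_indicatorConstLp_one hS hμS.ne, ← integral_inner hu]
  have h2 : ∀ᵐ t ∂τ, inner ℂ (indicatorConstLp 2 hS hμS.ne (1 : ℂ)) (u t) =
      ∫ z in S, W (t, z) ∂μ := by
    filter_upwards [h] with t ht
    rw [L2.inner_indicatorConstLp_one hS hμS.ne]
    exact integral_congr_ae (ae_restrict_of_ae ht)
  rw [integral_congr_ae h2]
  exact integral_integral_swap (hI S hμS)

end IntegralLp

/-! ### Integrals of families of smooth vectors -/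

namespace RealAlgebraicGroup

variable {d : ℕ} {G : RealAlgebraicGroup d} {H : Type*} [NormedAddCommGroup H]
  [InnerProductSpace ℂ H] {π : G.realPoints →* (H ≃ₗᵢ[ℂ] H)}

theorem smoothRep_dRepL (g : G.realPoints) (X : G.lieAlgebra) (v : smoothVectors π) :
    smoothRep π g (dRepL π X v) = dRepL π (g • X) (smoothRep π g v) :=
  Subtype.ext (rep_dRep v.2 g X)

/-- The iterated derivative `dπ(X₁) ⋯ dπ(X_k)` as an operator on smooth vectors. -/
def dRepListL (π : G.realPoints →* (H ≃ₗᵢ[ℂ] H)) :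
    List G.lieAlgebra → smoothVectors π →ₗ[ℂ] smoothVectors π
  | [] => LinearMap.id
  | X :: L => dRepL π X ∘ₗ dRepListL π L

theorem coe_dRepListL (L : List G.lieAlgebra) (v : smoothVectors π) :
    (dRepListL π L v : H) = dRepList π L (v : H) := by
  induction L with
  | nil => rfl
  | cons X L ih =>
    change dRep π X (dRepListL π L v : H) = dRep π X (dRepList π L (v : H))
    rw [ih]

/-- A continuous functional on the smooth vectors depends continuously on finitely many iterated
derivatives in the norm of `H`. -/
theorem exists_continuous_factorization (ℓ : smoothVectors π →ₗ[ℂ] ℂ)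
    (hℓ : Continuous[smoothTopology π, inferInstance] ℓ) :
    ∃ (𝓛 : Finset (List G.lieAlgebra)) (Λ : (𝓛 → H) →L[ℂ] ℂ),
      ∀ v : smoothVectors π, ℓ v = Λ fun L => dRepListL π L v := by
  have h0 : ∀ᶠ v in @nhds _ (smoothTopology π) (0 : smoothVectors π), ‖ℓ v‖ < 1 := by
    let _ := smoothTopology π
    have h1 := (hℓ.tendsto 0).eventually (Metric.ball_mem_nhds (ℓ 0) one_pos)
    simpa using h1
  have h1 : ∃ (𝓛 : Finset (List G.lieAlgebra)) (ε : ℝ), 0 < ε ∧ ∀ v : smoothVectors π,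
      (∀ L ∈ 𝓛, ‖(dRepListL π L v : H)‖ < ε) → ‖ℓ v‖ < 1 := by
    rw [nhds_iInf, Filter.Eventually, Filter.mem_iInf_finite] at h0
    obtain ⟨𝓛, h𝓛⟩ := h0
    refine ⟨𝓛, ?_⟩
    rw [Filter.mem_iInf_finset] at h𝓛
    obtain ⟨p, hp, hpe⟩ := h𝓛
    have h2 : ∀ L ∈ 𝓛, ∃ ε > 0, ∀ v : smoothVectors π, ‖(dRepListL π L v : H)‖ < ε → v ∈ p L := by
      intro L hL
      have h3 := hp L hL
      rw [nhds_induced, Filter.mem_comap] at h3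
      obtain ⟨s, hs, hsp⟩ := h3
      obtain ⟨ε, hε, hb⟩ := Metric.mem_nhds_iff.1 hs
      refine ⟨ε, hε, fun v hv => hsp (hb ?_)⟩
      change dRepList π L (v : H) ∈ _
      rw [← coe_dRepListL, ← coe_dRepListL, Metric.mem_ball, map_zero, Submodule.coe_zero, dist_zero_right]
      exact hv
    choose! ε hε hεp using h2
    rcases 𝓛.eq_empty_or_nonempty with he | hne
    · refine ⟨1, one_pos, fun v _ => ?_⟩
      subst he
      have : v ∈ {v | ‖ℓ v‖ < 1} := by rw [hpe]; simp
      exact this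
    · refine ⟨𝓛.inf' hne ε, (Finset.lt_inf'_iff hne).2 hε, fun v hv => ?_⟩
      have : v ∈ {v | ‖ℓ v‖ < 1} := by
        rw [hpe]
        simp only [Set.mem_iInter]
        exact fun L hL => hεp L hL v ((hv L hL).trans_le (Finset.inf'_le ε hL))
      exact this
  obtain ⟨𝓛, ε, hε, hb⟩ := h1
  let J : smoothVectors π →ₗ[ℂ] (𝓛 → H) :=
    LinearMap.pi fun L => (smoothVectors π).subtype ∘ₗ dRepListL π L
  have hJ : ∀ v, ‖ℓ v‖ ≤ (2 / ε) * ‖J v‖ := by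
    have hJ1 : ∀ v, ‖J v‖ < ε → ‖ℓ v‖ < 1 := fun v hv =>
      hb v fun L hL => (norm_le_pi_norm (J v) ⟨L, hL⟩).trans_lt hv
    intro v
    by_contra hcon
    push Not at hcon
    have hpos : 0 < ‖ℓ v‖ := lt_of_le_of_lt (by positivity) hcon
    have h3 := hJ1 (((‖ℓ v‖⁻¹ : ℝ) : ℂ) • v) (by
      rw [map_smul, norm_smul, Complex.norm_real, norm_inv, norm_norm, inv_mul_lt_iff₀ hpos]
      have : ‖J v‖ ≤ ε / 2 * (2 / ε * ‖J v‖) := by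
        rw [← mul_assoc]; field_simp; exact le_rfl
      nlinarith)
    rw [map_smul, norm_smul, Complex.norm_real, norm_inv, norm_norm, inv_mul_cancel₀ hpos.ne'] at h3
    exact lt_irrefl _ h3
  have hker : LinearMap.ker J ≤ LinearMap.ker ℓ := fun v hv => by
    rw [LinearMap.mem_ker] at hv ⊢
    have := hJ v
    rw [hv, norm_zero, mul_zero] at this
    exact norm_le_zero_iff.1 this
  let f : LinearMap.range J →ₗ[ℂ] ℂ :=
    (LinearMap.ker J).liftQ ℓ hker ∘ₗ J.quotKerEquivRange.symm.toLinearMap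
  have hf : ∀ v, f ⟨J v, LinearMap.mem_range_self J v⟩ = ℓ v := fun v => by
    have : J.quotKerEquivRange.symm ⟨J v, LinearMap.mem_range_self J v⟩ =
        (LinearMap.ker J).mkQ v := by
      rw [LinearEquiv.symm_apply_eq]
      rfl
    simp only [f, LinearMap.comp_apply, LinearEquiv.coe_coe, this]
    simp
  let fc : LinearMap.range J →L[ℂ] ℂ := f.mkContinuous (2 / ε) (by
    rintro ⟨_, v, rfl⟩
    rw [hf]
    exact hJ v)
  obtain ⟨Λ, hΛ, -⟩ := exists_extension_norm_eq (𝕜 := ℂ) (LinearMap.range J) fc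
  refine ⟨𝓛, Λ, fun v => ?_⟩
  rw [← hf v]
  exact (hΛ ⟨J v, LinearMap.mem_range_self J v⟩).symm

variable {T : Type*} [MeasurableSpace T] {τ : Measure T} [CompleteSpace H]

/-- The integral of a family of smooth vectors, all derivatives of which are integrable, is a smooth
vector, and continuous functionals commute with the integral. The set `𝓕` consists of the family and its
derivatives. -/
theorem integral_mem_smoothVectors (hπ : ∀ v : H, Continuous fun g => π g v)
    (𝓕 : Set (T → smoothVectors π))
    (hint : ∀ q ∈ 𝓕, Integrable (fun t => (q t : H)) τ)
    (hder : ∀ q ∈ 𝓕, ∀ X, (fun t => dRepL π X (q t)) ∈ 𝓕) {q : T → smoothVectors π} (hq : q ∈ 𝓕) :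
    ∃ w : smoothVectors π, (w : H) = ∫ t, (q t : H) ∂τ ∧
      ∀ ℓ : smoothVectors π →ₗ[ℂ] ℂ, Continuous[smoothTopology π, inferInstance] ℓ →
        ℓ w = ∫ t, ℓ (q t) ∂τ := by
  have hd : ∀ q ∈ 𝓕, ∀ X : G.lieAlgebra, HasDerivAt
      (fun s : ℝ => π (G.expMap (s • X)) (∫ t, (q t : H) ∂τ)) (∫ t, (dRepL π X (q t) : H) ∂τ) 0 := by
    intro q hq X
    have hi : ∀ s : ℝ, ∀ q ∈ 𝓕, Integrable (fun t => π (G.expMap (s • X)) (q t : H)) τ :=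
      fun s q hq => (repL π (G.expMap (s • X))).integrable_comp (hint q hq)
    have h1 := (hasDerivAt_integral_of_dominated_loc_of_deriv_le (μ := τ) (x₀ := (0 : ℝ))
      (F := fun s t => π (G.expMap (s • X)) (q t : H))
      (F' := fun s t => π (G.expMap (s • X)) (dRepL π X (q t) : H)) (s := Set.univ)
      (bound := fun t => ‖(dRepL π X (q t) : H)‖) Filter.univ_mem
      (.of_forall fun s => (hi s q hq).1) (hi 0 q hq) (hi 0 _ (hder q hq X)).1
      (.of_forall fun t s _ => by rw [LinearIsometryEquiv.norm_map])
      (hint _ (hder q hq X)).norm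
      (.of_forall fun t s _ => hasDerivAt_rep (q t).2 X s)).2
    simp only [zero_smul, expMap_zero, rep_one_apply] at h1
    refine h1.congr_of_eventuallyEq (.of_forall fun s => ?_)
    exact ((repL π (G.expMap (s • X))).integral_comp_comm (hint q hq)).symm
  have hmem : ∀ q ∈ 𝓕, ∫ t, (q t : H) ∂τ ∈ smoothVectors π := by
    intro q hq
    refine mem_smoothVectors_of_family hπ {w | ∃ q ∈ 𝓕, w = ∫ t, (q t : H) ∂τ} ?_ ⟨q, hq, rfl⟩
    rintro _ ⟨q, hq, rfl⟩
    refine ⟨⟨⟨fun X => ∫ t, (dRepL π X (q t) : H) ∂τ, fun X Y => ?_⟩, fun a X => ?_⟩,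
      fun X => ⟨⟨_, hder q hq X, rfl⟩, hd q hq X⟩⟩
    · rw [← integral_add (hint _ (hder q hq X)) (hint _ (hder q hq Y))]
      simp only [map_add, LinearMap.add_apply, Submodule.coe_add]
    · rw [RingHom.id_apply, ← integral_smul]
      simp only [map_smul, LinearMap.smul_apply]
      rfl
  have hlist : ∀ L, ∀ q ∈ 𝓕, (fun t => dRepListL π L (q t)) ∈ 𝓕 := by
    intro L
    induction L with
    | nil => exact fun q hq => hq
    | cons X L ih => exact fun q hq => hder _ (ih q hq) X
  have hlist' : ∀ L, ∀ (q) (hq : q ∈ 𝓕), (dRepListL π L ⟨_, hmem q hq⟩ : H) =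
      ∫ t, (dRepListL π L (q t) : H) ∂τ := by
    intro L q hq
    induction L with
    | nil => rfl
    | cons X L ih =>
      have e : dRepListL π L ⟨_, hmem q hq⟩ = ⟨_, hmem _ (hlist L q hq)⟩ := Subtype.ext ih
      change (dRepL π X (dRepListL π L ⟨_, hmem q hq⟩) : H) = _
      rw [e]
      exact (hasDerivAt_rep_zero (hmem _ (hlist L q hq)) X).unique (hd _ (hlist L q hq) X)
  refine ⟨⟨_, hmem q hq⟩, rfl, fun ℓ hℓ => ?_⟩
  obtain ⟨𝓛, Λ, hΛ⟩ := exists_continuous_factorization ℓ hℓ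
  have hI : ∀ L : 𝓛, Integrable (fun t => (dRepListL π (L : List G.lieAlgebra) (q t) : H)) τ :=
    fun L => hint _ (hlist L q hq)
  simp only [hΛ]
  rw [Λ.integral_comp_comm (Integrable.of_eval hI)]
  congr 1
  funext L
  rw [eval_integral hI]
  exact hlist' L q hq

end RealAlgebraicGroup

/-! ### Multiplication by test functions on the smooth vectors -/

/-- If `(ad a)³ b = 0`, then `exp a · b · exp (-a)` is given by the first three terms of the
exponential series of `ad a`. -/
theorem exp_mul_mul_exp_neg_of_lie {A : Type*} [NormedRing A] [NormedAlgebra ℝ A] [FiniteDimensional ℝ A]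
    {a b : A} (hab : ⁅a, ⁅a, ⁅a, b⁆⁆⁆ = 0) :
    NormedSpace.exp a * b * NormedSpace.exp (-a) = b + ⁅a, b⁆ + (1 / 2 : ℝ) • ⁅a, ⁅a, b⁆⁆ := by
  have : CompleteSpace A := FiniteDimensional.complete ℝ A
  set P : ℝ → A := fun t => b + t • ⁅a, b⁆ + (t ^ 2 / 2) • ⁅a, ⁅a, b⁆⁆ with hP
  set E : ℝ → A := fun t => NormedSpace.exp (t • a) with hE
  set F : ℝ → A := fun t => NormedSpace.exp (t • (-a)) with hF
  have hEF : ∀ t, F t * E t = 1 := fun t => by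
    simp only [hE, hF, smul_neg]; exact exp_neg_mul_exp _
  have hEF' : ∀ t, E t * F t = 1 := fun t => by
    have := exp_neg_mul_exp (-(t • a))
    rw [neg_neg] at this
    simp only [hE, hF, smul_neg]; exact this
  have hP' : ∀ t, HasDerivAt P (a * P t - P t * a) t := fun t => by
    have h1 : HasDerivAt P (⁅a, b⁆ + t • ⁅a, ⁅a, b⁆⁆) t := by
      have h2 := (((hasDerivAt_id t).smul_const ⁅a, b⁆).const_add b).add
        ((((hasDerivAt_id t).pow 2).div_const 2).smul_const ⁅a, ⁅a, b⁆⁆)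
      have h3 : (2 : ℕ) * id t ^ (2 - 1) * 1 / 2 = t := by simp
      rw [h3, one_smul] at h2
      exact h2
    convert h1 using 1
    rw [← Ring.lie_def]
    simp only [hP, lie_add, lie_smul, hab, smul_zero, add_zero]
  have hd : ∀ t, HasDerivAt (fun t => F t * P t * E t) 0 t := fun t => by
    have h1 := ((hasDerivAt_exp_smul_const (𝕂 := ℝ) (-a) t).mul (hP' t)).mul
      (hasDerivAt_exp_smul_const' (𝕂 := ℝ) a t)
    refine h1.congr_deriv ?_
    change (F t * -a * P t + F t * (a * P t - P t * a)) * E t + F t * P t * (a * E t) = 0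
    noncomm_ring
  have hc := is_const_of_deriv_eq_zero (fun t => (hd t).differentiableAt)
    (fun t => (hd t).deriv) 1 0
  have h0 : F 0 * P 0 * E 0 = b := by simp [hE, hF, hP]
  have h1 : P 1 = b + ⁅a, b⁆ + (1 / 2 : ℝ) • ⁅a, ⁅a, b⁆⁆ := by simp [hP]
  have hE1 : E 1 = NormedSpace.exp a := by simp [hE]
  have hF1 : F 1 = NormedSpace.exp (-a) := by simp [hF]
  rw [← h1, ← hE1, ← hF1, ← h0, ← hc, ← mul_assoc, ← mul_assoc, hEF', one_mul, mul_assoc, hEF',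
    mul_one]

namespace RealAlgebraicGroup

variable {d : ℕ} {G : RealAlgebraicGroup d}

section Adjoint

attribute [local instance] Matrix.linftyOpNormedRing Matrix.linftyOpNormedAlgebra

theorem expMap_smul_of_lie {X Y : G.lieAlgebra} (hXY : ⁅X, ⁅X, ⁅X, Y⁆⁆⁆ = 0) :
    G.expMap X • Y = Y + ⁅X, Y⁆ + (1 / 2 : ℝ) • ⁅X, ⁅X, Y⁆⁆ := by
  apply Subtype.ext
  rw [coe_smul, ← expMap_neg]
  change _ * _ * toMatrix (G.expMap (-X)) = _
  rw [toMatrix, coe_expMap, coe_expMap]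
  exact exp_mul_mul_exp_neg_of_lie (congrArg Subtype.val hXY)

end Adjoint

/-- A continuous function on a Euclidean space that is integrable against all polynomials. -/
def RapidDecay {n : ℕ} (φ : EuclideanSpace ℝ (Fin n) → ℂ) : Prop :=
  Continuous φ ∧ ∀ k : ℕ, Integrable fun ξ => ‖ξ‖ ^ k * ‖φ ξ‖

theorem RapidDecay.coord_mul {n : ℕ} {φ : EuclideanSpace ℝ (Fin n) → ℂ} (hφ : RapidDecay φ)
    (j : Fin n) : RapidDecay fun ξ => (ξ j : ℂ) * φ ξ := by
  have hc : Continuous fun ξ : EuclideanSpace ℝ (Fin n) => (ξ j : ℂ) * φ ξ :=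
    (Complex.continuous_ofReal.comp (EuclideanSpace.proj (𝕜 := ℝ) j).continuous).mul hφ.1
  refine ⟨hc, fun k => (hφ.2 (k + 1)).mono'
    ((continuous_norm.pow k).mul hc.norm).aestronglyMeasurable (.of_forall fun ξ => ?_)⟩
  rw [Real.norm_of_nonneg (by positivity), norm_mul, Complex.norm_real, pow_succ, mul_assoc]
  gcongr
  exact PiLp.norm_apply_le ξ j

theorem RapidDecay.integrable {n : ℕ} {φ : EuclideanSpace ℝ (Fin n) → ℂ} (hφ : RapidDecay φ) :
    Integrable φ := by
  refine (integrable_norm_iff hφ.1.aestronglyMeasurable).1 ?_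
  simpa using hφ.2 0

section WaveFamily

variable {H : Type*} [NormedAddCommGroup H] [InnerProductSpace ℂ H]
  {n : ℕ}

/-- The span of the families `ξ ↦ φ(ξ) π(exp X(ξ)) v` of smooth vectors, for `φ` of rapid decay. -/
def waveFamily (π : G.realPoints →* (H ≃ₗᵢ[ℂ] H)) (X : EuclideanSpace ℝ (Fin n) →ₗ[ℝ] G.lieAlgebra) :
    Submodule ℂ (EuclideanSpace ℝ (Fin n) → smoothVectors π) :=
  Submodule.span ℂ {q | ∃ φ v, RapidDecay φ ∧ q = fun ξ => φ ξ • smoothRep π (G.expMap (X ξ)) v}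

variable {π : G.realPoints →* (H ≃ₗᵢ[ℂ] H)} {X : EuclideanSpace ℝ (Fin n) →ₗ[ℝ] G.lieAlgebra}

theorem mem_waveFamily {φ : EuclideanSpace ℝ (Fin n) → ℂ} (hφ : RapidDecay φ)
    (v : smoothVectors π) :
    (fun ξ => φ ξ • smoothRep π (G.expMap (X ξ)) v) ∈ waveFamily π X :=
  Submodule.subset_span ⟨φ, v, hφ, rfl⟩

/-- The action on smooth vectors as a linear map. -/
def smoothRepL (π : G.realPoints →* (H ≃ₗᵢ[ℂ] H)) (g : G.realPoints) :
    smoothVectors π →ₗ[ℂ] smoothVectors π where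
  toFun := smoothRep π g
  map_add' v w := Subtype.ext ((π g).map_add (v : H) w)
  map_smul' a v := Subtype.ext ((π g).map_smul a (v : H))

theorem mem_waveFamily_linear {φ : EuclideanSpace ℝ (Fin n) → ℂ} (hφ : RapidDecay φ)
    (v : smoothVectors π) (A : EuclideanSpace ℝ (Fin n) →ₗ[ℝ] G.lieAlgebra) :
    (fun ξ => φ ξ • smoothRep π (G.expMap (X ξ)) (dRepL π (A ξ) v)) ∈ waveFamily π X := by
  have e : (fun ξ => φ ξ • smoothRep π (G.expMap (X ξ)) (dRepL π (A ξ) v)) =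
      ∑ j, fun ξ => ((ξ j : ℂ) * φ ξ) • smoothRep π (G.expMap (X ξ))
        (dRepL π (A (EuclideanSpace.basisFun (Fin n) ℝ j)) v) := by
    funext ξ
    rw [Finset.sum_apply]
    have h1 : A ξ = ∑ j, ξ j • A (EuclideanSpace.basisFun (Fin n) ℝ j) := by
      conv_lhs => rw [← (EuclideanSpace.basisFun (Fin n) ℝ).sum_repr ξ]
      rw [map_sum]
      refine Finset.sum_congr rfl fun j _ => ?_
      rw [map_smul, EuclideanSpace.basisFun_repr]
    change _ • smoothRepL π _ _ = ∑ j, _ • smoothRepL π _ _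
    rw [h1, map_sum, LinearMap.sum_apply, map_sum, Finset.smul_sum]
    refine Finset.sum_congr rfl fun j _ => ?_
    rw [map_smul, LinearMap.smul_apply, ← Complex.coe_smul, map_smul, smul_smul, mul_comm]
  rw [e]
  exact sum_mem fun j _ => mem_waveFamily (hφ.coord_mul j) _

theorem dRepL_mem_waveFamily (hX : ∀ ξ, ∀ Y : G.lieAlgebra, ⁅X ξ, ⁅X ξ, ⁅X ξ, Y⁆⁆⁆ = 0)
    {q : EuclideanSpace ℝ (Fin n) → smoothVectors π} (hq : q ∈ waveFamily π X) (Y : G.lieAlgebra) :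
    (fun ξ => dRepL π Y (q ξ)) ∈ waveFamily π X := by
  induction hq using Submodule.span_induction with
  | zero => simp only [Pi.zero_apply, map_zero]; exact zero_mem _
  | add q r _ _ hq hr => simp only [Pi.add_apply, map_add]; exact add_mem hq hr
  | smul a q _ hq => simp only [Pi.smul_apply, map_smul]; exact Submodule.smul_mem _ a hq
  | mem q hq =>
    obtain ⟨φ, v, hφ, rfl⟩ := hq
    let A : G.lieAlgebra → EuclideanSpace ℝ (Fin n) →ₗ[ℝ] G.lieAlgebra := fun Z =>
      { toFun := fun ξ => ⁅X ξ, Z⁆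
        map_add' := fun ξ η => by rw [map_add, add_lie]
        map_smul' := fun a ξ => by rw [map_smul, _root_.smul_lie, RingHom.id_apply] }
    let B : Fin n → EuclideanSpace ℝ (Fin n) →ₗ[ℝ] G.lieAlgebra := fun j =>
      (LieAlgebra.ad ℝ G.lieAlgebra (X (EuclideanSpace.basisFun (Fin n) ℝ j))).comp (A Y)
    have e : (fun ξ => dRepL π Y (φ ξ • smoothRep π (G.expMap (X ξ)) v)) =
        (fun ξ => φ ξ • smoothRep π (G.expMap (X ξ)) (dRepL π Y v)) -
        (fun ξ => φ ξ • smoothRep π (G.expMap (X ξ)) (dRepL π (A Y ξ) v)) +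
        (1 / 2 : ℂ) • ∑ j, fun ξ => ((ξ j : ℂ) * φ ξ) • smoothRep π (G.expMap (X ξ))
          (dRepL π (B j ξ) v) := by
      funext ξ
      have h1 : (G.expMap (X ξ))⁻¹ • Y =
          Y - A Y ξ + (1 / 2 : ℝ) • ∑ j, ξ j • B j ξ := by
        rw [← expMap_neg, expMap_smul_of_lie (by simp only [neg_lie, lie_neg, hX, neg_zero])]
        simp only [neg_lie, lie_neg, neg_neg]
        have h3 : ∀ Z : G.lieAlgebra,
            ∑ j, ξ j • ⁅X (EuclideanSpace.basisFun (Fin n) ℝ j), Z⁆ = ⁅X ξ, Z⁆ := fun Z => by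
          conv_rhs => rw [← (EuclideanSpace.basisFun (Fin n) ℝ).sum_repr ξ]
          rw [map_sum, _root_.sum_lie]
          refine Finset.sum_congr rfl fun j _ => ?_
          rw [map_smul, EuclideanSpace.basisFun_repr, _root_.smul_lie]
        have h2 : ∑ j, ξ j • B j ξ = ⁅X ξ, ⁅X ξ, Y⁆⁆ := h3 _
        rw [h2, sub_eq_add_neg]
        rfl
      have h3 : dRepL π Y (smoothRep π (G.expMap (X ξ)) v) =
          smoothRepL π (G.expMap (X ξ)) (dRepL π ((G.expMap (X ξ))⁻¹ • Y) v) := by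
        change _ = smoothRep π _ _
        rw [smoothRep_dRepL, smul_inv_smul]
      simp only [Pi.add_apply, Pi.sub_apply, Pi.smul_apply, Finset.sum_apply]
      change _ = _ • smoothRepL π _ _ - _ • smoothRepL π _ _ +
        (1 / 2 : ℂ) • ∑ j, _ • smoothRepL π _ _
      rw [map_smul, h3, h1, map_add, map_sub, map_smul, map_sum, LinearMap.add_apply,
        LinearMap.sub_apply, LinearMap.smul_apply, LinearMap.sum_apply, map_add, map_sub, smul_add,
        smul_sub, ← Complex.coe_smul, map_smul, map_sum, smul_comm, Finset.smul_sum]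
      congr 2
      · push_cast; rfl
      · refine Finset.sum_congr rfl fun j _ => ?_
        rw [map_smul, LinearMap.smul_apply, ← Complex.coe_smul, map_smul, smul_smul, mul_comm]
    rw [e]
    exact add_mem (sub_mem (mem_waveFamily hφ _) (mem_waveFamily_linear hφ _ _))
      (Submodule.smul_mem _ _ (sum_mem fun j _ => mem_waveFamily_linear (hφ.coord_mul j) _ _))

theorem integrable_of_mem_waveFamily (hπ : ∀ v : H, Continuous fun g => π g v)
    {q : EuclideanSpace ℝ (Fin n) → smoothVectors π} (hq : q ∈ waveFamily π X) :
    Integrable fun ξ => (q ξ : H) := by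
  induction hq using Submodule.span_induction with
  | zero => exact integrable_zero _ _ _
  | add q r _ _ hq hr => exact hq.add hr
  | smul a q _ hq => exact hq.smul a
  | mem q hq =>
    obtain ⟨φ, v, hφ, rfl⟩ := hq
    have hXc : Continuous X := X.continuous_of_finiteDimensional
    have hc : Continuous fun ξ => φ ξ • π (G.expMap (X ξ)) (v : H) :=
      hφ.1.smul ((continuous_rep_expMap hπ (v : H)).comp hXc)
    refine (hφ.integrable.norm.mul_const ‖(v : H)‖).mono' hc.aestronglyMeasurable
      (.of_forall fun ξ => ?_)
    change ‖φ ξ • π (G.expMap (X ξ)) (v : H)‖ ≤ _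
    rw [norm_smul, LinearIsometryEquiv.norm_map]

end WaveFamily

section Multiplication

variable {h : G.lieAlgebra} {c : ℝ}

/-- The Fourier variable: elements `X ξ` of `𝔫` for which the characters `exp (i⟨X ξ, y⟩)` of `𝔫̄` are
the exponentials of the Fourier transform in linear coordinates on `𝔫̄`. -/
theorem exists_fourier_variable (hgrad : G.IsGradingElement h)
    (hK : LieAlgebra.IsKilling ℝ G.lieAlgebra) (hc : c ≠ 0) {n : ℕ}
    (e : G.nilBar h ≃ₗ[ℝ] EuclideanSpace ℝ (Fin n)) :
    ∃ X : EuclideanSpace ℝ (Fin n) →ₗ[ℝ] G.lieAlgebra,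
      (∀ ξ, X ξ ∈ G.nil h) ∧ ∀ ξ, ∀ y : G.nilBar h,
        G.pairing c (X ξ) y = 2 * Real.pi * inner ℝ ξ (e y) := by
  have h1 : ∀ j, ∃ X ∈ G.nil h, ∀ y : G.nilBar h,
      G.pairing c X y = 2 * Real.pi * e y j := by
    intro j
    obtain ⟨X, hX, hXy⟩ := hgrad.exists_pairing_eq hK hc
      ((2 * Real.pi) • (EuclideanSpace.proj (𝕜 := ℝ) j).toLinearMap ∘ₗ e.toLinearMap)
    exact ⟨X, hX, fun y => hXy y⟩
  choose X hX hXy using h1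
  refine ⟨∑ j, (EuclideanSpace.proj (𝕜 := ℝ) j).toLinearMap.smulRight (X j), fun ξ => ?_,
    fun ξ y => ?_⟩
  · rw [LinearMap.sum_apply]
    exact sum_mem fun j _ => Submodule.smul_mem _ _ (hX j)
  · rw [LinearMap.sum_apply, pairing, map_sum, LinearMap.sum_apply, Finset.mul_sum, PiLp.inner_apply,
      Finset.mul_sum]
    refine Finset.sum_congr rfl fun j _ => ?_
    have h2 := hXy j y
    rw [pairing] at h2
    change c * (killingForm ℝ G.lieAlgebra) (ξ j • X j) y = _
    rw [map_smul, LinearMap.smul_apply, smul_eq_mul, mul_left_comm, h2]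
    simp only [RCLike.inner_apply, conj_trivial]
    ring

theorem exists_continuous_euclidean_coordinates (V : Type*) [NormedAddCommGroup V]
    [NormedSpace ℝ V] [FiniteDimensional ℝ V] :
    ∃ (n : ℕ) (e : V ≃ₗ[ℝ] EuclideanSpace ℝ (Fin n)), Continuous e :=
  let e := (Module.finBasis ℝ V).equivFun ≪≫ₗ (WithLp.linearEquiv 2 ℝ _).symm
  ⟨_, e, e.toLinearMap.continuous_of_finiteDimensional⟩

theorem exists_rapidDecay_fourier {V : Type*} [NormedAddCommGroup V] [NormedSpace ℝ V]
    [FiniteDimensional ℝ V] {n : ℕ} (e : V ≃ₗ[ℝ] EuclideanSpace ℝ (Fin n)) {F : V → ℂ}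
    (hF : ContDiff ℝ ∞ F) (hFc : HasCompactSupport F) :
    ∃ φ : EuclideanSpace ℝ (Fin n) → ℂ, RapidDecay φ ∧
      ∀ y, F y = ∫ ξ, Complex.exp (Complex.I * (2 * Real.pi * inner ℝ ξ (e y) : ℝ)) * φ ξ := by
  set e' := e.toContinuousLinearEquiv
  have hs : HasCompactSupport (F ∘ e'.symm) := hFc.comp_homeomorph e'.symm.toHomeomorph
  have hd : ContDiff ℝ ∞ (F ∘ e'.symm) := hF.comp e'.symm.contDiff
  set f := hs.toSchwartzMap hd with hf
  refine ⟨FourierTransform.fourier f, ⟨(FourierTransform.fourier f).continuous, fun k =>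
    SchwartzMap.integrable_pow_mul volume _ k⟩, fun y => ?_⟩
  have h1 : F y = f (e' y) := by
    change F y = F (e'.symm (e' y))
    rw [ContinuousLinearEquiv.symm_apply_apply]
  have h2 : FourierTransformInv.fourierInv (FourierTransform.fourier f) = f :=
    FourierPair.fourierInv_fourier_eq f
  rw [h1]
  conv_lhs => rw [← h2]
  rw [SchwartzMap.fourierInv_coe, Real.fourierInv_eq']
  refine integral_congr_ae (.of_forall fun ξ => ?_)
  simp only [smul_eq_mul, mul_comm Complex.I]
  rfl

variable {Ω : Set (G.nilBar h)} [MeasurableSpace Ω] [BorelSpace Ω] {μ : Measure Ω}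
  [SigmaFinite μ] {π : G.realPoints →* (Lp ℂ 2 μ ≃ₗᵢ[ℂ] Lp ℂ 2 μ)}

/-- The smooth vectors are stable under multiplication by test functions `F` on `𝔫̄`, and a continuous
functional on which `N` acts by the character attached to `x` takes the value `F x * ℓ v` on the product.
By Fourier inversion, multiplication by `F` is a superposition of the operators `π(n)`, `n ∈ N`. -/
theorem exists_mul_testFunction (hgrad : G.IsGradingElement h)
    (hK : LieAlgebra.IsKilling ℝ G.lieAlgebra) (hc : c ≠ 0)
    (hπ : ∀ f : Lp ℂ 2 μ, Continuous fun g => π g f)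
    (hπN : ∀ X ∈ G.nil h, ∀ f : Lp ℂ 2 μ, π (G.expMap X) f =ᵐ[μ] fun y =>
      Complex.exp (Complex.I * (G.pairing c X ((y : G.nilBar h) : G.lieAlgebra) : ℝ)) * f y)
    {F : G.nilBar h → ℂ} (hF : ContDiff ℝ ∞ F) (hFc : HasCompactSupport F) (v : smoothVectors π) :
    ∃ w : smoothVectors π, (w : Lp ℂ 2 μ) =ᵐ[μ] (fun y => F y * (v : Lp ℂ 2 μ) y) ∧
      ∀ (x : G.nilBar h) (ℓ : smoothVectors π →ₗ[ℂ] ℂ),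
        Continuous[smoothTopology π, inferInstance] ℓ →
        (∀ X ∈ G.nil h, ∀ v : smoothVectors π, ℓ (smoothRep π (G.expMap X) v) =
          Complex.exp (Complex.I * (G.pairing c X (x : G.lieAlgebra) : ℝ)) * ℓ v) →
        ℓ w = F x * ℓ v := by
  have hcoord := exists_continuous_euclidean_coordinates (G.nilBar h)
  rcases hcoord with ⟨n, e, hec⟩
  have hvar := exists_fourier_variable hgrad hK hc e
  rcases hvar with ⟨X, hX, hXy⟩
  have hfou := exists_rapidDecay_fourier (V := G.nilBar h) e hF hFc
  rcases hfou with ⟨φ, hφ, hφF⟩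
  have hX3 : ∀ ξ, ∀ Y : G.lieAlgebra, ⁅X ξ, ⁅X ξ, ⁅X ξ, Y⁆⁆⁆ = 0 := fun ξ Y => by
    have := congrArg (fun A => A Y) (hgrad.ad_pow_three (k := 2) (by norm_num) (hX ξ))
    simpa [pow_succ] using this
  have hq := mem_waveFamily (X := X) hφ v
  have hint := integral_mem_smoothVectors hπ {q | q ∈ waveFamily π X}
    (fun q hq => integrable_of_mem_waveFamily hπ hq)
    (fun q hq Y => dRepL_mem_waveFamily hX3 hq Y) hq
  rcases hint with ⟨w, hw, hℓ⟩
  refine ⟨w, ?_, fun x ℓ hcont hequi => ?_⟩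
  · rw [hw]
    have hWm : AEStronglyMeasurable (fun p : EuclideanSpace ℝ (Fin n) × Ω =>
        Complex.exp (Complex.I * (2 * Real.pi * inner ℝ p.1 (e (p.2 : G.nilBar h)) : ℝ)) * φ p.1 * (v : Lp ℂ 2 μ) p.2)
        (volume.prod μ) := by
      refine AEStronglyMeasurable.mul ?_ (Lp.aestronglyMeasurable (v : Lp ℂ 2 μ)).comp_snd
      have h1 : Continuous fun p : EuclideanSpace ℝ (Fin n) × Ω =>
          Complex.exp (Complex.I * (2 * Real.pi * inner ℝ p.1 (e (p.2 : G.nilBar h)) : ℝ)) * φ p.1 := by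
        have h2 : Continuous fun p : EuclideanSpace ℝ (Fin n) × Ω =>
            e (p.2 : G.nilBar h) :=
          hec.comp (continuous_subtype_val.comp continuous_snd)
        have h3 := hφ.1
        fun_prop
      exact h1.aestronglyMeasurable
    refine (coeFn_integral_Lp (integrable_of_mem_waveFamily hπ hq) hWm
      (.of_forall fun ξ => ?_)).trans (.of_forall fun y => ?_)
    · change (φ ξ • π (G.expMap (X ξ)) (v : Lp ℂ 2 μ) : Lp ℂ 2 μ) =ᵐ[μ] _
      filter_upwards [Lp.coeFn_smul (φ ξ) (π (G.expMap (X ξ)) (v : Lp ℂ 2 μ)),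
        hπN (X ξ) (hX ξ) (v : Lp ℂ 2 μ)] with y h1 h2
      rw [h1, Pi.smul_apply, h2, hXy, smul_eq_mul]
      ring
    · change _ = F y * _
      rw [hφF y]
      exact integral_mul_const (L := ℂ) ((v : Lp ℂ 2 μ) y) fun ξ =>
        Complex.exp (Complex.I * (2 * Real.pi * inner ℝ ξ (e y) : ℝ)) * φ ξ
  · refine (hℓ ℓ hcont).trans (Eq.trans ?_ (congrArg (fun z : ℂ => z * ℓ v) (hφF x).symm))
    refine Eq.trans ?_ (integral_mul_const (L := ℂ) _ _)
    refine integral_congr_ae (.of_forall fun ξ => ?_)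
    change ℓ (φ ξ • smoothRep π (G.expMap (X ξ)) v) = _
    have h1 := hequi (X ξ) (hX ξ) v
    rw [hXy] at h1
    calc ℓ (φ ξ • smoothRep π (G.expMap (X ξ)) v)
        = φ ξ * ℓ (smoothRep π (G.expMap (X ξ)) v) := ℓ.map_smul _ _
      _ = _ := by rw [h1]; ring

end Multiplication

end RealAlgebraicGroup

/-! ### Smooth families of square-integrable functions -/

section SmoothFamily

open FourierTransform

variable {n : ℕ}

/-- A smooth vector-valued function on a Euclidean space is near the origin the Fourier integral of a
function of rapid decay. -/
theorem exists_fourier_cutoff {E : Type*} [NormedAddCommGroup E] [NormedSpace ℂ E]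
    [CompleteSpace E] {u : EuclideanSpace ℝ (Fin n) → E} (hu : ContDiff ℝ ∞ u) :
    ∃ (χ : EuclideanSpace ℝ (Fin n) → ℝ) (φ : EuclideanSpace ℝ (Fin n) → E),
      Continuous χ ∧ (∀ t ∈ Metric.ball 0 1, χ t = 1) ∧ Continuous φ ∧
      (∀ k : ℕ, Integrable fun ξ => ‖ξ‖ ^ k * ‖φ ξ‖) ∧
      (∀ ξ, Integrable fun t => Complex.exp ((-2 * Real.pi * inner ℝ t ξ : ℝ) * Complex.I) •
        ((χ t : ℂ) • u t)) ∧
      (∀ ξ, φ ξ = ∫ t, Complex.exp ((-2 * Real.pi * inner ℝ t ξ : ℝ) * Complex.I) •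
        ((χ t : ℂ) • u t)) ∧
      (∀ t, Integrable fun ξ => Complex.exp ((2 * Real.pi * inner ℝ ξ t : ℝ) * Complex.I) • φ ξ) ∧
      ∀ t, (χ t : ℂ) • u t =
        ∫ ξ, Complex.exp ((2 * Real.pi * inner ℝ ξ t : ℝ) * Complex.I) • φ ξ := by
  let χ : ContDiffBump (0 : EuclideanSpace ℝ (Fin n)) := ⟨1, 2, one_pos, one_lt_two⟩
  have hχ : ∀ t, ((χ t : ℝ) : ℂ) • u t = (χ t : ℝ) • u t := fun t => Complex.coe_smul _ _
  have hsupp : HasCompactSupport fun t => ((χ t : ℝ) : ℂ) • u t := by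
    simp only [hχ]
    exact χ.hasCompactSupport.smul_right
  have hsmooth : ContDiff ℝ ∞ fun t => ((χ t : ℝ) : ℂ) • u t := by
    simp only [hχ]
    exact χ.contDiff.smul hu
  set f : SchwartzMap (EuclideanSpace ℝ (Fin n)) E := hsupp.toSchwartzMap hsmooth with hf
  set φ : SchwartzMap (EuclideanSpace ℝ (Fin n)) E := 𝓕 f with hφ
  refine ⟨χ, φ, χ.continuous, fun t ht => χ.one_of_mem_closedBall (Metric.ball_subset_closedBall ht),
    φ.continuous, φ.integrable_pow_mul volume, fun ξ => ?_, fun ξ => ?_, fun t => ?_, fun t => ?_⟩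
  · have hexp : Continuous fun t : EuclideanSpace ℝ (Fin n) =>
        Complex.exp ((-2 * Real.pi * inner ℝ t ξ : ℝ) * Complex.I) := by fun_prop
    exact f.integrable.bdd_smul 1 hexp.aestronglyMeasurable
      (.of_forall fun t => (Complex.norm_exp_ofReal_mul_I _).le)
  · rw [hφ, SchwartzMap.fourier_coe, Real.fourier_eq']
    rfl
  · have hexp : Continuous fun ξ : EuclideanSpace ℝ (Fin n) =>
        Complex.exp ((2 * Real.pi * inner ℝ ξ t : ℝ) * Complex.I) := by fun_prop
    exact φ.integrable.bdd_smul 1 hexp.aestronglyMeasurable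
      (.of_forall fun t => (Complex.norm_exp_ofReal_mul_I _).le)
  · change f t = _
    have h2 : 𝓕⁻ (𝓕 f) = f := FourierPair.fourierInv_fourier_eq f
    conv_lhs => rw [← h2]
    rw [SchwartzMap.fourierInv_coe, Real.fourierInv_eq']

variable {Ω : Type*} [MeasurableSpace Ω] {μ : Measure Ω} [SigmaFinite μ]

/-- If `t ↦ u t` is a smooth map into `L²` and `u t` is represented by `W (t, ·)` with `W` measurable,
then for almost every `z` the function `t ↦ W (t, z)` agrees almost everywhere on the unit ball with a
smooth function. After a cut-off, `u` is the Fourier integral of a Schwartz function with values in `L²`,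
and this integral can be taken pointwise. -/
theorem ae_exists_contDiff_of_contDiff_Lp {u : EuclideanSpace ℝ (Fin n) → Lp ℂ 2 μ}
    (hu : @ContDiff ℝ _ _ _ _ (Lp ℂ 2 μ) _ NormedSpace.complexToReal ∞ u)
    {W : EuclideanSpace ℝ (Fin n) × Ω → ℂ} (hW : Measurable W)
    (h : ∀ t, u t =ᵐ[μ] fun z => W (t, z)) :
    ∀ᵐ z ∂μ, ∃ g : EuclideanSpace ℝ (Fin n) → ℂ, ContDiff ℝ ∞ g ∧
      ∀ᵐ t, t ∈ Metric.ball (0 : EuclideanSpace ℝ (Fin n)) 1 → W (t, z) = g t := by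
  obtain ⟨χ, φ, hχc, hχ1, hφc, hφm, hfi, hφ, hφi, hf⟩ := exists_fourier_cutoff hu
  set W₀ : EuclideanSpace ℝ (Fin n) × Ω → ℂ := fun p => (χ p.1 : ℂ) * W p with hW₀
  have hχ : Measurable fun t : EuclideanSpace ℝ (Fin n) => (χ t : ℂ) :=
    (Complex.continuous_ofReal.comp hχc).measurable
  have hW₀m : Measurable W₀ := (hχ.comp measurable_fst).mul hW
  have hf₀ : ∀ t, ((χ t : ℂ) • u t : Lp ℂ 2 μ) =ᵐ[μ] fun z => W₀ (t, z) := fun t => by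
    filter_upwards [h t, Lp.coeFn_smul (χ t : ℂ) (u t)] with z h1 h2
    rw [h2, Pi.smul_apply, h1, smul_eq_mul]
  -- The pointwise Fourier transform of the cut-off represents `φ`.
  set Φ : EuclideanSpace ℝ (Fin n) × Ω → ℂ := fun p =>
    ∫ t, Complex.exp ((-2 * Real.pi * inner ℝ t p.1 : ℝ) * Complex.I) * W₀ (t, p.2) with hΦ
  have hΦm : StronglyMeasurable Φ := by
    have h1 : Measurable fun q : (EuclideanSpace ℝ (Fin n) × Ω) × EuclideanSpace ℝ (Fin n) =>
        Complex.exp ((-2 * Real.pi * inner ℝ q.2 q.1.1 : ℝ) * Complex.I) * W₀ (q.2, q.1.2) :=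
      Measurable.mul (by fun_prop) (hW₀m.comp (by fun_prop))
    exact h1.stronglyMeasurable.integral_prod_right'
  have hφΦ : ∀ ξ, φ ξ =ᵐ[μ] fun z => Φ (ξ, z) := fun ξ => by
    rw [hφ ξ]
    refine coeFn_integral_Lp (W := fun p =>
      Complex.exp ((-2 * Real.pi * inner ℝ p.1 ξ : ℝ) * Complex.I) * W₀ p) (hfi ξ)
      (Measurable.mul (by fun_prop) hW₀m).aestronglyMeasurable (.of_forall fun t => ?_)
    filter_upwards [hf₀ t, Lp.coeFn_smul
      (Complex.exp ((-2 * Real.pi * inner ℝ t ξ : ℝ) * Complex.I)) ((χ t : ℂ) • u t)] with z h2 h3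
    rw [h3, Pi.smul_apply, h2, smul_eq_mul]
  have hmom : ∀ k : ℕ, ∀ᵐ z ∂μ, Integrable fun ξ => ((‖ξ‖ ^ k : ℝ) : ℂ) * Φ (ξ, z) := fun k => by
    have hi : Integrable fun ξ => ((‖ξ‖ ^ k : ℝ) : ℂ) • φ ξ := by
      have hc : Continuous fun ξ => ((‖ξ‖ ^ k : ℝ) : ℂ) • φ ξ :=
        (Complex.continuous_ofReal.comp (continuous_norm.pow k)).smul hφc
      refine (hφm k).mono' hc.aestronglyMeasurable (.of_forall fun ξ => ?_)
      rw [norm_smul, Complex.norm_real, norm_pow, norm_norm]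
    refine ae_integrable_of_coeFn_ae_eq (W := fun p => ((‖p.1‖ ^ k : ℝ) : ℂ) * Φ p) hi
      (Measurable.mul (by fun_prop) hΦm.measurable).aestronglyMeasurable (.of_forall fun ξ => ?_)
    filter_upwards [hφΦ ξ, Lp.coeFn_smul ((‖ξ‖ ^ k : ℝ) : ℂ) (φ ξ)] with z h2 h3
    rw [h3, Pi.smul_apply, h2, smul_eq_mul]
  set g : EuclideanSpace ℝ (Fin n) × Ω → ℂ := fun p =>
    ∫ ξ, Complex.exp ((2 * Real.pi * inner ℝ ξ p.1 : ℝ) * Complex.I) * Φ (ξ, p.2) with hg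
  have hgm : StronglyMeasurable g := by
    have h1 : Measurable fun q : (EuclideanSpace ℝ (Fin n) × Ω) × EuclideanSpace ℝ (Fin n) =>
        Complex.exp ((2 * Real.pi * inner ℝ q.2 q.1.1 : ℝ) * Complex.I) * Φ (q.2, q.1.2) :=
      Measurable.mul (by fun_prop) (hΦm.measurable.comp (by fun_prop))
    exact h1.stronglyMeasurable.integral_prod_right'
  have hfg : ∀ t, ∀ᵐ z ∂μ, W₀ (t, z) = g (t, z) := fun t => by
    have h3 : ((χ t : ℂ) • u t : Lp ℂ 2 μ) =ᵐ[μ] fun z => g (t, z) := by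
      rw [hf t]
      refine coeFn_integral_Lp (W := fun p =>
        Complex.exp ((2 * Real.pi * inner ℝ p.1 t : ℝ) * Complex.I) * Φ p) (hφi t)
        (Measurable.mul (by fun_prop) hΦm.measurable).aestronglyMeasurable (.of_forall fun ξ => ?_)
      filter_upwards [hφΦ ξ, Lp.coeFn_smul
        (Complex.exp ((2 * Real.pi * inner ℝ ξ t : ℝ) * Complex.I)) (φ ξ)] with z h4 h5
      rw [h5, Pi.smul_apply, h4, smul_eq_mul]
    filter_upwards [hf₀ t, h3] with z h4 h5
    rw [← h4, h5]
  have hswap : ∀ᵐ z ∂μ, ∀ᵐ t, W₀ (t, z) = g (t, z) :=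
    (Measure.ae_ae_comm (p := fun t z => W₀ (t, z) = g (t, z))
      (measurableSet_eq_fun hW₀m hgm.measurable)).1 (.of_forall hfg)
  filter_upwards [ae_all_iff.2 hmom, hswap] with z h1 h2
  refine ⟨fun t => g (t, z), ?_, ?_⟩
  · have h3 : (fun t => g (t, z)) = (𝓕 fun ξ => Φ (ξ, z)) ∘ fun t => -t := by
      funext t
      rw [Function.comp_apply, ← Real.fourierInv_eq_fourier_neg, Real.fourierInv_eq']
      rfl
    rw [h3]
    refine ContDiff.comp ?_ contDiff_neg
    refine Real.contDiff_fourier (N := ⊤) fun k _ => ?_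
    refine (h1 k).norm.congr (.of_forall fun ξ => ?_)
    simp only [norm_mul, Complex.norm_real, norm_pow, norm_norm]
  · filter_upwards [h2] with t ht ht1
    rw [← ht]
    simp only [hW₀, hχ1 t ht1, Complex.ofReal_one, one_mul]

end SmoothFamily

/-! ### Transversals and charts -/

section Chart

theorem exists_local_inverse {E F : Type*} [NormedAddCommGroup E] [NormedSpace ℝ E]
    [NormedAddCommGroup F] [NormedSpace ℝ F] [CompleteSpace E] {f : E → F} {f' : E ≃L[ℝ] F} {a : E}
    (hf : ContDiffAt ℝ ω f a) (hf' : HasFDerivAt f (f' : E →L[ℝ] F) a) :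
    ∃ g : F → E, ContDiffAt ℝ ω g (f a) ∧ g (f a) = a ∧ (∀ᶠ x in 𝓝 a, g (f x) = x) ∧
      ∀ᶠ y in 𝓝 (f a), f (g y) = y := by
  have h0 : (ω : WithTop ℕ∞) ≠ 0 := by simp
  have hs := hf.hasStrictFDerivAt' hf' h0
  exact ⟨hf.localInverse hf' h0, hf.to_localInverse hf' h0, hf.localInverse_apply_image hf' h0,
    hs.eventually_left_inverse, hs.eventually_right_inverse⟩

variable {T V : Type*} [NormedAddCommGroup T] [NormedSpace ℝ T] [FiniteDimensional ℝ T]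
  [NormedAddCommGroup V] [NormedSpace ℝ V] [FiniteDimensional ℝ V]

/-- The subspace `y + S` meets `Ω` near `y` only in `y`, if `S` is a complement of the tangent space
`O y` and, up to quadratic terms, every displacement `u` is tangent to `Ω` at the point `y + u`. -/
theorem eventually_eq_zero_of_transversal {A : V →L[ℝ] T →L[ℝ] V} {y : V} {S : Submodule ℝ V}
    (hS : Disjoint (LinearMap.range (A y : T →ₗ[ℝ] V)) S) (hinj : Function.Injective (A y))
    {O : V → Submodule ℝ V} {Ω : Set V} (hAO : ∀ z τ, A z τ ∈ O z)
    (hO : ∀ z ∈ Ω, Module.finrank ℝ (O z) = Module.finrank ℝ T) {Q : V → V} {C : ℝ}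
    (hQ : ∀ u, ‖Q u‖ ≤ C * ‖u‖ ^ 2) (hQO : ∀ u, (2 : ℝ) • u - Q u ∈ O (y + u)) :
    ∀ᶠ u in 𝓝 (0 : V), u ∈ S → y + u ∈ Ω → u = 0 := by
  let B : T × S →ₗ[ℝ] V := (A y : T →ₗ[ℝ] V).coprod S.subtype
  have hB : LinearMap.ker B = ⊥ := by
    rw [LinearMap.ker_coprod_of_disjoint_range _ _ (by rwa [Submodule.range_subtype]),
      LinearMap.ker_eq_bot.2 hinj, Submodule.ker_subtype, Submodule.prod_bot]
  obtain ⟨K, hK, hBK⟩ := B.exists_antilipschitzWith hB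
  have hBK' : ∀ p, ‖p‖ ≤ K * ‖B p‖ := fun p => by
    simpa [dist_eq_norm] using hBK.le_mul_dist p 0
  have hsmall : ∀ᶠ u in 𝓝 (0 : V), K * (‖A‖ * ‖u‖) < 1 / 2 ∧ K * |C| * ‖u‖ < 1 / 2 := by
    have h1 : Filter.Tendsto (fun u : V => K * (‖A‖ * ‖u‖)) (𝓝 0) (𝓝 0) := by
      have : Continuous fun u : V => K * (‖A‖ * ‖u‖) := by fun_prop
      simpa using this.tendsto 0
    have h2 : Filter.Tendsto (fun u : V => K * |C| * ‖u‖) (𝓝 0) (𝓝 0) := by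
      have : Continuous fun u : V => K * |C| * ‖u‖ := by fun_prop
      simpa using this.tendsto 0
    exact (h1.eventually_lt_const (by norm_num)).and (h2.eventually_lt_const (by norm_num))
  filter_upwards [hsmall] with u hu huS huΩ
  -- The estimate for `B` persists at the nearby point `y + u`.
  have hBu : ∀ (τ : T) (s : S), ‖(τ, s)‖ ≤ 2 * K * ‖A (y + u) τ + s‖ := by
    intro τ s
    have h1 := hBK' (τ, s)
    have h2 : B (τ, s) = (A (y + u) τ + s) - A u τ := by
      simp only [B, LinearMap.coprod_apply, map_add, add_apply, Submodule.subtype_apply]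
      change A y τ + (s : V) = _
      abel
    have h3 : ‖A u τ‖ ≤ ‖A‖ * ‖u‖ * ‖(τ, s)‖ :=
      (A.le_opNorm₂ u τ).trans (mul_le_mul_of_nonneg_left (norm_fst_le (τ, s)) (by positivity))
    have h4 : K * ‖A u τ‖ ≤ 1 / 2 * ‖(τ, s)‖ := by
      calc K * ‖A u τ‖ ≤ K * (‖A‖ * ‖u‖ * ‖(τ, s)‖) := by gcongr
        _ = K * (‖A‖ * ‖u‖) * ‖(τ, s)‖ := by ring
        _ ≤ 1 / 2 * ‖(τ, s)‖ := by gcongr; exact hu.1.le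
    have h5 : K * ‖B (τ, s)‖ ≤ K * ‖A (y + u) τ + s‖ + K * ‖A u τ‖ := by
      rw [h2, ← mul_add]
      gcongr
      exact norm_sub_le _ _
    linarith
  have hinj' : Function.Injective (A (y + u)) := by
    refine (injective_iff_map_eq_zero _).2 fun τ hτ => ?_
    have := hBu τ 0
    rw [hτ, Submodule.coe_zero, add_zero, norm_zero, mul_zero] at this
    exact (Prod.mk.inj (norm_le_zero_iff.1 this)).1
  have hrange : LinearMap.range (A (y + u) : T →ₗ[ℝ] V) = O (y + u) := by
    refine Submodule.eq_of_le_of_finrank_eq ?_ ?_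
    · rintro _ ⟨τ, rfl⟩
      exact hAO _ _
    · rw [LinearMap.finrank_range_of_inj hinj', hO _ huΩ]
  have hmem := hQO u
  rw [← hrange] at hmem
  obtain ⟨τ, hτ⟩ := hmem
  have h1 := hBu τ ⟨-((2 : ℝ) • u), S.neg_mem (S.smul_mem _ huS)⟩
  have hτ' : A (y + u) τ = (2 : ℝ) • u - Q u := hτ
  rw [hτ', sub_add_eq_add_sub, add_neg_cancel, zero_sub, norm_neg] at h1
  have h2 : 2 * ‖u‖ ≤ ‖(τ, (⟨-((2 : ℝ) • u), S.neg_mem (S.smul_mem _ huS)⟩ : S))‖ := by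
    refine le_trans (le_of_eq ?_) (norm_snd_le _)
    change _ = ‖-((2 : ℝ) • u)‖
    rw [norm_neg, norm_smul, Real.norm_of_nonneg zero_le_two]
  have h3 : ‖Q u‖ ≤ |C| * ‖u‖ ^ 2 := (hQ u).trans (by gcongr; exact le_abs_self C)
  have h4 : 2 * ‖u‖ ≤ 2 * (K * |C| * ‖u‖) * ‖u‖ := by
    calc 2 * ‖u‖ ≤ 2 * K * ‖Q u‖ := h2.trans h1
      _ ≤ 2 * K * (|C| * ‖u‖ ^ 2) := by gcongr
      _ = _ := by ring
  by_contra hne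
  have hpos : 0 < ‖u‖ := norm_pos_iff.2 hne
  nlinarith [hu.2]

/-- A chart of `Ω` at `y` that inverts the parametrization `t ↦ p (t, y)`. -/
theorem exists_chart {p : T × V → V} (hp : ContDiff ℝ ω p) (hp0 : ∀ z, p (0, z) = z)
    (hpneg : ∀ t z, p (-t, p (t, z)) = z) {Ω : Set V} (hpΩ : ∀ t, ∀ z ∈ Ω, p (t, z) ∈ Ω) {y : V}
    {A : T →L[ℝ] V} (hA : HasFDerivAt (fun t => p (t, y)) A 0) (hinj : Function.Injective A)
    {S : Submodule ℝ V} (hS : IsCompl (LinearMap.range (A : T →ₗ[ℝ] V)) S)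
    (hSΩ : ∀ᶠ u in 𝓝 (0 : V), u ∈ S → y + u ∈ Ω → u = 0) :
    ∃ c : V → T, ContDiffAt ℝ ω c y ∧ c y = 0 ∧ (∀ᶠ z in 𝓝 y, z ∈ Ω → p (c z, y) = z) ∧
      ∀ᶠ t in 𝓝 (0 : T), c (p (t, y)) = t := by
  let Φ : T × S → V := fun q => p (q.1, y + q.2)
  have hΦ : ContDiff ℝ ω Φ :=
    hp.comp (contDiff_fst.prodMk (contDiff_const.add (S.subtypeL.contDiff.comp contDiff_snd)))
  have hd : HasFDerivAt Φ (fderiv ℝ Φ 0) 0 := (hΦ.differentiable (by simp) 0).hasFDerivAt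
  have hd' : fderiv ℝ Φ 0 = A.coprod S.subtypeL := by
    refine ContinuousLinearMap.ext fun q => ?_
    have h1 : fderiv ℝ Φ 0 (q.1, 0) = A q.1 := by
      have h2 : HasFDerivAt (fun t : T => ((t, 0) : T × S)) (ContinuousLinearMap.inl ℝ T S) 0 :=
        (ContinuousLinearMap.inl ℝ T S).hasFDerivAt
      have h3 := HasFDerivAt.comp (x := (0 : T)) (g := Φ) (g' := fderiv ℝ Φ 0) hd h2
      have h4 : (Φ ∘ fun t : T => ((t, 0) : T × S)) = fun t => p (t, y) := by
        funext t
        simp [Φ]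
      rw [h4] at h3
      exact congrArg (fun L : T →L[ℝ] V => L q.1) (h3.unique hA)
    have h5 : fderiv ℝ Φ 0 (0, q.2) = q.2 := by
      have h2 : HasFDerivAt (fun s : S => ((0, s) : T × S)) (ContinuousLinearMap.inr ℝ T S) 0 :=
        (ContinuousLinearMap.inr ℝ T S).hasFDerivAt
      have h3 := HasFDerivAt.comp (x := (0 : S)) (g := Φ) (g' := fderiv ℝ Φ 0) hd h2
      have h4 : (Φ ∘ fun s : S => ((0, s) : T × S)) = fun s => y + S.subtypeL s := by
        funext s
        simp [Φ, hp0]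
      rw [h4] at h3
      exact congrArg (fun L : S →L[ℝ] V => L q.2)
        (h3.unique (S.subtypeL.hasFDerivAt.const_add y))
    have h6 : q = (q.1, 0) + (0, q.2) := by simp
    conv_lhs => rw [h6, map_add, h1, h5]
    rfl
  have hker : LinearMap.ker (A.coprod S.subtypeL : T × S →ₗ[ℝ] V) = ⊥ := by
    have := LinearMap.ker_coprod_of_disjoint_range (A : T →ₗ[ℝ] V) S.subtype
      (by rw [Submodule.range_subtype]; exact hS.disjoint)
    rw [LinearMap.ker_eq_bot.2 hinj, Submodule.ker_subtype, Submodule.prod_bot] at this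
    exact this
  have hran : LinearMap.range (A.coprod S.subtypeL : T × S →ₗ[ℝ] V) = ⊤ := by
    have := LinearMap.range_coprod (A : T →ₗ[ℝ] V) S.subtype
    rw [Submodule.range_subtype, hS.sup_eq_top] at this
    exact this
  let E : (T × S) ≃L[ℝ] V := ContinuousLinearEquiv.ofBijective (A.coprod S.subtypeL) hker hran
  have hE : (E : T × S →L[ℝ] V) = fderiv ℝ Φ 0 := by
    rw [hd']
    exact ContinuousLinearMap.ext fun q => rfl
  obtain ⟨g, hg, hg0, hgl, hgr⟩ := exists_local_inverse (f' := E) hΦ.contDiffAt (by rwa [hE])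
  have hΦ0 : Φ 0 = y := by simp [Φ, hp0]
  rw [hΦ0] at hg hg0 hgr
  refine ⟨fun z => (g z).1, hg.fst, congrArg Prod.fst hg0, ?_, ?_⟩
  · have h1 : Filter.Tendsto (fun z => ((g z).2 : V)) (𝓝 y) (𝓝 0) := by
      have := (continuous_subtype_val.comp continuous_snd).continuousAt.tendsto.comp
        (x := 𝓝 y) hg.continuousAt
      rw [hg0] at this
      exact this
    filter_upwards [hgr, h1.eventually hSΩ] with z hz1 hz2 hzΩ
    have h3 : p ((g z).1, y + (g z).2) = z := hz1
    have h4 : y + ((g z).2 : V) ∈ Ω := by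
      rw [← hpneg (g z).1 (y + (g z).2), h3]
      exact hpΩ _ z hzΩ
    rw [hz2 (g z).2.2 h4, add_zero] at h3
    exact h3
  · have h1 : Filter.Tendsto (fun t : T => ((t, 0) : T × S)) (𝓝 0) (𝓝 0) :=
      (continuous_id.prodMk continuous_const).tendsto' _ _ rfl
    filter_upwards [h1.eventually hgl] with t ht
    have h2 : Φ (t, 0) = p (t, y) := by simp [Φ]
    rw [← h2, ht]

/-- The change of chart between the parametrizations of an orbit based at `y` and at a nearby point `z`,
depending analytically on `z`. -/
theorem exists_transition {p : T × V → V} (hp : ContDiff ℝ ω p) (hp0 : ∀ z, p (0, z) = z) {y : V}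
    {c : V → T} (hc : ContDiffAt ℝ ω c y) (hc0 : c y = 0) (hcp : ∀ᶠ t in 𝓝 (0 : T), c (p (t, y)) = t) :
    ∃ σ : V × T → T, ContDiffAt ℝ ω σ (y, 0) ∧ σ (y, 0) = 0 ∧
      (∀ᶠ q in 𝓝 (y, (0 : T)), c (p (σ q, q.1)) = q.2) ∧
      ∀ᶠ q in 𝓝 (y, (0 : T)), σ (q.1, c (p (q.2, q.1))) = q.2 := by
  have hcp' : ContDiffAt ℝ ω (fun q : V × T => c (p (q.2, q.1))) (y, 0) := by
    refine ContDiffAt.comp (y, (0 : T)) (g := c) ?_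
      (hp.contDiffAt.comp (y, (0 : T)) (contDiffAt_snd.prodMk contDiffAt_fst))
    change ContDiffAt ℝ ω c (p (0, y))
    rwa [hp0]
  let Ψ : V × T → V × T := fun q => (q.1, c (p (q.2, q.1)))
  have hΨ : ContDiffAt ℝ ω Ψ (y, 0) := contDiffAt_fst.prodMk hcp'
  set L := fderiv ℝ (fun q : V × T => c (p (q.2, q.1))) (y, 0) with hL
  have hLd : HasFDerivAt (fun q : V × T => c (p (q.2, q.1))) L (y, 0) :=
    (hcp'.differentiableAt (by simp)).hasFDerivAt
  have hL0 : ∀ τ, L (0, τ) = τ := by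
    have h2 : HasFDerivAt (fun t : T => ((y, t) : V × T)) (ContinuousLinearMap.inr ℝ V T) 0 :=
      hasFDerivAt_prodMk_right y 0
    have h3 := HasFDerivAt.comp (x := (0 : T)) (g := fun q : V × T => c (p (q.2, q.1))) hLd h2
    have h4 : HasFDerivAt (fun t : T => c (p (t, y))) (ContinuousLinearMap.id ℝ T) 0 :=
      (hasFDerivAt_id (0 : T)).congr_of_eventuallyEq hcp
    intro τ
    exact congrArg (fun L : T →L[ℝ] T => L τ) (h3.unique h4)
  have hLs : ∀ q : V × T, L q = L (q.1, 0) + q.2 := fun q => by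
    have : q = (q.1, 0) + (0, q.2) := by simp
    conv_lhs => rw [this, map_add, hL0]
  let E : (V × T) ≃L[ℝ] (V × T) := ContinuousLinearEquiv.equivOfInverse
    ((ContinuousLinearMap.fst ℝ V T).prod L)
    ((ContinuousLinearMap.fst ℝ V T).prod (ContinuousLinearMap.snd ℝ V T -
      (L.comp (ContinuousLinearMap.inl ℝ V T)).comp (ContinuousLinearMap.fst ℝ V T)))
    (fun q => Prod.ext rfl (by
      change L q - L (q.1, 0) = q.2
      rw [hLs q, add_sub_cancel_left]))
    (fun q => Prod.ext rfl (by
      change L (q.1, q.2 - L (q.1, 0)) = q.2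
      rw [hLs, add_sub_cancel]))
  obtain ⟨g, hg, hg0, hgl, hgr⟩ := exists_local_inverse (f' := E) hΨ
    (hasFDerivAt_fst.prodMk hLd)
  have hΨ0 : Ψ (y, 0) = (y, 0) := by simp [Ψ, hp0, hc0]
  rw [hΨ0] at hg hg0 hgr
  refine ⟨fun q => (g q).2, hg.snd, congrArg Prod.snd hg0, ?_, ?_⟩
  · filter_upwards [hgr] with q hq
    have h1 : (g q).1 = q.1 := (Prod.ext_iff.1 hq).1
    have h2 : c (p ((g q).2, (g q).1)) = q.2 := (Prod.ext_iff.1 hq).2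
    rwa [h1] at h2
  · filter_upwards [hgl] with q hq
    exact congrArg Prod.snd hq

end Chart

/-! ### Smooth representatives in charts -/

section SmoothRepresentative

theorem isOpenPosMeasure_of_isPretransitive {M X : Type*} [Group M] [MulAction M X]
    [MulAction.IsPretransitive M X] [TopologicalSpace X] [SecondCountableTopology X]
    [MeasurableSpace X] {μ : Measure X} (hμ : μ ≠ 0) (hcont : ∀ m : M, Continuous fun x : X => m • x)
    (hqi : ∀ (m : M) (O : Set X), IsOpen O → μ O = 0 → μ ((fun x => m • x) ⁻¹' O) = 0) :
    μ.IsOpenPosMeasure := by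
  refine ⟨fun O hO ⟨x, hx⟩ h0 => hμ ?_⟩
  refine Measure.measure_univ_eq_zero.1 (measure_null_of_locally_null _ fun z _ => ?_)
  obtain ⟨m, hm⟩ := MulAction.exists_smul_eq M z x
  refine ⟨_, mem_nhdsWithin_of_mem_nhds ((hO.preimage (hcont m)).mem_nhds ?_), hqi m O hO h0⟩
  change m • z ∈ O
  rwa [hm]

theorem continuous_of_mem_smoothFunctions {V : Type*} [NormedAddCommGroup V] [NormedSpace ℝ V]
    {Ω : Set V} {f : Ω → ℂ} (hf : f ∈ smoothFunctions Ω) :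
    Continuous f := by
  refine continuous_iff_continuousAt.2 fun y => ?_
  obtain ⟨U, hU, F, hF, hFf⟩ := hf y
  have h1 : ContinuousAt (fun z : Ω => F z) y :=
    (hF.continuous.comp continuous_subtype_val).continuousAt
  refine h1.congr ?_
  filter_upwards [continuous_subtype_val.continuousAt.preimage_mem_nhds hU] with z hz
  exact (hFf z hz).symm

theorem contDiff_bump_smul {V : Type*} [NormedAddCommGroup V] [NormedSpace ℝ V]
    [FiniteDimensional ℝ V] {y : V} (ρ : ContDiffBump y) {F : V → ℂ}
    (hF : ∀ w ∈ Metric.closedBall y ρ.rOut, ContDiffAt ℝ ∞ F w) :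
    ContDiff ℝ ∞ fun w => ρ w • F w := by
  refine contDiff_iff_contDiffAt.2 fun w => ?_
  by_cases hw : w ∈ Metric.closedBall y ρ.rOut
  · exact ρ.contDiff.contDiffAt.smul (hF w hw)
  · refine (contDiffAt_const (c := (0 : ℂ))).congr_of_eventuallyEq ?_
    filter_upwards [Metric.isClosed_closedBall.isOpen_compl.mem_nhds hw] with z hz
    rw [ρ.zero_of_le_dist (not_le.1 fun h => hz (Metric.mem_closedBall.2 h)).le, zero_smul]

variable {V : Type*} [NormedAddCommGroup V] [NormedSpace ℝ V] [FiniteDimensional ℝ V] {Ω : Set V}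
  [MeasurableSpace Ω] [BorelSpace Ω] {μ : Measure Ω} [μ.IsOpenPosMeasure]

/-- Local smooth representatives of a function on `Ω` fit together. -/
theorem exists_smoothFunctions_ae_eq_of_local {v : Ω → ℂ}
    (h : ∀ y : Ω, ∃ F : V → ℂ, ContDiff ℝ ∞ F ∧ ∃ U ∈ 𝓝 (y : V),
      ∀ᵐ z : Ω ∂μ, (z : V) ∈ U → v z = F z) :
    ∃ f : smoothFunctions Ω, v =ᵐ[μ] (f : Ω → ℂ) := by
  choose F hF U hU hv using h
  have hopen : ∀ y : Ω, IsOpen {z : Ω | (z : V) ∈ interior (U y)} := fun y =>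
    isOpen_interior.preimage continuous_subtype_val
  have hmem : ∀ y : Ω, y ∈ {z : Ω | (z : V) ∈ interior (U y)} := fun y =>
    mem_interior_iff_mem_nhds.2 (hU y)
  have hFy : ∀ y z : Ω, (z : V) ∈ interior (U y) → F z z = F y z := by
    intro y z hz
    refine Measure.eqOn_open_of_ae_eq (μ := μ) (f := fun x : Ω => F z x) (g := fun x : Ω => F y x)
      ?_ ((hopen z).inter (hopen y)) ((hF z).continuous.comp continuous_subtype_val).continuousOn
      ((hF y).continuous.comp continuous_subtype_val).continuousOn ⟨hmem z, hz⟩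
    refine (ae_restrict_iff' ((hopen z).inter (hopen y)).measurableSet).2 ?_
    filter_upwards [hv z, hv y] with x h1 h2 hx
    rw [← h1 (interior_subset hx.1), ← h2 (interior_subset hx.2)]
  have hf : (fun z => F z z) ∈ smoothFunctions Ω := fun y =>
    ⟨interior (U y), isOpen_interior.mem_nhds (hmem y), F y, hF y, fun z hz => hFy y z hz⟩
  refine ⟨⟨_, hf⟩, ?_⟩
  refine measure_null_of_locally_null _ fun y _ => ⟨_, inter_mem_nhdsWithin _ ((hopen y).mem_nhds (hmem y)), ?_⟩
  refine measure_mono_null ?_ (hv y)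
  rintro z ⟨hz1, hz2⟩ hz3
  exact hz1 ((hz3 (interior_subset hz2)).trans (hFy y z hz2).symm)

/-- Let the maps `p (t, ·)` preserve `Ω`, and let `t ↦ p (t, y)` parametrize `Ω` near `y`, with inverse `c`. If the translates
`χ t * v (p (t, ·))` of a square-integrable function `v` depend smoothly on `t` in `L²`, then `v` has
near `y` a smooth representative. Indeed, for almost every `z₀` the function `v` is smooth in the
coordinates `t ↦ p (t, z₀)`, up to a null set of `t`; the changes of charts preserve null sets, so that
the exceptional set of `t` is null for every base point `z` near `y`, and by Fubini the
exceptional set in `Ω` is null. -/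
theorem exists_local_smooth_representative {n : ℕ} [SigmaFinite μ]
    {p : EuclideanSpace ℝ (Fin n) × V → V} (hp : ContDiff ℝ ω p) (hp0 : ∀ z, p (0, z) = z)
    (hpneg : ∀ t z, p (-t, p (t, z)) = z) (hpΩ : ∀ t, ∀ z ∈ Ω, p (t, z) ∈ Ω)
    (hqi : ∀ (t : EuclideanSpace ℝ (Fin n)) (E : Set Ω), MeasurableSet E →
      μ {z | (⟨p (t, z), hpΩ t z z.2⟩ : Ω) ∈ E} = 0 → μ E = 0)
    {y : V} {c : V → EuclideanSpace ℝ (Fin n)} (hc : ContDiffAt ℝ ω c y) (hc0 : c y = 0)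
    (hcΩ : ∀ᶠ z in 𝓝 y, z ∈ Ω → p (c z, y) = z) (hcp : ∀ᶠ t in 𝓝 0, c (p (t, y)) = t)
    (hy : y ∈ Ω) {v : Lp ℂ 2 μ} {u : EuclideanSpace ℝ (Fin n) → Lp ℂ 2 μ}
    (hu : @ContDiff ℝ _ _ _ _ (Lp ℂ 2 μ) _ NormedSpace.complexToReal ∞ u)
    {χ : EuclideanSpace ℝ (Fin n) → ℂ} (hχ : ContDiff ℝ ∞ χ) (hχ0 : ∀ t, χ t ≠ 0)
    (huv : ∀ t, u t =ᵐ[μ] fun z => χ t * v ⟨p (t, z), hpΩ t z z.2⟩) :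
    ∃ F : V → ℂ, ContDiff ℝ ∞ F ∧ ∃ U ∈ 𝓝 y, ∀ᵐ z : Ω ∂μ, (z : V) ∈ U → v z = F z := by
  set k : EuclideanSpace ℝ (Fin n) × Ω → Ω := fun q => ⟨p (q.1, q.2), hpΩ q.1 q.2 q.2.2⟩ with hk
  have hkc : Continuous k := Continuous.subtype_mk (hp.continuous.comp
    (continuous_fst.prodMk (continuous_subtype_val.comp continuous_snd))) _
  have hvm : Measurable v := (Lp.stronglyMeasurable v).measurable
  have hWm : Measurable fun q : EuclideanSpace ℝ (Fin n) × Ω => χ q.1 * v (k q) :=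
    (hχ.continuous.measurable.comp measurable_fst).mul (hvm.comp hkc.measurable)
  have hgood := ae_exists_contDiff_of_contDiff_Lp hu hWm huv
  obtain ⟨σ, hσ, hσ0, hσr, hσl⟩ := exists_transition hp hp0 hc hc0 hcp
  -- All the points that occur in the argument stay in the domains of the charts.
  have tw : Filter.Tendsto (fun q : V × V × EuclideanSpace ℝ (Fin n) => p (q.2.2, q.2.1))
      (𝓝 (y, y, 0)) (𝓝 y) := by
    have h1 : Continuous fun q : V × V × EuclideanSpace ℝ (Fin n) => p (q.2.2, q.2.1) :=
      hp.continuous.comp (by fun_prop)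
    exact h1.tendsto' _ _ (hp0 y)
  have ts : Filter.Tendsto (fun q : V × V × EuclideanSpace ℝ (Fin n) => c (p (q.2.2, q.2.1)))
      (𝓝 (y, y, 0)) (𝓝 0) := by
    have := hc.continuousAt.tendsto
    rw [hc0] at this
    exact this.comp tw
  have t1 : Filter.Tendsto (fun q : V × V × EuclideanSpace ℝ (Fin n) => (q.1, c (p (q.2.2, q.2.1))))
      (𝓝 (y, y, 0)) (𝓝 (y, 0)) := (continuous_fst.tendsto' _ _ rfl).prodMk_nhds ts
  have t2 : Filter.Tendsto (fun q : V × V × EuclideanSpace ℝ (Fin n) =>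
      (q.2.1, c (p (q.2.2, q.2.1)))) (𝓝 (y, y, 0)) (𝓝 (y, 0)) :=
    ((continuous_fst.comp continuous_snd).tendsto' _ _ rfl).prodMk_nhds ts
  have t3 : Filter.Tendsto (fun q : V × V × EuclideanSpace ℝ (Fin n) =>
      σ (q.1, c (p (q.2.2, q.2.1)))) (𝓝 (y, y, 0)) (𝓝 0) := by
    have := hσ.continuousAt.tendsto
    rw [hσ0] at this
    exact this.comp t1
  have t4 : Filter.Tendsto (fun q : V × V × EuclideanSpace ℝ (Fin n) =>
      p (σ (q.1, c (p (q.2.2, q.2.1))), q.1)) (𝓝 (y, y, 0)) (𝓝 y) := by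
    have h1 := hp.continuous.tendsto ((0 : EuclideanSpace ℝ (Fin n)), y)
    rw [hp0] at h1
    exact h1.comp (t3.prodMk_nhds (continuous_fst.tendsto' _ _ rfl))
  have t5 : Filter.Tendsto (fun q : V × V × EuclideanSpace ℝ (Fin n) => (q.2.1, q.2.2))
      (𝓝 (y, y, 0)) (𝓝 (y, 0)) := continuous_snd.tendsto' _ _ rfl
  have hω : (ω : WithTop ℕ∞) ≠ ∞ := by simp
  have hev := (tw.eventually ((hc.eventually hω).and hcΩ)).and
    ((t1.eventually ((hσ.eventually hω).and hσr)).and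
    ((t2.eventually (hσ.eventually hω)).and
    ((t3.eventually (Metric.ball_mem_nhds 0 one_pos)).and
    ((t4.eventually ((hc.eventually hω).and hcΩ)).and (t5.eventually hσl)))))
  obtain ⟨ε, hε, hball⟩ := Metric.eventually_nhds_iff.1 hev
  have hB : ∀ (z₀ z : V) (t : EuclideanSpace ℝ (Fin n)), dist z₀ y < ε → dist z y < ε → dist t 0 < ε → _ :=
    fun z₀ z t h1 h2 h3 => @hball (z₀, z, t) (max_lt h1 (max_lt h2 h3))
  clear hball hev t1 t2 t3 t4 t5 tw ts
  -- The base point `z₀` at which `v` is smooth in the coordinates `t`.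
  obtain ⟨z₀, ⟨g, hg, hgv⟩, hz₀⟩ : ∃ z₀ : Ω, (∃ g : EuclideanSpace ℝ (Fin n) → ℂ, ContDiff ℝ ∞ g ∧
      ∀ᵐ t, t ∈ Metric.ball (0 : EuclideanSpace ℝ (Fin n)) 1 → χ t * v (k (t, z₀)) = g t) ∧
      dist (z₀ : V) y < ε := by
    have hO : IsOpen {z : Ω | dist (z : V) y < ε} :=
      isOpen_lt (continuous_subtype_val.dist continuous_const) continuous_const
    obtain ⟨z, hz1, hz2⟩ := (Measure.dense_of_ae hgood).inter_open_nonempty _ hO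
      ⟨⟨y, hy⟩, by simpa using hε⟩
    exact ⟨z, hz2, hz1⟩
  set N : Set (EuclideanSpace ℝ (Fin n)) := {t | ¬ (t ∈ Metric.ball 0 1 → χ t * v (k (t, z₀)) = g t)}
    with hN
  have hN0 : volume N = 0 := hgv
  set F₀ : V → ℂ := fun w => (χ (σ (z₀, c w)))⁻¹ * g (σ (z₀, c w)) with hF₀
  have hF₀s : ∀ w, dist w y < ε → ContDiffAt ℝ ∞ F₀ w := by
    intro w hw
    have h1 := hB z₀ w 0 hz₀ hw (by simpa using hε)
    simp only [hp0] at h1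
    have h2 : ContDiffAt ℝ ∞ (fun w => σ (z₀, c w)) w :=
      (h1.2.1.1.of_le (by simp)).comp w (contDiffAt_const.prodMk (h1.1.1.of_le (by simp)))
    exact ((hχ.contDiffAt.comp w h2).inv (hχ0 _)).mul (hg.contDiffAt.comp w h2)
  let ρ : ContDiffBump y := ⟨ε / 4, ε / 2, by positivity, by linarith⟩
  have hFs : ContDiff ℝ ∞ fun w => ρ w • F₀ w := contDiff_bump_smul ρ fun w hw => hF₀s w
    (lt_of_le_of_lt (Metric.mem_closedBall.1 hw) (by change ε / 2 < ε; linarith))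
  have hFm : Measurable fun z : Ω => ρ (z : V) • F₀ z :=
    (hFs.continuous.comp continuous_subtype_val).measurable
  refine ⟨_, hFs, ?_⟩
  set A : Set Ω := {w | dist (w : V) y < ε / 4 ∧ v w ≠ ρ (w : V) • F₀ w} with hA
  have hAm : MeasurableSet A := by
    refine MeasurableSet.inter ?_ (measurableSet_eq_fun hvm hFm).compl
    exact (isOpen_lt (continuous_subtype_val.dist continuous_const) continuous_const).measurableSet
  have hnull : ∀ z : Ω, ∀ᵐ t, dist (z : V) y < ε → dist t 0 < ε → k (t, z) ∉ A := by
    intro z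
    rw [ae_iff]
    set N' : Set (EuclideanSpace ℝ (Fin n)) := {t | t ∈ N ∧ DifferentiableAt ℝ c (p (t, z₀)) ∧
      DifferentiableAt ℝ σ (z, c (p (t, z₀)))} with hN'
    have hθ : DifferentiableOn ℝ (fun t => σ (z, c (p (t, z₀)))) N' := by
      intro t ht
      have h1 : DifferentiableAt ℝ (fun t => p (t, (z₀ : V))) t :=
        ((hp.differentiable (by simp)).comp (by fun_prop)).differentiableAt
      have h2 : DifferentiableAt ℝ (fun t => c (p (t, (z₀ : V)))) t := ht.2.1.comp t h1
      have h3 : DifferentiableAt ℝ (fun t => ((z : V), c (p (t, (z₀ : V))))) t :=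
        (differentiableAt_const _).prodMk h2
      exact (DifferentiableAt.comp t (g := σ) ht.2.2 h3).differentiableWithinAt
    refine measure_mono_null ?_ (addHaar_image_eq_zero_of_differentiableOn_of_addHaar_eq_zero volume
      hθ (measure_mono_null (fun t ht => ht.1) hN0))
    intro t ht
    rw [Set.mem_ofPred_eq] at ht
    push Not at ht
    obtain ⟨hz, ht, hbad⟩ := ht
    obtain ⟨⟨-, h1⟩, ⟨-, h2⟩, h3, h4, ⟨h5, h6⟩, h7⟩ := hB z₀ z t hz₀ hz ht
    simp only at h1 h2 h3 h4 h5 h6 h7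
    set w : V := p (t, z) with hw
    set t' := σ (z₀, c w) with ht'
    -- The points with parameters `t` at `z` and `t'` at `z₀` coincide.
    have h8 : p (t', z₀) = w := by
      rw [← h6 (hpΩ _ _ z₀.2), h2, h1 (hpΩ _ _ z.2)]
    refine ⟨t', ⟨?_, h5.differentiableAt (by simp), ?_⟩, ?_⟩
    · intro hcon
      have h9 := hcon h4
      have h10 : k (t', z₀) = k (t, z) := Subtype.ext h8
      rw [h10] at h9
      refine hbad.2 ?_
      have h11 : ρ w = 1 := ρ.one_of_mem_closedBall hbad.1.le
      change v (k (t, z)) = ρ w • F₀ w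
      rw [h11, one_smul]
      change _ = (χ t')⁻¹ * g t'
      rw [← h9]
      exact (inv_mul_cancel_left₀ (hχ0 _) _).symm
    · rw [h8]
      exact h3.differentiableAt (by simp)
    · change σ (z, c (p (t', z₀))) = t
      rw [h8]
      exact h7
  have hswap : ∀ᵐ t : EuclideanSpace ℝ (Fin n), ∀ᵐ z : Ω ∂μ,
      dist (z : V) y < ε → dist t 0 < ε → k (t, z) ∉ A := by
    refine (Measure.ae_ae_comm (p := fun (t : EuclideanSpace ℝ (Fin n)) (z : Ω) =>
      dist (z : V) y < ε → dist t 0 < ε → k (t, z) ∉ A) ?_).2 (.of_forall hnull)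
    have e : {x : EuclideanSpace ℝ (Fin n) × Ω | dist (x.2 : V) y < ε → dist x.1 0 < ε →
        k (x.1, x.2) ∉ A} = ({x | dist (x.2 : V) y < ε} ∩ ({x | dist x.1 0 < ε} ∩ k ⁻¹' A))ᶜ := by
      ext x
      simp only [Set.mem_ofPred_eq, Set.mem_compl_iff, Set.mem_inter_iff, Set.mem_preimage]
      tauto
    rw [e]
    refine (MeasurableSet.inter ?_ (MeasurableSet.inter ?_ (hkc.measurable hAm))).compl
    · exact (isOpen_lt ((continuous_subtype_val.comp continuous_snd).dist continuous_const)
        continuous_const).measurableSet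
    · exact (isOpen_lt (continuous_fst.dist continuous_const) continuous_const).measurableSet
  have hinv : ∀ᶠ q in 𝓝 ((0 : EuclideanSpace ℝ (Fin n)), y), dist (p (-q.1, q.2)) y < ε := by
    have h1 : Continuous fun q : EuclideanSpace ℝ (Fin n) × V => p (-q.1, q.2) :=
      hp.continuous.comp (by fun_prop)
    have h2 := h1.tendsto' ((0 : EuclideanSpace ℝ (Fin n)), y) y (by simp [hp0])
    exact h2.eventually (Metric.ball_mem_nhds y hε)
  obtain ⟨δ, hδ, hinv⟩ := Metric.eventually_nhds_iff.1 hinv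
  obtain ⟨t, ht1, ht2⟩ := (Measure.dense_of_ae hswap).inter_open_nonempty
    (Metric.ball 0 (min δ ε)) Metric.isOpen_ball ⟨0, Metric.mem_ball_self (lt_min hδ hε)⟩
  have ht1' : dist t 0 < min δ ε := ht1
  have hE : μ (A ∩ {w : Ω | dist (w : V) y < δ}) = 0 := by
    refine hqi t _ (hAm.inter
      (isOpen_lt (continuous_subtype_val.dist continuous_const) continuous_const).measurableSet) ?_
    refine measure_mono_null ?_ ht2
    rintro z ⟨hz1, hz2⟩ hz3
    refine hz3 ?_ (ht1'.trans_le (min_le_right _ _)) hz1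
    have h1 := @hinv (t, p (t, z)) (max_lt (ht1'.trans_le (min_le_left _ _)) hz2)
    rwa [hpneg] at h1
  refine ⟨Metric.ball y (min δ (ε / 4)), Metric.ball_mem_nhds y (lt_min hδ (by positivity)), ?_⟩
  refine measure_mono_null ?_ hE
  intro z hz
  rw [Set.mem_compl_iff, Set.mem_ofPred_eq] at hz
  push Not at hz
  have hz1 : dist (z : V) y < min δ (ε / 4) := hz.1
  exact ⟨⟨hz1.trans_le (min_le_right _ _), hz.2⟩, hz1.trans_le (min_le_left _ _)⟩

end SmoothRepresentative

/-! ### Smoothness of continuous characters and of linear actions -/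

section Smoothness

/-- A continuous character of a Euclidean space is smooth, being proportional to its convolution with a
bump function. -/
theorem contDiff_of_continuous_of_map_add {n : ℕ} {χ : EuclideanSpace ℝ (Fin n) → ℂ}
    (hχ : Continuous χ) (hadd : ∀ s t, χ (s + t) = χ s * χ t) (h0 : χ 0 = 1) :
    ContDiff ℝ ∞ χ := by
  obtain ⟨δ, hδ, hball⟩ := Metric.continuousAt_iff.1 (hχ.continuousAt (x := 0)) (1 / 2) (by norm_num)
  let ρ : ContDiffBump (0 : EuclideanSpace ℝ (Fin n)) := ⟨δ / 2, δ, by positivity, by linarith⟩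
  set ψ : EuclideanSpace ℝ (Fin n) → ℂ :=
    convolution (ρ.normed volume) χ (ContinuousLinearMap.lsmul ℝ ℝ) volume with hψ
  have hψs : ContDiff ℝ ∞ ψ := ρ.hasCompactSupport_normed.contDiff_convolution_left _
    ρ.contDiff_normed hχ.locallyIntegrable
  have hψ0 : ψ 0 ≠ 0 := by
    have h1 : dist (ψ 0) (χ 0) ≤ 1 / 2 := ρ.dist_normed_convolution_le hχ.aestronglyMeasurable
      fun x hx => (hball hx).le
    intro h2
    rw [h0, h2, dist_zero_left, norm_one] at h1
    norm_num at h1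
  have hψχ : ∀ t, ψ t = χ t * ψ 0 := fun t => by
    simp only [hψ, convolution_def, ContinuousLinearMap.lsmul_apply]
    rw [← integral_const_mul]
    congr 1
    funext s
    have h1 := hadd t (0 - s)
    rw [zero_sub, ← sub_eq_add_neg] at h1
    rw [h1, zero_sub, mul_smul_comm]
  have e : χ = fun t => ψ t * (ψ 0)⁻¹ := by
    funext t
    rw [hψχ t, mul_assoc, mul_inv_cancel₀ hψ0, mul_one]
  rw [e]
  exact hψs.mul contDiff_const

variable {V W : Type*} [NormedAddCommGroup V] [NormedSpace ℝ V]
  [NormedAddCommGroup W] [NormedSpace ℝ W]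

theorem hasFDerivAt_zero_of_lines {f : V → W} {A : V →L[ℝ] W} (hf : DifferentiableAt ℝ f 0)
    (hA : ∀ τ, HasDerivAt (fun s : ℝ => f (s • τ)) (A τ) 0) : HasFDerivAt f A 0 := by
  have h1 : fderiv ℝ f 0 = A := by
    refine ContinuousLinearMap.ext fun τ => ?_
    have h2 : HasDerivAt (fun s : ℝ => s • τ) τ 0 := by
      simpa using (hasDerivAt_id (0 : ℝ)).smul_const τ
    have h3 : HasFDerivAt f (fderiv ℝ f 0) ((0 : ℝ) • τ) := by
      rw [zero_smul]; exact hf.hasFDerivAt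
    exact (h3.comp_hasDerivAt (0 : ℝ) h2).unique (hA τ)
  rw [← h1]
  exact hf.hasFDerivAt

variable [FiniteDimensional ℝ W]

theorem exists_continuous_leftInverse {i : V →ₗ[ℝ] W} (hi : Function.Injective i) :
    ∃ r : W →L[ℝ] V, ∀ x, r (i x) = x := by
  obtain ⟨r, hr⟩ := i.exists_leftInverse_of_injective (LinearMap.ker_eq_bot.2 hi)
  exact ⟨LinearMap.toContinuousLinearMap r, fun x => LinearMap.congr_fun hr x⟩

theorem contDiff_of_linear_comp {P : Type*} [NormedAddCommGroup P] [NormedSpace ℝ P]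
    {i : V →ₗ[ℝ] W} (hi : Function.Injective i) {n : WithTop ℕ∞} {f : P → V}
    (hf : ContDiff ℝ n fun x => i (f x)) : ContDiff ℝ n f := by
  obtain ⟨r, hr⟩ := exists_continuous_leftInverse hi
  have := r.contDiff.comp hf
  simpa only [Function.comp_def, hr] using this

theorem hasDerivAt_of_linear_comp {i : V →ₗ[ℝ] W} (hi : Function.Injective i) {f : ℝ → V} {v : V}
    {t : ℝ} (hf : HasDerivAt (fun x => i (f x)) (i v) t) : HasDerivAt f v t := by
  obtain ⟨r, hr⟩ := exists_continuous_leftInverse hi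
  have := r.hasFDerivAt.comp_hasDerivAt t hf
  simpa only [Function.comp_def, hr] using this

theorem exists_continuous_bilinear [FiniteDimensional ℝ V] (B : V →ₗ[ℝ] W →ₗ[ℝ] V) :
    ∃ A : V →L[ℝ] W →L[ℝ] V, ∀ z τ, A z τ = B z τ :=
  ⟨LinearMap.toContinuousLinearMap
    (LinearMap.toContinuousLinearMap.toLinearMap ∘ₗ B), fun _ _ => rfl⟩

end Smoothness

/-! ### The orbits of the Levi subgroup -/

namespace RealAlgebraicGroup

variable {d : ℕ} {G : RealAlgebraicGroup d} {h : G.lieAlgebra}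

/-- The exponential map of the Lie algebra `𝔪` of the Levi subgroup. -/
def leviExp (X : G.gradedPart h 0) : G.levi h :=
  ⟨G.expMap X, MulAction.mem_stabilizer_iff.2 <| by
    have h1 : ⁅(X : G.lieAlgebra), h⁆ = 0 := by
      rw [← lie_skew, (mem_gradedPart G).1 X.2, zero_smul, neg_zero]
    rw [expMap_smul_of_lie (by simp only [h1, lie_zero]), h1, lie_zero, smul_zero, add_zero,
      add_zero]⟩

theorem coe_leviExp (X : G.gradedPart h 0) : (leviExp X : G.realPoints) = G.expMap X := rfl

theorem leviExp_zero : leviExp (0 : G.gradedPart h 0) = 1 := Subtype.ext expMap_zero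

theorem leviExp_neg (X : G.gradedPart h 0) : leviExp (-X) = (leviExp X)⁻¹ :=
  Subtype.ext (expMap_neg _)

theorem leviExp_nsmul (X : G.gradedPart h 0) (k : ℕ) : leviExp ((k : ℝ) • X) = leviExp X ^ k := by
  induction k with
  | zero => rw [Nat.cast_zero, zero_smul, leviExp_zero, pow_zero]
  | succ k ih =>
    rw [pow_succ, ← ih]
    refine Subtype.ext ?_
    have := expMap_add_smul (k : ℝ) 1 (X : G.lieAlgebra)
    rw [one_smul] at this
    rw [Nat.cast_succ]
    exact this

/-- The bracket `𝔪 × 𝔫̄ → 𝔫̄`. -/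
def leviLie (h : G.lieAlgebra) : G.gradedPart h 0 →ₗ[ℝ] G.nilBar h →ₗ[ℝ] G.nilBar h :=
  LinearMap.mk₂ ℝ (fun X y => ⟨⁅(X : G.lieAlgebra), (y : G.lieAlgebra)⁆, by
      have := lie_mem_gradedPart X.2 y.2
      rwa [zero_add] at this⟩)
    (fun X Y y => Subtype.ext (add_lie _ _ _)) (fun a X y => Subtype.ext (_root_.smul_lie _ _ _))
    (fun X y z => Subtype.ext (lie_add _ _ _)) (fun a X y => Subtype.ext (lie_smul _ _ _))

section Topology

attribute [local instance] Matrix.linftyOpNormedRing Matrix.linftyOpNormedAlgebra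

variable (h) in
/-- The inclusion of `𝔫̄` in the space of matrices. -/
def nilBarMatrix : G.nilBar h →ₗ[ℝ] Matrix (Fin d) (Fin d) ℝ :=
  G.lieAlgebra.toSubmodule.subtype ∘ₗ (G.nilBar h).subtype

theorem nilBarMatrix_injective : Function.Injective (nilBarMatrix h) :=
  Subtype.val_injective.comp Subtype.val_injective

theorem nilBarMatrix_leviExp_smul (X : G.gradedPart h 0) (y : G.nilBar h) :
    nilBarMatrix h (leviExp X • y) =
      NormedSpace.exp ((X : G.lieAlgebra) : Matrix (Fin d) (Fin d) ℝ) * nilBarMatrix h y *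
        NormedSpace.exp (-((X : G.lieAlgebra) : Matrix (Fin d) (Fin d) ℝ)) := by
  change (((leviExp X : G.realPoints) • (y : G.lieAlgebra) : G.lieAlgebra) :
    Matrix (Fin d) (Fin d) ℝ) = _
  rw [coe_leviExp, coe_smul, ← expMap_neg]
  change toMatrix _ * _ * toMatrix _ = _
  rw [toMatrix, toMatrix, coe_expMap, coe_expMap]
  rfl

theorem contDiff_linear_matrix {P : Type*} [NormedAddCommGroup P] [NormedSpace ℝ P]
    [FiniteDimensional ℝ P] (f : P →ₗ[ℝ] Matrix (Fin d) (Fin d) ℝ) {n : WithTop ℕ∞} :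
    ContDiff ℝ n f := by
  have := (LinearMap.toContinuousLinearMap f).contDiff (n := n)
  exact this

theorem contDiff_leviExp_smul {P : Type*} [NormedAddCommGroup P] [NormedSpace ℝ P]
    [FiniteDimensional ℝ P] (X : P →ₗ[ℝ] G.gradedPart h 0) {n : WithTop ℕ∞} :
    ContDiff ℝ n fun q : P × G.nilBar h => leviExp (X q.1) • q.2 := by
  refine contDiff_of_linear_comp (V := G.nilBar h) (nilBarMatrix_injective (h := h)) ?_
  simp only [nilBarMatrix_leviExp_smul]
  have hX : ContDiff ℝ n fun t : P => ((X t : G.lieAlgebra) : Matrix (Fin d) (Fin d) ℝ) :=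
    contDiff_linear_matrix (G.lieAlgebra.toSubmodule.subtype ∘ₗ (G.gradedPart h 0).subtype ∘ₗ X)
  exact ((contDiff_normedSpace_exp.comp (hX.comp contDiff_fst)).mul
    ((contDiff_linear_matrix (nilBarMatrix h)).comp contDiff_snd)).mul
      (contDiff_normedSpace_exp.comp (hX.comp contDiff_fst).neg)

theorem hasDerivAt_leviExp_smul (X : G.gradedPart h 0) (y : G.nilBar h) :
    HasDerivAt (fun s : ℝ => leviExp (s • X) • y) (leviLie h X y) 0 := by
  refine hasDerivAt_of_linear_comp (V := G.nilBar h) (nilBarMatrix_injective (h := h)) ?_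
  simp only [nilBarMatrix_leviExp_smul]
  have h1 := hasDerivAt_exp_smul_const (𝕂 := ℝ) ((X : G.lieAlgebra) : Matrix (Fin d) (Fin d) ℝ) (0 : ℝ)
  have h2 := hasDerivAt_exp_smul_const (𝕂 := ℝ) (-((X : G.lieAlgebra) : Matrix (Fin d) (Fin d) ℝ)) (0 : ℝ)
  have h3 := (h1.mul_const (nilBarMatrix h y)).mul h2
  simp only [zero_smul, smul_neg, neg_zero, NormedSpace.exp_zero, one_mul, mul_one, mul_neg,
    ← sub_eq_add_neg] at h3
  exact h3

theorem continuous_leviExp : Continuous fun X : G.gradedPart h 0 => leviExp X := by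
  have h1 : Continuous fun X : G.gradedPart h 0 => G.expMap X :=
    continuous_expMap.comp continuous_subtype_val
  exact h1.subtype_mk _

/-- A continuous character of the Levi subgroup is additive on its Lie algebra, by the Lie product
formula. -/
theorem map_leviExp_add {ν : G.levi h →* ℂˣ} (hν : Continuous ν) (X Y : G.gradedPart h 0) :
    ν (leviExp (X + Y)) = ν (leviExp X) * ν (leviExp Y) := by
  set s : ℕ → ℝ := fun k => 1 / ((k : ℝ) + 1) with hs
  set γ : ℕ → G.levi h := fun k => (leviExp (s k • X) * leviExp (s k • Y)) ^ (k + 1) with hγ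
  have h1 : ∀ k, ν (γ k) = ν (leviExp X) * ν (leviExp Y) := fun k => by
    have h2 : ∀ Z : G.gradedPart h 0, leviExp (s k • Z) ^ (k + 1) = leviExp Z := fun Z => by
      rw [← leviExp_nsmul, smul_smul, hs]
      have : ((k : ℝ) + 1) ≠ 0 := by positivity
      push_cast
      rw [mul_one_div_cancel this, one_smul]
    rw [hγ]
    simp only
    rw [map_pow, map_mul, mul_pow, ← map_pow, ← map_pow, h2, h2]
  have h3 : Filter.Tendsto γ Filter.atTop (𝓝 (leviExp (X + Y))) := by
    have hc := tendsto_curve_pow (norm_one_matrix_le (d := d))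
      (fun r : ℝ => NormedSpace.exp (r • ((X : G.lieAlgebra) : Matrix (Fin d) (Fin d) ℝ)) *
        NormedSpace.exp (r • ((Y : G.lieAlgebra) : Matrix (Fin d) (Fin d) ℝ)))
      (((X : G.lieAlgebra) : Matrix (Fin d) (Fin d) ℝ) + ((Y : G.lieAlgebra) : Matrix (Fin d) (Fin d) ℝ))
      (by simp) (by
        have h1 := hasDerivAt_exp_smul_const (𝕂 := ℝ)
          ((X : G.lieAlgebra) : Matrix (Fin d) (Fin d) ℝ) (0 : ℝ)
        have h2 := hasDerivAt_exp_smul_const (𝕂 := ℝ)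
          ((Y : G.lieAlgebra) : Matrix (Fin d) (Fin d) ℝ) (0 : ℝ)
        have := h1.mul h2
        simp only [zero_smul, NormedSpace.exp_zero, one_mul, mul_one] at this
        exact this)
    refine tendsto_subtype_rng.2 (tendsto_subtype_rng.2 (tendsto_subtype_rng.2 ?_))
    have e1 : ∀ k, (((γ k : G.realPoints) : Matrix.SpecialLinearGroup (Fin d) ℝ) :
        Matrix (Fin d) (Fin d) ℝ) =
        (NormedSpace.exp (s k • ((X : G.lieAlgebra) : Matrix (Fin d) (Fin d) ℝ)) *
        NormedSpace.exp (s k • ((Y : G.lieAlgebra) : Matrix (Fin d) (Fin d) ℝ))) ^ (k + 1) := fun k => by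
      rw [hγ]
      simp only [Subgroup.coe_pow, Subgroup.coe_mul, Matrix.SpecialLinearGroup.coe_pow,
        Matrix.SpecialLinearGroup.coe_mul, coe_leviExp, coe_expMap]
      rfl
    have e2 : (((leviExp (X + Y) : G.realPoints) : Matrix.SpecialLinearGroup (Fin d) ℝ) :
        Matrix (Fin d) (Fin d) ℝ) = NormedSpace.exp (((X : G.lieAlgebra) : Matrix (Fin d) (Fin d) ℝ) +
          ((Y : G.lieAlgebra) : Matrix (Fin d) (Fin d) ℝ)) := by
      rw [coe_leviExp, coe_expMap]
      rfl
    refine Filter.Tendsto.congr (fun k => (e1 k).symm) ?_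
    exact hc.trans_eq (congrArg _ e2.symm)
  have h4 := (hν.tendsto _).comp h3
  have h5 : ν ∘ γ = fun _ => ν (leviExp X) * ν (leviExp Y) := funext h1
  rw [h5] at h4
  exact (tendsto_nhds_unique tendsto_const_nhds h4).symm

theorem contDiff_character_leviExp {ν : G.levi h →* ℂˣ} (hν : Continuous ν) {n : ℕ}
    (X : EuclideanSpace ℝ (Fin n) →ₗ[ℝ] G.gradedPart h 0) :
    ContDiff ℝ ∞ fun t => (ν (leviExp (X t)) : ℂ) := by
  refine contDiff_of_continuous_of_map_add ?_ (fun s t => ?_) ?_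
  · have hX : Continuous X := X.continuous_of_finiteDimensional
    exact Units.continuous_val.comp (hν.comp (continuous_leviExp.comp hX))
  · rw [map_add, map_leviExp_add hν, Units.val_mul]
  · rw [map_zero, leviExp_zero, map_one, Units.val_one]

end Topology

/-- The action of an element of the Levi subgroup on `𝔫̄` as a linear automorphism. -/
def leviEquiv (m : G.levi h) : G.nilBar h ≃ₗ[ℝ] G.nilBar h where
  toFun y := m • y
  invFun y := m⁻¹ • y
  left_inv y := inv_smul_smul m y
  right_inv y := smul_inv_smul m y
  map_add' y z := by
    apply Subtype.ext
    apply Subtype.ext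
    change ((m : G.realPoints) : Matrix (Fin d) (Fin d) ℝ) * (nilBarMatrix h y + nilBarMatrix h z) *
        (((m : G.realPoints)⁻¹ : G.realPoints) : Matrix (Fin d) (Fin d) ℝ) =
      ((m : G.realPoints) : Matrix (Fin d) (Fin d) ℝ) * nilBarMatrix h y *
        (((m : G.realPoints)⁻¹ : G.realPoints) : Matrix (Fin d) (Fin d) ℝ) +
      ((m : G.realPoints) : Matrix (Fin d) (Fin d) ℝ) * nilBarMatrix h z *
        (((m : G.realPoints)⁻¹ : G.realPoints) : Matrix (Fin d) (Fin d) ℝ)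
    rw [mul_add, add_mul]
  map_smul' a y := Subtype.ext (smul_real G _ a _)

theorem smul_mem_gradedPart_zero (m : G.levi h) {X : G.lieAlgebra} (hX : X ∈ G.gradedPart h 0) :
    (m : G.realPoints) • X ∈ G.gradedPart h 0 := by
  have hm : (m : G.realPoints) • h = h := MulAction.mem_stabilizer_iff.1 m.2
  have e := smul_lie G (m : G.realPoints) h X
  rw [hm, (mem_gradedPart G).1 hX, smul_real] at e
  exact (mem_gradedPart G).2 e.symm

/-- The tangent spaces `[𝔪, z]` of an orbit have the same dimension at all of its points. -/
theorem finrank_range_leviLie_smul (m : G.levi h) (y : G.nilBar h) :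
    Module.finrank ℝ (LinearMap.range ((leviLie h).flip (m • y))) =
      Module.finrank ℝ (LinearMap.range ((leviLie h).flip y)) := by
  have h1 : LinearMap.range ((leviLie h).flip (m • y)) =
      (LinearMap.range ((leviLie h).flip y)).map (leviEquiv m).toLinearMap := by
    have h2 : ∀ (m : G.levi h) (y : G.nilBar h) (X : G.gradedPart h 0),
        m • leviLie h X y = leviLie h ⟨_, smul_mem_gradedPart_zero m X.2⟩ (m • y) := fun m y X =>
      Subtype.ext (smul_lie G _ _ _)
    ext z
    constructor
    · rintro ⟨X, rfl⟩
      refine ⟨_, ⟨⟨_, smul_mem_gradedPart_zero m⁻¹ X.2⟩, rfl⟩, ?_⟩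
      change m • leviLie h _ y = leviLie h X (m • y)
      rw [h2]
      congr 2
      exact Subtype.ext (smul_inv_smul (m : G.realPoints) (X : G.lieAlgebra))
    · rintro ⟨_, ⟨X, rfl⟩, rfl⟩
      exact ⟨⟨_, smul_mem_gradedPart_zero m X.2⟩, (h2 m y X).symm⟩
  rw [h1]
  exact (leviEquiv m).finrank_map_eq _

end RealAlgebraicGroup

/-! ### Exponential charts of the orbits -/

theorem exists_linear_lift_of_range {E V : Type*} [AddCommGroup E] [Module ℝ E] [AddCommGroup V]
    [Module ℝ V] [FiniteDimensional ℝ V] (L : E →ₗ[ℝ] V) :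
    ∃ (n : ℕ) (X : EuclideanSpace ℝ (Fin n) →ₗ[ℝ] E), Function.Injective (L ∘ₗ X) ∧
      n = Module.finrank ℝ (LinearMap.range L) := by
  obtain ⟨r, hr⟩ := L.rangeRestrict.exists_rightInverse_of_surjective L.range_rangeRestrict
  let e : EuclideanSpace ℝ (Fin (Module.finrank ℝ (LinearMap.range L))) ≃ₗ[ℝ] LinearMap.range L :=
    LinearEquiv.ofFinrankEq _ _ (by simp)
  refine ⟨_, r ∘ₗ e.toLinearMap, fun s t hst => e.injective (Subtype.ext ?_), rfl⟩
  have h1 : ∀ s, L (r (e s)) = e s := fun s =>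
    congrArg Subtype.val (LinearMap.congr_fun hr (e s))
  rw [← h1 s, ← h1 t]
  exact hst

theorem exists_norm_bilinear_self_le {V : Type*} [NormedAddCommGroup V] [NormedSpace ℝ V]
    [FiniteDimensional ℝ V] (B : V →ₗ[ℝ] V →ₗ[ℝ] V) : ∃ C : ℝ, ∀ u, ‖B u u‖ ≤ C * ‖u‖ ^ 2 := by
  obtain ⟨A, hA⟩ := exists_continuous_bilinear B
  refine ⟨‖A‖, fun u => ?_⟩
  rw [← hA, pow_two, ← mul_assoc]
  exact A.le_opNorm₂ u u

namespace RealAlgebraicGroup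

variable {d : ℕ} {G : RealAlgebraicGroup d} {h : G.lieAlgebra}

theorem hasFDerivAt_leviExp_smul {P : Type*} [NormedAddCommGroup P] [NormedSpace ℝ P]
    [FiniteDimensional ℝ P] (X : P →ₗ[ℝ] G.gradedPart h 0) (y : G.nilBar h) {A : P →L[ℝ] G.nilBar h}
    (hA : ∀ τ, A τ = leviLie h (X τ) y) : HasFDerivAt (fun t => leviExp (X t) • y) A 0 := by
  refine hasFDerivAt_zero_of_lines (W := G.nilBar h) ?_ fun τ => ?_
  · have h1 : ContDiff ℝ 1 fun t => leviExp (X t) • y :=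
      ContDiff.comp (g := fun q : P × G.nilBar h => leviExp (X q.1) • q.2) (f := fun t => (t, y))
        (contDiff_leviExp_smul X (n := 1)) (contDiff_id.prodMk contDiff_const)
    exact h1.differentiable (by simp) 0
  · refine ((hasDerivAt_leviExp_smul (X τ) y).congr_deriv (hA τ).symm).congr_of_eventuallyEq ?_
    exact Filter.Eventually.of_forall fun s => by
      change leviExp (X (s • τ)) • y = leviExp (s • X τ) • y
      rw [map_smul]

/-- Exponential coordinates on a complement of the stabilizer of `y` in `𝔪` are coordinates of the orbit of
`y` near `y`: every point of the orbit that is close to `y` in `𝔫̄` is `exp X • y` for a small `X`. -/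
theorem IsGradingElement.exists_orbit_chart (hgrad : G.IsGradingElement h)
    (hK : LieAlgebra.IsKilling ℝ G.lieAlgebra) {x₀ y : G.nilBar h}
    (hy : y ∈ MulAction.orbit (G.levi h) x₀) :
    ∃ (n : ℕ) (X : EuclideanSpace ℝ (Fin n) →ₗ[ℝ] G.gradedPart h 0)
      (c : G.nilBar h → EuclideanSpace ℝ (Fin n)), ContDiffAt ℝ ω c y ∧ c y = 0 ∧
      (∀ᶠ z in 𝓝 y, z ∈ MulAction.orbit (G.levi h) x₀ → leviExp (X (c z)) • y = z) ∧
      ∀ᶠ t in 𝓝 0, c (leviExp (X t) • y) = t := by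
  have hX := exists_linear_lift_of_range ((leviLie h).flip y)
  rcases hX with ⟨n, X, hX, hn⟩
  have hA : ∃ A : G.nilBar h →L[ℝ] EuclideanSpace ℝ (Fin n) →L[ℝ] G.nilBar h,
      ∀ z τ, A z τ = leviLie h (X τ) z :=
    exists_continuous_bilinear (V := G.nilBar h) ((leviLie h ∘ₗ X).flip)
  rcases hA with ⟨A, hA'⟩
  have hinj : Function.Injective (A y) := fun s t hst => hX <| by
    rw [hA', hA'] at hst
    exact hst
  have hS := Submodule.exists_isCompl (LinearMap.range (A y : EuclideanSpace ℝ (Fin n) →ₗ[ℝ] G.nilBar h))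
  rcases hS with ⟨S, hS⟩
  have he := hgrad.exists_transversal hK y.2
  rcases he with ⟨e, he⟩
  let Q : G.nilBar h →ₗ[ℝ] G.nilBar h →ₗ[ℝ] G.nilBar h :=
    leviLie h ∘ₗ LinearMap.codRestrict (G.gradedPart h 0)
      ((LieAlgebra.ad ℝ G.lieAlgebra e : G.lieAlgebra →ₗ[ℝ] G.lieAlgebra) ∘ₗ (G.nilBar h).subtype)
      fun u => (he u u.2).1
  have hC := exists_norm_bilinear_self_le (V := G.nilBar h) Q
  rcases hC with ⟨C, hC⟩
  have hSΩ := eventually_eq_zero_of_transversal (V := G.nilBar h) (A := A) (y := y) hS.disjoint hinj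
    (O := fun z => LinearMap.range ((leviLie h).flip z)) (Ω := MulAction.orbit (G.levi h) x₀)
    (fun z τ => ⟨X τ, (hA' z τ).symm⟩)
    (by
      have h1 : ∀ z ∈ MulAction.orbit (G.levi h) x₀,
          Module.finrank ℝ (LinearMap.range ((leviLie h).flip z)) =
            Module.finrank ℝ (LinearMap.range ((leviLie h).flip x₀)) := by
        rintro _ ⟨m, rfl⟩
        exact finrank_range_leviLie_smul m x₀
      intro z hz
      rw [h1 z hz, ← h1 y hy, finrank_euclideanSpace_fin, hn])
    (Q := fun u => Q u u) hC
    (fun u => by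
      have hu := (he u u.2).2
      rcases hu with ⟨W, hW, hWu⟩
      exact ⟨⟨W, hW⟩, (Subtype.ext hWu).symm⟩)
  have hd := hasFDerivAt_leviExp_smul X y (hA' y)
  have hchart := exists_chart (V := G.nilBar h) (p := fun q => leviExp (X q.1) • q.2)
    (contDiff_leviExp_smul X) (fun z => by simp only [map_zero, leviExp_zero, one_smul])
    (fun t z => by simp only [map_neg, leviExp_neg, inv_smul_smul])
    (Ω := MulAction.orbit (G.levi h) x₀)
    (fun t z hz => by
      rw [← MulAction.orbit_eq_iff] at hz ⊢
      rw [MulAction.orbit_smul, hz]) hd hinj hS hSΩ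
  rcases hchart with ⟨c, hc⟩
  exact ⟨_, X, c, hc⟩

end RealAlgebraicGroup

/-! ### Smooth representatives of smooth vectors -/

theorem measure_preimage_smul_eq_zero_iff {M X : Type*} [Group M] [MulAction M X] [MeasurableSpace X]
    {μ : Measure X} (hmeas : ∀ m : M, Measurable fun x : X => m • x) {k : M → ENNReal}
    (hμ : ∀ (m : M) (E : Set X), MeasurableSet E → μ ((fun x => m • x) '' E) = k m * μ E)
    (m : M) {E : Set X} (hE : MeasurableSet E) : μ ((fun x => m • x) ⁻¹' E) = 0 ↔ μ E = 0 := by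
  constructor <;> intro h0
  · have e : E = (fun x => m • x) '' ((fun x => m • x) ⁻¹' E) :=
      (Set.image_preimage_eq E (MulAction.surjective m)).symm
    rw [e, hμ m _ (hmeas m hE), h0, mul_zero]
  · have e : (fun x => m • x) ⁻¹' E = (fun x => m⁻¹ • x) '' E := by
      ext x
      exact ⟨fun hx => ⟨m • x, hx, inv_smul_smul m x⟩, by
        rintro ⟨y, hy, rfl⟩
        change m • m⁻¹ • y ∈ E
        rwa [smul_inv_smul]⟩
    rw [e, hμ _ _ hE, h0, mul_zero]

/-- If the representatives of all elements of a family `S` of functions, stable under translation up to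
scalars, vanish at one point of a homogeneous space, then `S` contains only the zero function. -/
theorem eq_zero_of_forall_apply_eq_zero {M X : Type*} [Group M] [MulAction M X]
    [MulAction.IsPretransitive M X] [TopologicalSpace X] [MeasurableSpace X] [BorelSpace X]
    {μ : Measure X} [μ.IsOpenPosMeasure] (hcont : ∀ m : M, Continuous fun x : X => m • x)
    (hqi : ∀ (m : M) (E : Set X), MeasurableSet E → μ E = 0 → μ ((fun x => m • x) ⁻¹' E) = 0)
    {S : Set (Lp ℂ 2 μ)} {C : Set (X → ℂ)} (hC : ∀ f ∈ C, Continuous f)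
    (hrep : ∀ v ∈ S, ∃ f ∈ C, v =ᵐ[μ] f) {χ : M → ℂ} (hχ : ∀ m, χ m ≠ 0)
    (htrans : ∀ (m : M), ∀ v ∈ S, ∃ w ∈ S, w =ᵐ[μ] fun y => χ m * v (m⁻¹ • y))
    {x : X} (hx : ∀ v ∈ S, ∀ f ∈ C, v =ᵐ[μ] f → f x = 0) {v : Lp ℂ 2 μ} (hv : v ∈ S) : v = 0 := by
  obtain ⟨f, hfC, hf⟩ := hrep v hv
  have hf0 : ∀ z, f z = 0 := fun z => by
    obtain ⟨m, rfl⟩ := MulAction.exists_smul_eq M x z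
    obtain ⟨w, hwS, hw⟩ := htrans m⁻¹ v hv
    rw [inv_inv] at hw
    obtain ⟨f', hfC', hf'⟩ := hrep w hwS
    have hm : Measure.QuasiMeasurePreserving (fun y : X => m • y) μ μ :=
      ⟨(hcont m).measurable, Measure.AbsolutelyContinuous.mk fun E hE h0 => by
        rw [Measure.map_apply (hcont m).measurable hE]
        exact hqi m E hE h0⟩
    have h5 : f' = fun y => χ m⁻¹ * f (m • y) := by
      refine Measure.eq_of_ae_eq (μ := μ) ?_ (hC f' hfC')
        (continuous_const.mul ((hC f hfC).comp (hcont m)))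
      filter_upwards [hf', hw, hm.ae_eq_comp hf] with y hy1 hy2 hy3
      rw [← hy1, hy2]
      exact congrArg _ hy3
    have h6 := hx w hwS f' hfC' hf'
    rw [h5] at h6
    exact (mul_eq_zero.1 h6).resolve_left (hχ _)
  refine Lp.eq_zero_iff_ae_eq_zero.2 ?_
  filter_upwards [hf] with z hz
  rw [hz, hf0]
  rfl

theorem secondCountableTopology_of_finiteDimensional {V : Type*} [NormedAddCommGroup V]
    [NormedSpace ℝ V] [FiniteDimensional ℝ V] (Ω : Set V) : SecondCountableTopology Ω := by
  have := FiniteDimensional.proper ℝ V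
  infer_instance

namespace RealAlgebraicGroup

variable {d : ℕ} {G : RealAlgebraicGroup d} {h : G.lieAlgebra}

section Topology

attribute [local instance] Matrix.linftyOpNormedRing Matrix.linftyOpNormedAlgebra

theorem contDiff_rep_leviExp {n : ℕ} (X : EuclideanSpace ℝ (Fin n) →ₗ[ℝ] G.gradedPart h 0)
    {Ω : Type*} [MeasurableSpace Ω] {μ : Measure Ω} {π : G.realPoints →* (Lp ℂ 2 μ ≃ₗᵢ[ℂ] Lp ℂ 2 μ)}
    {v : Lp ℂ 2 μ} (hv : v ∈ smoothVectors π) :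
    @ContDiff ℝ _ _ _ _ (Lp ℂ 2 μ) _ NormedSpace.complexToReal ∞
      fun t => π (leviExp (X t) : G.realPoints) v := by
  have hX : ContDiff ℝ ∞ ((G.gradedPart h 0).subtype ∘ₗ X) :=
    (LinearMap.toContinuousLinearMap ((G.gradedPart h 0).subtype ∘ₗ X)).contDiff
  exact contDiff_rep hv (γ := fun t => G.expMap ((G.gradedPart h 0).subtype (X t)))
    (contDiff_toMatrix_expMap.comp hX)

end Topology

theorem continuous_levi_smul (m : G.levi h) : Continuous fun y : G.nilBar h => m • y := by
  have := (leviEquiv m).toLinearMap.continuous_of_finiteDimensional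
  exact this

variable {x₀ : G.nilBar h}

theorem continuous_orbit_smul (m : G.levi h) :
    Continuous fun y : MulAction.orbit (G.levi h) x₀ => m • y :=
  Continuous.subtype_mk ((continuous_levi_smul m).comp continuous_subtype_val) _

variable [MeasurableSpace (MulAction.orbit (G.levi h) x₀)] [BorelSpace (MulAction.orbit (G.levi h) x₀)]
  {μ : Measure (MulAction.orbit (G.levi h) x₀)} {ν : G.levi h →* ℂˣ}

theorem measure_preimage_levi_smul_eq_zero_iff
    (hμν : ∀ (m : G.levi h) (E : Set (MulAction.orbit (G.levi h) x₀)), MeasurableSet E →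
      μ ((fun y => m • y) '' E) = ENNReal.ofReal ((‖(ν m : ℂ)‖ ^ 2)⁻¹) * μ E)
    (m : G.levi h) {E : Set (MulAction.orbit (G.levi h) x₀)} (hE : MeasurableSet E) :
    μ ((fun y => m • y) ⁻¹' E) = 0 ↔ μ E = 0 :=
  measure_preimage_smul_eq_zero_iff (fun m => (continuous_orbit_smul m).measurable) hμν m hE

theorem isOpenPosMeasure_orbit (hμ : μ ≠ 0)
    (hμν : ∀ (m : G.levi h) (E : Set (MulAction.orbit (G.levi h) x₀)), MeasurableSet E →
      μ ((fun y => m • y) '' E) = ENNReal.ofReal ((‖(ν m : ℂ)‖ ^ 2)⁻¹) * μ E) :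
    μ.IsOpenPosMeasure := by
  have : SecondCountableTopology (MulAction.orbit (G.levi h) x₀) :=
    secondCountableTopology_of_finiteDimensional (V := G.nilBar h) _
  exact isOpenPosMeasure_of_isPretransitive hμ (continuous_orbit_smul (x₀ := x₀)) fun m O hO h0 =>
    (measure_preimage_levi_smul_eq_zero_iff hμν m hO.measurableSet).2 h0

variable {π : G.realPoints →* (Lp ℂ 2 μ ≃ₗᵢ[ℂ] Lp ℂ 2 μ)}

set_option maxHeartbeats 1000000 in
theorem exists_local_smooth_representative_orbit [SigmaFinite μ] [μ.IsOpenPosMeasure]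
    (hgrad : G.IsGradingElement h)
    (hK : LieAlgebra.IsKilling ℝ G.lieAlgebra) (hν : Continuous ν)
    (hμν : ∀ (m : G.levi h) (E : Set (MulAction.orbit (G.levi h) x₀)), MeasurableSet E →
      μ ((fun y => m • y) '' E) = ENNReal.ofReal ((‖(ν m : ℂ)‖ ^ 2)⁻¹) * μ E)
    (hπM : ∀ (m : G.levi h) (f : Lp ℂ 2 μ),
      π (m : G.realPoints) f =ᵐ[μ] fun y => (ν m : ℂ) * f (m⁻¹ • y))
    {v : Lp ℂ 2 μ} (hv : v ∈ smoothVectors π) {y : G.nilBar h}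
    (hy : y ∈ MulAction.orbit (G.levi h) x₀) :
    ∃ F : G.nilBar h → ℂ, ContDiff ℝ ∞ F ∧ ∃ U ∈ 𝓝 y,
      ∀ᵐ z : MulAction.orbit (G.levi h) x₀ ∂μ, (z : G.nilBar h) ∈ U → v z = F z := by
  have hB : BorelSpace (MulAction.orbit (G.levi h) x₀) := inferInstance
  have hpos : μ.IsOpenPosMeasure := inferInstance
  have hchart := hgrad.exists_orbit_chart hK hy
  rcases hchart with ⟨n, X, c, hc, hc0, hcΩ, hct⟩
  have hpΩ : ∀ (t : EuclideanSpace ℝ (Fin n)), ∀ z ∈ MulAction.orbit (G.levi h) x₀,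
      leviExp (X t) • z ∈ MulAction.orbit (G.levi h) x₀ := fun t z hz =>
    (leviExp (X t) • (⟨z, hz⟩ : MulAction.orbit (G.levi h) x₀)).2
  have hqi : ∀ (t : EuclideanSpace ℝ (Fin n)) (E : Set (MulAction.orbit (G.levi h) x₀)),
      MeasurableSet E → μ {z | (⟨leviExp (X t) • (z : G.nilBar h), hpΩ t z z.2⟩ :
        MulAction.orbit (G.levi h) x₀) ∈ E} = 0 → μ E = 0 := fun t E hE =>
    (measure_preimage_levi_smul_eq_zero_iff hμν (leviExp (X t)) hE).1
  have huv : ∀ t : EuclideanSpace ℝ (Fin n), (π (leviExp ((-X) t) : G.realPoints) v : Lp ℂ 2 μ) =ᵐ[μ]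
      fun z => (ν (leviExp ((-X) t)) : ℂ) * v ⟨leviExp (X t) • (z : G.nilBar h), hpΩ t z z.2⟩ :=
    fun t => by
      have h1 := hπM (leviExp ((-X) t)) v
      have h2 : (leviExp ((-X) t))⁻¹ = leviExp (X t) := by
        rw [← leviExp_neg, LinearMap.neg_apply, neg_neg]
      rw [h2] at h1
      exact h1
  have hu := contDiff_rep_leviExp (-X) hv
  have hχ := contDiff_character_leviExp hν (-X)
  have hχ0 : ∀ t, (ν (leviExp ((-X) t)) : ℂ) ≠ 0 := fun t => (ν (leviExp ((-X) t))).ne_zero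
  have hp0 : ∀ z : G.nilBar h, leviExp (X 0) • z = z := fun z => by
    rw [map_zero, leviExp_zero, one_smul]
  have hpneg : ∀ (t : EuclideanSpace ℝ (Fin n)) (z : G.nilBar h),
      leviExp (X (-t)) • leviExp (X t) • z = z := fun t z => by
    rw [map_neg, leviExp_neg, inv_smul_smul]
  have hp := contDiff_leviExp_smul (n := ω) X
  exact @exists_local_smooth_representative (G.nilBar h) _ _ _ _ _ hB μ hpos n _
    (fun q => leviExp (X q.1) • q.2) hp hp0 hpneg hpΩ hqi y c hc hc0 hcΩ hct hy v _ hu _ hχ hχ0 huv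

/-- Every smooth vector is represented by a smooth function: along the action of `𝔪` it is smooth, and the
coordinates of the orbit are given by this action. -/
theorem exists_smoothFunctions_ae_eq [SigmaFinite μ] [μ.IsOpenPosMeasure]
    (hgrad : G.IsGradingElement h)
    (hK : LieAlgebra.IsKilling ℝ G.lieAlgebra) (hν : Continuous ν)
    (hμν : ∀ (m : G.levi h) (E : Set (MulAction.orbit (G.levi h) x₀)), MeasurableSet E →
      μ ((fun y => m • y) '' E) = ENNReal.ofReal ((‖(ν m : ℂ)‖ ^ 2)⁻¹) * μ E)
    (hπM : ∀ (m : G.levi h) (f : Lp ℂ 2 μ),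
      π (m : G.realPoints) f =ᵐ[μ] fun y => (ν m : ℂ) * f (m⁻¹ • y))
    {v : Lp ℂ 2 μ} (hv : v ∈ smoothVectors π) :
    ∃ f : smoothFunctions (MulAction.orbit (G.levi h) x₀),
      v =ᵐ[μ] (f : MulAction.orbit (G.levi h) x₀ → ℂ) := by
  have hB : BorelSpace (MulAction.orbit (G.levi h) x₀) := inferInstance
  have hpos : μ.IsOpenPosMeasure := inferInstance
  have hloc := fun y : MulAction.orbit (G.levi h) x₀ =>
    exists_local_smooth_representative_orbit hgrad hK hν hμν hπM hv y.2
  exact @exists_smoothFunctions_ae_eq_of_local (G.nilBar h) _ _ _ _ _ hB μ hpos _ hloc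

end RealAlgebraicGroup

/-! ### Functionals compatible with multiplication by test functions -/

section LocalFunctional

variable {V : Type*} [NormedAddCommGroup V] [NormedSpace ℝ V] [FiniteDimensional ℝ V] {Ω : Set V}

/-- Take a bump function at `x` for `F`, and `K = F f / f₀`. -/
theorem exists_testFunction_mul_eq {f f₀ : Ω → ℂ} (hf : f ∈ smoothFunctions Ω)
    (hf₀ : f₀ ∈ smoothFunctions Ω) {x : Ω} (hx : f₀ x ≠ 0) :
    ∃ F K : V → ℂ, ContDiff ℝ ∞ F ∧ HasCompactSupport F ∧ ContDiff ℝ ∞ K ∧ HasCompactSupport K ∧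
      F x = 1 ∧ K x = f x / f₀ x ∧ ∀ z : Ω, F z * f z = K z * f₀ z := by
  obtain ⟨U, hU, A, hA, hAf⟩ := hf x
  obtain ⟨U₀, hU₀, A₀, hA₀, hAf₀⟩ := hf₀ x
  have hx₀ : A₀ x ≠ 0 := by rwa [← hAf₀ x (mem_of_mem_nhds hU₀)]
  have hN : U ∩ U₀ ∩ {w | A₀ w ≠ 0} ∈ 𝓝 (x : V) :=
    Filter.inter_mem (Filter.inter_mem hU hU₀)
      ((isOpen_ne.preimage hA₀.continuous).mem_nhds hx₀)
  obtain ⟨ε, hε, hεN⟩ := Metric.nhds_basis_closedBall.mem_iff.1 hN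
  let ρ : ContDiffBump (x : V) := ⟨ε / 2, ε, by positivity, by linarith⟩
  have hρx : ρ x = 1 := ρ.one_of_mem_closedBall (Metric.mem_closedBall_self ρ.rIn_pos.le)
  refine ⟨fun w => ρ w • 1, fun w => ρ w • (A w / A₀ w),
    contDiff_bump_smul ρ fun _ _ => contDiffAt_const, ρ.hasCompactSupport.smul_right,
    contDiff_bump_smul ρ fun w hw => by
      simp only [div_eq_mul_inv]
      exact hA.contDiffAt.mul (hA₀.contDiffAt.inv (hεN hw).2),
    ρ.hasCompactSupport.smul_right, ?_, ?_, fun z => ?_⟩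
  · simp only [hρx, one_smul]
  · simp only [hρx, one_smul]
    rw [hAf x (mem_of_mem_nhds hU), hAf₀ x (mem_of_mem_nhds hU₀)]
  · by_cases hz : (z : V) ∈ Metric.closedBall (x : V) ε
    · have hz' := hεN hz
      have hz0 : A₀ z ≠ 0 := hz'.2
      simp only [Complex.real_smul]
      rw [hAf z hz'.1.1, hAf₀ z hz'.1.2]
      field_simp
    · have : ρ z = 0 := ρ.zero_of_le_dist (not_le.1 fun h => hz (Metric.mem_closedBall.2 h)).le
      simp only [this, zero_smul, zero_mul]

variable [MeasurableSpace Ω] {μ : Measure Ω} {S : Submodule ℂ (Lp ℂ 2 μ)} {ℓ : S →ₗ[ℂ] ℂ}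
  {x : V}

theorem eq_zero_of_notMem_closure
    (hmul : ∀ F : V → ℂ, ContDiff ℝ ∞ F → HasCompactSupport F → ∀ v : S, ∃ w : S,
      (w : Lp ℂ 2 μ) =ᵐ[μ] (fun y => F y * (v : Lp ℂ 2 μ) y) ∧ ℓ w = F x * ℓ v)
    (hx : x ∉ closure Ω) : ℓ = 0 := by
  obtain ⟨f, hfs, hfc, hf, -, hfx⟩ := exists_contDiff_tsupport_subset (n := ⊤)
    (isClosed_closure.isOpen_compl.mem_nhds hx)
  refine LinearMap.ext fun v => ?_
  obtain ⟨w, hw, hℓ⟩ := hmul (fun y => (f y : ℂ)) (Complex.ofRealCLM.contDiff.comp hf)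
    (hfc.comp_left (g := fun r : ℝ => (r : ℂ)) Complex.ofReal_zero) v
  have hw0 : w = 0 := by
    refine Subtype.ext (Lp.eq_zero_iff_ae_eq_zero.2 ?_)
    filter_upwards [hw] with y hy
    rw [hy, image_eq_zero_of_notMem_tsupport fun h => hfs h (subset_closure y.2), Complex.ofReal_zero,
      zero_mul]
    rfl
  rw [hw0, map_zero, hfx, Complex.ofReal_one, one_mul] at hℓ
  exact hℓ.symm

/-- Multiplication by test functions allows to compare the values of `ℓ` at two elements `v`, `v₀` whose
representatives differ near `x` by a smooth factor. -/
theorem exists_eq_mul_apply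
    (hmul : ∀ F : V → ℂ, ContDiff ℝ ∞ F → HasCompactSupport F → ∀ v : S, ∃ w : S,
      (w : Lp ℂ 2 μ) =ᵐ[μ] (fun y => F y * (v : Lp ℂ 2 μ) y) ∧ ℓ w = F x * ℓ v)
    (hx : x ∈ Ω)
    (h0 : (∀ v ∈ S, ∀ f : smoothFunctions Ω, v =ᵐ[μ] (f : Ω → ℂ) → (f : Ω → ℂ) ⟨x, hx⟩ = 0) →
      ∀ v ∈ S, v = 0) :
    ∃ a : ℂ, ∀ (v : S) (f : smoothFunctions Ω), (v : Lp ℂ 2 μ) =ᵐ[μ] (f : Ω → ℂ) →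
      ℓ v = a * (f : Ω → ℂ) ⟨x, hx⟩ := by
  by_cases hall : ∀ v ∈ S, ∀ f : smoothFunctions Ω, v =ᵐ[μ] (f : Ω → ℂ) → (f : Ω → ℂ) ⟨x, hx⟩ = 0
  · refine ⟨0, fun v f _ => ?_⟩
    rw [show v = 0 from Subtype.ext (h0 hall v v.2), map_zero, zero_mul]
  · push Not at hall
    obtain ⟨v₀, hv₀, f₀, hvf₀, hf₀x⟩ := hall
    refine ⟨ℓ ⟨v₀, hv₀⟩ / (f₀ : Ω → ℂ) ⟨x, hx⟩, fun v f hvf => ?_⟩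
    obtain ⟨F, K, hF, hFc, hK, hKc, hFx, hKx, hFK⟩ := exists_testFunction_mul_eq f.2 f₀.2 hf₀x
    obtain ⟨w, hw, hℓw⟩ := hmul F hF hFc v
    obtain ⟨w₀, hw₀, hℓw₀⟩ := hmul K hK hKc ⟨v₀, hv₀⟩
    have e : w = w₀ := by
      refine Subtype.ext (Lp.ext ?_)
      filter_upwards [hw, hw₀, hvf, hvf₀] with z h1 h2 h3 h4
      rw [h1, h2, h3, hFK]
      exact congrArg _ h4.symm
    rw [← one_mul (ℓ v), ← hFx, ← hℓw, e, hℓw₀, hKx]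
    ring

end LocalFunctional

end

theorem mainTheorem5 {d : ℕ} (G : RealAlgebraicGroup d)
    (hsc : SimplyConnectedSpace G.complexPoints)
    (hsimple : LieAlgebra.IsSimple ℂ (ℂ ⊗[ℝ] G.lieAlgebra))
    (h : G.lieAlgebra) (hgrad : G.IsGradingElement h)
    (hopp : ∃ w : G.realPoints,
      (G.parabolic h).map (MulAut.conj w).toMonoidHom = G.oppositeParabolic h)
    (c : ℝ) (hc : c ≠ 0)
    (x₀ : G.nilBar h)
    [MeasurableSpace (MulAction.orbit (G.levi h) x₀)]
    [BorelSpace (MulAction.orbit (G.levi h) x₀)]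
    (μ : Measure (MulAction.orbit (G.levi h) x₀)) [IsLocallyFiniteMeasure μ] (hμ : μ ≠ 0)
    (ν : G.levi h →* ℂˣ) (hν : Continuous ν)
    (hμν : ∀ (m : G.levi h) (E : Set (MulAction.orbit (G.levi h) x₀)), MeasurableSet E →
      μ ((fun y => m • y) '' E) = ENNReal.ofReal ((‖(ν m : ℂ)‖ ^ 2)⁻¹) * μ E)
    (π : G.realPoints →* (Lp ℂ 2 μ ≃ₗᵢ[ℂ] Lp ℂ 2 μ))
    (hπ : ∀ f : Lp ℂ 2 μ, Continuous fun g => π g f)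
    (hπM : ∀ (m : G.levi h) (f : Lp ℂ 2 μ),
      π (m : G.realPoints) f =ᵐ[μ] fun y => (ν m : ℂ) * f (m⁻¹ • y))
    (hπN : ∀ X ∈ G.nil h, ∀ f : Lp ℂ 2 μ, π (G.expMap X) f =ᵐ[μ] fun y =>
      Complex.exp (Complex.I * (G.pairing c X ((y : G.nilBar h) : G.lieAlgebra) : ℝ)) * f y)
    (hD : ∀ X : G.lieAlgebra,
      ∃ D : smoothFunctions (MulAction.orbit (G.levi h) x₀) →ₗ[ℂ]
          smoothFunctions (MulAction.orbit (G.levi h) x₀),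
        IsDifferentialOperator D ∧ IsAntisymmetric μ D ∧
        ∀ v ∈ RealAlgebraicGroup.smoothVectors π,
          ∀ f : smoothFunctions (MulAction.orbit (G.levi h) x₀),
            v =ᵐ[μ] (f : MulAction.orbit (G.levi h) x₀ → ℂ) →
            (RealAlgebraicGroup.dRep π X v : Lp ℂ 2 μ) =ᵐ[μ] (D f : MulAction.orbit (G.levi h) x₀ → ℂ)) :
    (∀ v ∈ RealAlgebraicGroup.smoothVectors π,
      ∃! f : smoothFunctions (MulAction.orbit (G.levi h) x₀),
        v =ᵐ[μ] (f : MulAction.orbit (G.levi h) x₀ → ℂ)) ∧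
    ∀ (x : G.nilBar h) (ℓ : RealAlgebraicGroup.smoothVectors π →ₗ[ℂ] ℂ),
      Continuous[RealAlgebraicGroup.smoothTopology π, inferInstance] ℓ →
      (∀ X ∈ G.nil h, ∀ v : RealAlgebraicGroup.smoothVectors π,
        ℓ (RealAlgebraicGroup.smoothRep π (G.expMap X) v) =
          Complex.exp (Complex.I * (G.pairing c X (x : G.lieAlgebra) : ℝ)) * ℓ v) →
      (x ∉ closure (MulAction.orbit (G.levi h) x₀) → ℓ = 0) ∧
      (∀ hx : x ∈ MulAction.orbit (G.levi h) x₀, ∃ a : ℂ,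
        ∀ (v : RealAlgebraicGroup.smoothVectors π)
          (f : smoothFunctions (MulAction.orbit (G.levi h) x₀)),
          (v : Lp ℂ 2 μ) =ᵐ[μ] (f : MulAction.orbit (G.levi h) x₀ → ℂ) →
          ℓ v = a * (f : MulAction.orbit (G.levi h) x₀ → ℂ) ⟨x, hx⟩) := by
  have hK := G.isKilling_of_isSimple hsimple
  have hpos := RealAlgebraicGroup.isOpenPosMeasure_orbit hμ hμν
  have hsec : SecondCountableTopology (MulAction.orbit (G.levi h) x₀) :=
    secondCountableTopology_of_finiteDimensional (V := G.nilBar h) _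
  have hσ : SigmaFinite μ := sigmaFinite_of_locallyFinite
  have hrep : ∀ v ∈ RealAlgebraicGroup.smoothVectors π,
      ∃ f : smoothFunctions (MulAction.orbit (G.levi h) x₀),
        v =ᵐ[μ] (f : MulAction.orbit (G.levi h) x₀ → ℂ) := fun v hv =>
    RealAlgebraicGroup.exists_smoothFunctions_ae_eq hgrad hK hν hμν hπM hv
  have hcont : ∀ f ∈ (smoothFunctions (MulAction.orbit (G.levi h) x₀) :
      Set (MulAction.orbit (G.levi h) x₀ → ℂ)), Continuous f := fun f hf =>
    continuous_of_mem_smoothFunctions (V := G.nilBar h) hf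
  refine ⟨fun v hv => ?_, fun x ℓ hℓ hequiv => ?_⟩
  · have hf := hrep v hv
    rcases hf with ⟨f, hf⟩
    exact ⟨f, hf, fun f' hf' => Subtype.ext
      (Measure.eq_of_ae_eq (hf'.symm.trans hf) (hcont f' f'.2) (hcont f f.2))⟩
  have hmul : ∀ F : G.nilBar h → ℂ, ContDiff ℝ ∞ F → HasCompactSupport F →
      ∀ v : RealAlgebraicGroup.smoothVectors π, ∃ w : RealAlgebraicGroup.smoothVectors π,
        (w : Lp ℂ 2 μ) =ᵐ[μ] (fun y => F y * (v : Lp ℂ 2 μ) y) ∧ ℓ w = F x * ℓ v :=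
    fun F hF hFc v => by
      have hw := RealAlgebraicGroup.exists_mul_testFunction hgrad hK hc hπ hπN hF hFc v
      rcases hw with ⟨w, hw, hwℓ⟩
      exact ⟨w, hw, hwℓ x ℓ hℓ hequiv⟩
  refine ⟨fun hx => eq_zero_of_notMem_closure (V := G.nilBar h) hmul hx, fun hx =>
    exists_eq_mul_apply (V := G.nilBar h) hmul hx fun h0 v hv => ?_⟩
  refine eq_zero_of_forall_apply_eq_zero (M := G.levi h)
    (S := (RealAlgebraicGroup.smoothVectors π : Set (Lp ℂ 2 μ)))
    (C := (smoothFunctions (MulAction.orbit (G.levi h) x₀) :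
      Set (MulAction.orbit (G.levi h) x₀ → ℂ)))
    (RealAlgebraicGroup.continuous_orbit_smul (x₀ := x₀))
    (fun m E hE => (RealAlgebraicGroup.measure_preimage_levi_smul_eq_zero_iff hμν m hE).2) hcont
    (fun v hv => ?_) (χ := fun m => (ν m : ℂ)) (fun m => (ν m).ne_zero)
    (fun m v hv => ⟨_, RealAlgebraicGroup.smul_mem_smoothVectors π (m : G.realPoints) hv, hπM m v⟩)
    (x := ⟨x, hx⟩) (fun v hv f hf hvf => h0 v hv ⟨f, hf⟩ hvf) hv
  have hf := hrep v hv
  rcases hf with ⟨f, hf⟩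
  exact ⟨f, f.2, hf⟩
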